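/- **Setting.** Let $\mathfrak n,d\ge 1$ be integers, $\mathbb T=\mathbb R/2\pi\mathbb Z$, $\Omega=[1,2]^{\mathfrak n+d}\ni\widetilde\omega=(\omega,\nu)$, and $\langle x\rangle=(1+|x|^2)^{1/2}$. Operators $R$ on functions on $\mathbb T^d$ are identified with their matrices $(R_j^{j'})_{j,j'\in\mathbb Z^d}$ in the basis $e^{\mathrm i j\cdot x}$ ($R_j^{j'}$ is the coefficient of $e^{\mathrm i j\cdot x}$ in $R[e^{\mathrm i j'\cdot x}]$). For a family $R(\varphi)$, $\varphi\in\mathbb T^{\mathfrak n}$, with time Fourier coefficients $\widehat R(l)$, $l\in\mathbb Z^{\mathfrak n}$, put $$\|R\|^2_{\mathcal M^s_{\sigma_1,\sigma_2}}=\sum_{l\in\mathbb Z^{\mathfrak n}}\langle l\rangle^{2s}\sum_{k,k'\in\mathbb Z^d}\langle k\rangle^{2\sigma_2}|\widehat R(l)_k^{k'}|^2\langle k'\rangle^{-2\sigma_1},\qquad (\langle\nabla\rangle^\beta R)_j^{j'}=\langle j-j'\rangle^\beta R_j^{j'} ,$$ and let $\mathcal M^s_{\sigma_1,\sigma_2}$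 be the space of families of finite norm (for $s>\mathfrak n/2$ their entries are continuous in $\varphi$). For a function $f$ of $\widetilde\omega$ in a set $\mathcal O$, $\|f\|^{\mathrm{Lip}(g)}=\sup_{\mathcal O}\|f\|+g\sup_{\widetilde\omega_1\ne\widetilde\omega_2\in\mathcal O}\frac{\|f(\widetilde\omega_1)-f(\widetilde\omega_2)\|}{|\widetilde\omega_1-\widetilde\omega_2|}$ and $\mathrm{Lip}=\mathrm{Lip}(1)$; the set $\mathcal O$ is the domain on which $f$ is considered. Put $$\|R\|^{\mathrm{Lip}}_{s,\beta;\sigma_1,\sigma_2}=\|R\|^{\mathrm{Lip}}_{\mathcal M^{s+\beta}_{\sigma_1,\sigma_2}}+\|\langle\nabla\rangle^\beta R\|^{\mathrm{Lip}}_{\mathcal M^{s}_{\sigma_1,\sigma_2}} .$$ A family $R$ is *real* if $R(\varphi)$ maps real functions to real functions, i.e. $R_j^{j'}(\varphi)=\overline{R_{-j}^{-j'}(\varphi)}$, and *reversible* if $R(\varphi)\circ S=-S\circ R(-\varphi)$ with $(Su)(x)=u(-x)$. If $\Phi(\varphi)$ is invertible, $\Phi_{\omega*}H=\Phi^{-1}\big(H\Phi-\omega\cdot\partial_\varphi\Phi\big)$.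 Given $\tau>0$ let $\alpha=12\tau+7$, $\beta=\alpha+1$, $m=2\tau+2$; given $\gamma\in(0,1)$ let $N_0=\gamma^{-1}$, $N_k=N_0^{(3/2)^k}$ for $k\ge 0$, $N_{-1}=1$. **The system.** Let $K>0$, $\varepsilon>0$, $\mathfrak e>0$, $\tau>0$, $s>[\mathfrak n/2]+1$, $\sigma\ge0$. Let $\nu^{(0)}:\Omega\to\mathbb R^d$ satisfy $|\nu^{(0)}-\nu|^{\mathrm{Lip}(\gamma)}\le K\varepsilon$ on $\Omega$, and let $$\Omega_{0,\gamma}=\Big\{\widetilde\omega\in\Omega:\ |\omega\cdot l+\nu^{(0)}(\widetilde\omega)\cdot j|>\frac{\gamma}{\langle l,j\rangle^{\tau}}\ \ \forall (l,j)\in\mathbb Z^{\mathfrak n+d}\setminus\{0\}\Big\}.$$ For $\widetilde\omega\in\Omega_{0,\gamma}$ let $z(\xi)=z(\widetilde\omega,\xi)\in\mathbb C$ be differentiable in $\xi\in\mathbb R^d$ with $|z(\xi)|^{\mathrm{Lip}}\le K\varepsilon\langle\xi\rangle^{1-\mathfrak e}$ and $|\partial_\xi z(\xi)|^{\mathrm{Lip}}\le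 K\varepsilon$ for all $\xi$, and let $P_0(\varphi)=P_0(\varphi;\widetilde\omega)$ satisfy, on $\Omega_{0,\gamma}$, $$\|P_0\|^{\mathrm{Lip}}_{\mathcal M^s_{\sigma-m,\sigma+m}}\le K\varepsilon,\qquad \|P_0\|^{\mathrm{Lip}}_{s,\beta;\sigma-m,\sigma+m}\le K\varepsilon .$$ Let $Z=\mathrm{diag}_{j}z(j)$, $\lambda^{(0)}_j=\mathrm i\nu^{(0)}\cdot j+z(j)$, $A_0=\mathrm{diag}_{j\in\mathbb Z^d}\lambda_j^{(0)}$ and $H_0=A_0+P_0$. **Theorem (KAM reducibility).** There is an absolute constant $c>0$, and for all $\mathfrak n,d,\tau,s,\sigma,K$ as above there are constants $C_0>0$, $\delta\in(0,1)$, $C_*>0$, $C>0$ depending only on $\mathfrak n,d,\tau,s,\sigma,K$, such that for all $\gamma\in(0,1)$, $\varepsilon$, $\mathfrak e$, $\nu^{(0)}$, $z$, $P_0$ as above with $$N_0^{C_0}\varepsilon\le\delta$$ there are $\rho_j^{(k)}$, $P_k$, $X_k$, $\widetilde\lambda_j^{(k)}$ ($k\ge0$, $j\in\mathbb Z^d$),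 with $\rho_j^{(0)}=0$ and with $P_0$ the given family, such that the following holds for all $k\ge 0$. Put $\lambda_j^{(k)}=\lambda_j^{(0)}+\rho_j^{(k)}$, $A_k=\mathrm{diag}_j\lambda_j^{(k)}$, $H_k(\varphi)=A_k+P_k(\varphi)$, $\mathcal O_{0,\gamma}=\Omega_{0,\gamma}$ and $$\mathcal O_{k+1,\gamma}=\Big\{\widetilde\omega\in\mathcal O_{k,\gamma}:\ |\mathrm i\,\omega\cdot l+\lambda_j^{(k)}-\lambda_{j'}^{(k)}|\ge\frac{\gamma}{\langle l\rangle^\tau\langle j\rangle^\tau\langle j'\rangle^\tau}\ \ \forall (l,j,j')\ne(0,j,j),\ |l|,|j-j'|\le N_k\Big\}.$$ 1. On $\mathcal O_{k,\gamma}$: $\ \sup_j\langle j\rangle^{2m}|\rho_j^{(k)}|^{\mathrm{Lip}}\le C\varepsilon$; $\ P_k(\cdot;\widetilde\omega)\in\mathcal M^s_{\sigma-m,\sigma+m}$; and $$\|P_k\|^{\mathrm{Lip}}_{\mathcal M^s_{\sigma-m,\sigma+m}}\le C_*N_{k-1}^{-\alpha}\varepsilon,\qquad \|P_k\|^{\mathrm{Lip}}_{s,\beta;\sigma-m,\sigma+m}\le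 C_*N_{k-1}\varepsilon .$$ 2. For every $\widetilde\omega\in\mathcal O_{k+1,\gamma}$, $X_k\in\mathcal M^s_{\sigma+m,\sigma+m}\cap\mathcal M^s_{\sigma-m,\sigma-m}$, the map $\Phi_k=\mathrm{Id}+X_k$ is invertible with $\Phi_k^{-1}-\mathrm{Id}$ in the same two spaces, and $H_{k+1}=(\Phi_k)_{\omega*}H_k$. Moreover, on $\mathcal O_{k+1,\gamma}$, $$\|X_k\|^{\mathrm{Lip}}_{\mathcal M^s_{\sigma\pm m,\sigma\pm m}}\le C\,N_k^{4\tau+2}N_{k-1}^{-\alpha}\varepsilon$$ (for both choices of the sign). 3. If $P_0$ and $Z$ are real and reversible for all $\widetilde\omega\in\Omega_{0,\gamma}$, then $P_k$ is real and reversible and $\lambda_j^{(k)}\in\mathrm i\mathbb R$ for all $j$, for all $\widetilde\omega\in\mathcal O_{k,\gamma}$. 4. $\widetilde\lambda_j^{(k)}:\Omega_{0,\gamma}\to\mathbb C$ is a bounded Lipschitz extension of $\lambda_j^{(k)}:\mathcal O_{k,\gamma}\to\mathbb C$, and $$|\widetilde\lambda_j^{(k+1)}-\widetilde\lambda_j^{(k)}|^{\mathrm{Lip}}\le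 c\,\langle j\rangle^{-2m}\|P_k\|^{\mathrm{Lip}}_{\mathcal M^s_{\sigma-m,\sigma+m}},\qquad |\widetilde\lambda_j^{(k+1)}-\widetilde\lambda_j^{(k)}|^{\mathrm{Lip}}\le C\langle j\rangle^{-2m}N_{k-1}^{-\alpha}\varepsilon ,$$ where the norms on the left are taken over $\Omega_{0,\gamma}$ and $\|P_k\|^{\mathrm{Lip}}$ over $\mathcal O_{k,\gamma}$. -/

import Mathlib

open scoped ENNReal

noncomputable section

/-- The parameter space `ℝ^{𝔫+d}` of pairs `(ω, ν)`, with its Euclidean norm. -/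
abbrev Param (n d : ℕ) : Type := EuclideanSpace ℝ (Fin n ⊕ Fin d)

/-- The component `ω ∈ ℝ^𝔫` of a parameter `(ω, ν)`. -/
def freq {n d : ℕ} (w : Param n d) : Fin n → ℝ := fun i => w (Sum.inl i)

/-- The component `ν ∈ ℝ^d` of a parameter `(ω, ν)`. -/
def vel {n d : ℕ} (w : Param n d) : EuclideanSpace ℝ (Fin d) :=
  WithLp.toLp 2 (fun i => w (Sum.inr i))

/-- `Ω = [1,2]^{𝔫+d}`. -/
def paramBox (n d : ℕ) : Set (Param n d) := {w | ∀ i, 1 ≤ w i ∧ w i ≤ 2}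

/-- The Euclidean length `|l|` of an integer vector. -/
def intLen {p : ℕ} (l : Fin p → ℤ) : ℝ := Real.sqrt (∑ i, (l i : ℝ) ^ 2)

/-- `⟨l⟩ = (1 + |l|²)^{1/2}`. -/
def jap {p : ℕ} (l : Fin p → ℤ) : ℝ := Real.sqrt (1 + ∑ i, (l i : ℝ) ^ 2)

/-- `⟨l, j⟩ = (1 + |l|² + |j|²)^{1/2}`. -/
def jap₂ {n d : ℕ} (l : Fin n → ℤ) (j : Fin d → ℤ) : ℝ :=
  Real.sqrt (1 + ∑ i, (l i : ℝ) ^ 2 + ∑ i, (j i : ℝ) ^ 2)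

/-- The product `x · l` of a real and an integer vector. -/
def dotInt {p : ℕ} (x : Fin p → ℝ) (l : Fin p → ℤ) : ℝ := ∑ i, x i * (l i : ℝ)

/-- An integer vector as a point of `ℝ^d`. -/
def intVec {d : ℕ} (j : Fin d → ℤ) : EuclideanSpace ℝ (Fin d) :=
  WithLp.toLp 2 (fun i => (j i : ℝ))

/-- Operators on functions on `𝕋^d` are written as matrices in the basis `e^{i j·x}`, `j ∈ ℤ^d`:
`R j j'` is the coefficient of `e^{i j·x}` in `R[e^{i j'·x}]`. -/
abbrev OpMatrix (d : ℕ) : Type := Matrix (Fin d → ℤ) (Fin d → ℤ) ℂ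

/-- Operators depending on the angle `φ ∈ 𝕋^𝔫 = (ℝ/2πℤ)^𝔫`. The angle is written `φ = 2π θ` with
`θ ∈ (ℝ/ℤ)^𝔫`. -/
abbrev OpFamily (n d : ℕ) : Type := UnitAddTorus (Fin n) → OpMatrix d

/-- The operator `R̂(l)`, with entries
`(2π)^{-𝔫} ∫ R(φ)_j^{j'} e^{-i l·φ} dφ`. -/
def timeCoeff {n d : ℕ} (R : OpFamily n d) (l : Fin n → ℤ) : OpMatrix d :=
  fun j j' => UnitAddTorus.mFourierCoeff (fun θ => R θ j j') l

/-- The norm `‖R‖^{HS}_{σ₁,σ₂}`, the square root of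
`∑_{k,k'} ⟨k⟩^{2σ₂} |R_k^{k'}|² ⟨k'⟩^{-2σ₁}`. -/
def hsNorm {d : ℕ} (σ₁ σ₂ : ℝ) (R : OpMatrix d) : ℝ≥0∞ :=
  (∑' k : Fin d → ℤ, ∑' k' : Fin d → ℤ,
    ENNReal.ofReal (jap k ^ (2 * σ₂) * ‖R k k'‖ ^ 2 * jap k' ^ (-(2 * σ₁)))) ^ (1 / 2 : ℝ)

/-- The norm of `ℳ^s_{σ₁,σ₂} = ℋ^s(𝕋^𝔫; ℬ^{HS}(ℋ^{σ₁}, ℋ^{σ₂}))`. -/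
def mNorm {n d : ℕ} (s σ₁ σ₂ : ℝ) (R : OpFamily n d) : ℝ≥0∞ :=
  (∑' l : Fin n → ℤ,
    ENNReal.ofReal (jap l ^ (2 * s)) * hsNorm σ₁ σ₂ (timeCoeff R l) ^ 2) ^ (1 / 2 : ℝ)

/-- `R ∈ ℳ^s_{σ₁,σ₂}`, for `s > 𝔫/2`: such a class of functions has exactly one representative
with continuous entries, and `R` is that representative. -/
def MemM {n d : ℕ} (s σ₁ σ₂ : ℝ) (R : OpFamily n d) : Prop :=
  (∀ j j', Continuous fun θ => R θ j j') ∧ mNorm s σ₁ σ₂ R < ⊤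

/-- `(⟨∇⟩^β R)_j^{j'} = ⟨j - j'⟩^β R_j^{j'}`. -/
def nablaPow {n d : ℕ} (β : ℝ) (R : OpFamily n d) : OpFamily n d :=
  fun θ j j' => ((jap (j - j') ^ β : ℝ) : ℂ) * R θ j j'

/-- The norm `‖f‖^{Lip(g)} = ‖f‖^{sup} + g ‖f‖^{lip}` over the parameter set `O`, with values in
`[0, ∞]`, for functions into a space whose norm is `N`. -/
def lipNorm {n d : ℕ} {E : Type*} [Sub E] (N : E → ℝ≥0∞) (g : ℝ) (O : Set (Param n d))
    (f : Param n d → E) : ℝ≥0∞ :=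
  (⨆ w ∈ O, N (f w)) +
    ENNReal.ofReal g *
      ⨆ w₁ ∈ O, ⨆ w₂ ∈ O, ⨆ (_ : w₁ ≠ w₂), N (f w₁ - f w₂) / ENNReal.ofReal ‖w₁ - w₂‖

/-- The norm `|f|^{Lip(g)}` of a function with values in a normed space. -/
def lipNormVal {n d : ℕ} {E : Type*} [NormedAddCommGroup E] (g : ℝ) (O : Set (Param n d))
    (f : Param n d → E) : ℝ≥0∞ :=
  lipNorm (fun x : E => ‖x‖ₑ) g O f

/-- The norm `‖R‖^{Lip}` of `ℳ^s_{σ₁,σ₂}` over `O`. -/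
def mLip {n d : ℕ} (s σ₁ σ₂ : ℝ) (O : Set (Param n d)) (R : Param n d → OpFamily n d) : ℝ≥0∞ :=
  lipNorm (mNorm s σ₁ σ₂) 1 O R

/-- The higher regularity norm
`‖R‖^{Lip}_{ℳ^{s+β}_{σ₁,σ₂}} + ‖⟨∇⟩^β R‖^{Lip}_{ℳ^s_{σ₁,σ₂}}`. -/
def mLipHigh {n d : ℕ} (β s σ₁ σ₂ : ℝ) (O : Set (Param n d))
    (R : Param n d → OpFamily n d) : ℝ≥0∞ :=
  mLip (s + β) σ₁ σ₂ O R + mLip s σ₁ σ₂ O (fun w => nablaPow β (R w))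

/-- `C` is the product of the infinite matrices `A` and `B`: every entry is the sum of an
absolutely convergent series. -/
def HasMatMul {d : ℕ} (A B C : OpMatrix d) : Prop :=
  ∀ j j', HasSum (fun k => A j k * B k j') (C j j')

/-- The point `φ + t ω` of the torus, where `φ = 2π θ`. -/
def torusShift {n : ℕ} (θ : UnitAddTorus (Fin n)) (ω : Fin n → ℝ) (t : ℝ) :
    UnitAddTorus (Fin n) :=
  fun i => θ i + ((t * ω i / (2 * Real.pi) : ℝ) : UnitAddCircle)

/-- `D = ω · ∂_φ Φ`, entry by entry. -/
def HasOmegaDeriv {n d : ℕ} (ω : Fin n → ℝ) (Φ D : OpFamily n d) : Prop :=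
  ∀ θ j j', HasDerivAt (fun t : ℝ => Φ (torusShift θ ω t) j j') (D θ j j') 0

/-- `Φ` is invertible with inverse `Ψ`, and `Ψ - Id` belongs to `ℳ^s_{a,a}` and `ℳ^s_{b,b}`. -/
def HasInverse {n d : ℕ} (s a b : ℝ) (Φ Ψ : OpFamily n d) : Prop :=
  (∀ θ, HasMatMul (Ψ θ) (Φ θ) 1 ∧ HasMatMul (Φ θ) (Ψ θ) 1) ∧
    MemM s a a (fun θ => Ψ θ - 1) ∧ MemM s b b (fun θ => Ψ θ - 1)

/-- `Φ` is invertible and `H' = Φ_{ω*} H = Φ⁻¹ (H Φ - ω · ∂_φ Φ)`. -/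
def IsPushforward {n d : ℕ} (s a b : ℝ) (ω : Fin n → ℝ) (Φ H H' : OpFamily n d) : Prop :=
  ∃ Ψ D G : OpFamily n d, HasInverse s a b Φ Ψ ∧ HasOmegaDeriv ω Φ D ∧
    (∀ θ, HasMatMul (H θ) (Φ θ) (G θ)) ∧
    ∀ θ, HasMatMul (Ψ θ) (G θ - D θ) (H' θ)

/-- `R = R̄`, where `R̄[u]` is the complex conjugate of `R[ū]`; since the conjugate of `e^{i j·x}`
is `e^{-i j·x}`, the matrix of `R̄` is the conjugate of `R_{-j}^{-j'}`. -/
def IsRealFamily {n d : ℕ} (R : OpFamily n d) : Prop :=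
  ∀ θ j j', R θ j j' = (starRingEnd ℂ) (R θ (-j) (-j'))

/-- `R(φ) ∘ S = - S ∘ R(-φ)`, where `(S u)(x) = u(-x)`, that is `S e^{i j·x} = e^{-i j·x}`. -/
def IsReversibleFamily {n d : ℕ} (R : OpFamily n d) : Prop :=
  ∀ θ j j', R θ j (-j') = -R (-θ) (-j) j'

/-- `α = 12 τ + 7`. -/
def kamAlpha (τ : ℝ) : ℝ := 12 * τ + 7

/-- `β = α + 1`. -/
def kamBeta (τ : ℝ) : ℝ := kamAlpha τ + 1

/-- `m = 2 τ + 2`. -/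
def kamM (τ : ℝ) : ℝ := 2 * τ + 2

/-- `N_k = N₀^{(3/2)^k}` for `k ≥ 0` and `N_{-1} = 1`. -/
def kamScale (N₀ : ℝ) (k : ℤ) : ℝ := if k < 0 then 1 else N₀ ^ ((3 / 2 : ℝ) ^ k)

/-- `Ω_{0,γ}`: the parameters in `Ω` with `|ω·l + ν⁽⁰⁾·j| > γ / ⟨l,j⟩^τ` for `(l,j) ≠ 0`. -/
def diophSet {n d : ℕ} (γ τ : ℝ) (ν₀ : Param n d → EuclideanSpace ℝ (Fin d)) :
    Set (Param n d) :=
  {w | w ∈ paramBox n d ∧ ∀ (l : Fin n → ℤ) (j : Fin d → ℤ), ¬(l = 0 ∧ j = 0) →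
    γ / jap₂ l j ^ τ < |dotInt (freq w) l + dotInt (ν₀ w) j|}

/-- The eigenvalues `λ_j⁽⁰⁾ = i ν⁽⁰⁾·j + z(j)`. -/
def initEig {n d : ℕ} (ν₀ : Param n d → EuclideanSpace ℝ (Fin d))
    (z : Param n d → EuclideanSpace ℝ (Fin d) → ℂ) (j : Fin d → ℤ) (w : Param n d) : ℂ :=
  Complex.I * (dotInt (ν₀ w) j : ℂ) + z w (intVec j)

/-- The nested sets `𝒪_{k,γ}` given by the second Melnikov conditions on the eigenvalues
`lam k j = λ_j⁽ᵏ⁾`, starting from `𝒪_{0,γ} = O₀`. -/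
def melnikovSet {n d : ℕ} (γ τ : ℝ) (O₀ : Set (Param n d))
    (lam : ℕ → (Fin d → ℤ) → Param n d → ℂ) : ℕ → Set (Param n d)
  | 0 => O₀
  | k + 1 => {w | w ∈ melnikovSet γ τ O₀ lam k ∧
      ∀ (l : Fin n → ℤ) (j j' : Fin d → ℤ), ¬(l = 0 ∧ j = j') →
        intLen l ≤ kamScale γ⁻¹ k → intLen (j - j') ≤ kamScale γ⁻¹ k →
        γ / (jap l ^ τ * jap j ^ τ * jap j' ^ τ) ≤
          ‖Complex.I * (dotInt (freq w) l : ℂ) + lam k j w - lam k j' w‖}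

/-- The vector field `diag_j λ_j + P(φ)`. -/
def diagPlus {n d : ℕ} (lam : (Fin d → ℤ) → ℂ) (P : OpFamily n d) : OpFamily n d :=
  fun θ => Matrix.diagonal lam + P θ

end

/-!
# KAM reducibility

A family of operators is represented by the array `x l j j'` of its time Fourier coefficients. On
arrays, composition of families becomes a convolution in `l` combined with the matrix product in the
space indices (`conv`), and all norms involved are weighted `ℓ²` norms (`nrm`), with weight
`V(l, j - j')` equal to `1` for the low norm and to `⟨l⟩^β + ⟨j - j'⟩^β` for the high norm. Since
`s > 𝔫/2`, the low norm is submultiplicative and the high norm obeys a tame product estimate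
(`eNorm_econv_le`); arrays of finite norm are exactly the coefficients of families with continuous
entries (`timeCoeff_ev`, `ev_timeCoeff`).

One step of the iteration starts from `diag λ + p`, splits off the modes `|l|, |j - j'| ≤ N`, and
solves the homological equation `ω · ∂_φ x = [diag λ, x] + Π_N p - diag p̂(0)` by division by the
divisors `i ω·l - λ_j + λ_{j'}`. The second Melnikov conditions lose `⟨l⟩^τ ⟨j⟩^τ ⟨j'⟩^τ`, and twice
as much for Lipschitz dependence on the parameter. The powers of `⟨j⟩` and `⟨j'⟩` are paid for by the
smoothing of `p` (`jap_rpow_mul_le`), the powers of `⟨l⟩` and `⟨j - j'⟩` by a factor `N^{4τ+1}`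
(`lipBd_solA`). The map `1 + x` is inverted by a Neumann series and conjugates `diag λ + p` to
`diag (λ + p̂(0)) + p'` (`isPushforward_step`), where `p'` consists of the truncation error, of size
`N^{-β}` times the high norm of `p`, and of a term quadratic in `p`, while the high norm grows at most
by a factor three (`lipBd_stepA`).

Along the scales `N_k` the low norm of the `k`-th perturbation is of order
`N_{k-1}^{-β} N_{k-2} ε` and its high norm of order `N_{k-1} ε`; the choice of `β` makes this stable
(`sq_mul_rpow_mul_kamErr_sq_le`, `KamHyp.bounds`). When `γ` is close to `1` the scales grow slowly at
first. As long as `N_k < 27` no step is carried out, which costs only a constant factor; from then on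
`N_k ≥ 3 N_{k-1}`, so that the growth of the high norm is compatible with the scales and the
corrections of the eigenvalues sum up. The eigenvalues are Lipschitz in the parameter, with
differences growing at most linearly in `j - j'` by the mean value inequality for the symbol
(`norm_divisor_sub_le`), and their increments extend from `𝒪_k` to all of `Ω_{0,γ}` by McShane's
extension (`exists_extensions`). Real and reversible families are those whose coefficients are purely
imaginary and odd under `(l, j, j') ↦ -(l, j, j')`, a property that the step preserves
(`kamState_parity`).
-/

open scoped ENNReal

noncomputable section

/-! ### The `ℓ²` norm with values in `[0, ∞]` -/

/-- The `ℓ²` norm of a family with values in `[0, ∞]`. -/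
def sq2 {ι : Type*} (f : ι → ℝ≥0∞) : ℝ≥0∞ := (∑' i, f i ^ 2) ^ (1 / 2 : ℝ)

section EllTwo

variable {ι κ : Type*}

theorem sq2_sq (f : ι → ℝ≥0∞) : sq2 f ^ 2 = ∑' i, f i ^ 2 := by
  rw [sq2, ← ENNReal.rpow_natCast, ← ENNReal.rpow_mul]
  norm_num

theorem sq2_mono {f g : ι → ℝ≥0∞} (h : ∀ i, f i ≤ g i) : sq2 f ≤ sq2 g := by
  unfold sq2
  gcongr with i
  exact h i

theorem sq2_le_iff {f : ι → ℝ≥0∞} {c : ℝ≥0∞} : sq2 f ≤ c ↔ ∑' i, f i ^ 2 ≤ c ^ 2 := by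
  rw [← sq2_sq]
  exact (ENNReal.pow_le_pow_left_iff two_ne_zero).symm

theorem le_sq2 (f : ι → ℝ≥0∞) (i : ι) : f i ≤ sq2 f := by
  rw [← ENNReal.pow_le_pow_left_iff two_ne_zero, sq2_sq]
  exact ENNReal.le_tsum i

theorem sq2_const_mul (c : ℝ≥0∞) (f : ι → ℝ≥0∞) : sq2 (fun i => c * f i) = c * sq2 f := by
  unfold sq2
  simp_rw [mul_pow]
  rw [ENNReal.tsum_mul_left, ENNReal.mul_rpow_of_nonneg _ _ (by norm_num),
    ← ENNReal.rpow_natCast, ← ENNReal.rpow_mul]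
  norm_num

theorem sq2_equiv (e : κ ≃ ι) (f : ι → ℝ≥0∞) : sq2 (fun i => f (e i)) = sq2 f := by
  unfold sq2
  rw [Equiv.tsum_eq e (fun i => f i ^ 2)]

theorem sq2_add_le (f g : ι → ℝ≥0∞) : sq2 (fun i => f i + g i) ≤ sq2 f + sq2 g := by
  let _ : MeasurableSpace ι := ⊤
  have h := ENNReal.lintegral_Lp_add_le (μ := MeasureTheory.Measure.count) (p := 2)
    (f := f) (g := g) measurable_from_top.aemeasurable measurable_from_top.aemeasurable
    (by norm_num)
  simp only [MeasureTheory.lintegral_count, Pi.add_apply, ENNReal.rpow_two] at h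
  exact h

theorem tsum_mul_le_sq2 (f g : ι → ℝ≥0∞) : ∑' i, f i * g i ≤ sq2 f * sq2 g := by
  let _ : MeasurableSpace ι := ⊤
  have h := ENNReal.lintegral_mul_le_Lp_mul_Lq (μ := MeasureTheory.Measure.count)
    (Real.HolderConjugate.two_two)
    (f := f) (g := g) measurable_from_top.aemeasurable measurable_from_top.aemeasurable
  simp only [MeasureTheory.lintegral_count, Pi.mul_apply, ENNReal.rpow_two] at h
  exact h

/-- Minkowski's inequality for infinitely many summands. -/
theorem sq2_tsum_le (f : κ → ι → ℝ≥0∞) : sq2 (fun i => ∑' n, f n i) ≤ ∑' n, sq2 (f n) := by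
  classical
  have hfin : ∀ s : Finset κ, sq2 (fun i => ∑ n ∈ s, f n i) ≤ ∑ n ∈ s, sq2 (f n) := by
    intro s
    induction s using Finset.induction_on with
    | empty => simp [sq2]
    | insert a s ha ih =>
      simp only [Finset.sum_insert ha]
      exact (sq2_add_le _ _).trans (by gcongr)
  rw [sq2_le_iff, ENNReal.tsum_eq_iSup_sum]
  refine iSup_le fun t => ?_
  -- finitely many coordinates: pass to the limit in the finite partial sums over `n`
  have hlim : Filter.Tendsto (fun s : Finset κ => ∑ i ∈ t, (∑ n ∈ s, f n i) ^ 2) Filter.atTop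
      (nhds (∑ i ∈ t, (∑' n, f n i) ^ 2)) := by
    refine tendsto_finsetSum _ fun i _ => ?_
    exact (ENNReal.continuous_pow 2).continuousAt.tendsto.comp ENNReal.summable.hasSum
  refine le_of_tendsto hlim (Filter.Eventually.of_forall fun s => ?_)
  calc ∑ i ∈ t, (∑ n ∈ s, f n i) ^ 2 ≤ ∑' i, (∑ n ∈ s, f n i) ^ 2 := ENNReal.sum_le_tsum t
    _ = sq2 (fun i => ∑ n ∈ s, f n i) ^ 2 := (sq2_sq _).symm
    _ ≤ (∑' n, sq2 (f n)) ^ 2 := by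
        gcongr
        exact (hfin s).trans (ENNReal.sum_le_tsum s)

theorem sq2_prod (f : ι × κ → ℝ≥0∞) : sq2 f = sq2 (fun i => sq2 fun k => f (i, k)) := by
  have h : ∀ i, sq2 (fun k => f (i, k)) ^ 2 = ∑' k, f (i, k) ^ 2 := fun i => sq2_sq _
  rw [sq2, sq2]
  simp_rw [h]
  rw [ENNReal.tsum_prod']

/-- The Hilbert--Schmidt norm is submultiplicative. -/
theorem sq2_matMul_le {μ : Type*} (f : ι → κ → ℝ≥0∞) (g : κ → μ → ℝ≥0∞) :
    sq2 (fun t : ι × μ => ∑' k, f t.1 k * g k t.2) ≤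
      sq2 (fun t : ι × κ => f t.1 t.2) * sq2 (fun t : κ × μ => g t.1 t.2) := by
  have hg : sq2 (fun j => sq2 fun k => g k j) = sq2 (fun t : κ × μ => g t.1 t.2) := by
    rw [← sq2_equiv (Equiv.prodComm μ κ), sq2_prod]
    rfl
  rw [← hg, sq2_prod, sq2_prod (fun t : ι × κ => f t.1 t.2)]
  calc sq2 (fun i => sq2 fun j => ∑' k, f i k * g k j)
      ≤ sq2 (fun i => sq2 fun j => sq2 (f i) * sq2 fun k => g k j) :=
        sq2_mono fun i => sq2_mono fun j => tsum_mul_le_sq2 _ _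
    _ = _ := by
        simp_rw [sq2_const_mul, mul_comm _ (sq2 fun j => sq2 fun k => g k j), sq2_const_mul]

/-- Young's inequality `ℓ² ∗ ℓ¹ ⊂ ℓ²`. -/
theorem sq2_convolution_le {G : Type*} [AddCommGroup G] (u v : G → ℝ≥0∞) :
    sq2 (fun l => ∑' m, u (l - m) * v m) ≤ sq2 u * ∑' m, v m := by
  refine (sq2_tsum_le _).trans ?_
  rw [mul_comm, ← ENNReal.tsum_mul_right]
  refine ENNReal.tsum_le_tsum fun m => ?_
  simp_rw [mul_comm _ (v m), sq2_const_mul]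
  exact mul_le_mul_right (sq2_equiv (Equiv.subRight m) u).le _

theorem convolution_comm {G : Type*} [AddCommGroup G] (u v : G → ℝ≥0∞) (l : G) :
    ∑' m, u (l - m) * v m = ∑' m, v (l - m) * u m := by
  rw [← Equiv.tsum_eq (Equiv.subLeft l)]
  simp [mul_comm]

/-- Young's inequality `ℓ¹ ∗ ℓ² ⊂ ℓ²`. -/
theorem sq2_convolution_le' {G : Type*} [AddCommGroup G] (u v : G → ℝ≥0∞) :
    sq2 (fun l => ∑' m, u (l - m) * v m) ≤ (∑' m, u m) * sq2 v := by
  simp_rw [convolution_comm u v]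
  rw [mul_comm]
  exact sq2_convolution_le v u

end EllTwo

/-! ### Japanese brackets and weighted norms of arrays -/

section JapaneseBracket

variable {p : ℕ}

theorem intLen_eq_norm (l : Fin p → ℤ) : intLen l = ‖intVec l‖ := by
  simp [intLen, intVec, EuclideanSpace.norm_eq]

theorem intLen_nonneg (l : Fin p → ℤ) : 0 ≤ intLen l := Real.sqrt_nonneg _

theorem jap_sq (l : Fin p → ℤ) : jap l ^ 2 = 1 + intLen l ^ 2 := by
  rw [jap, intLen, Real.sq_sqrt (by positivity), Real.sq_sqrt (by positivity)]

theorem one_le_jap (l : Fin p → ℤ) : 1 ≤ jap l := by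
  rw [jap, Real.one_le_sqrt]
  have : 0 ≤ ∑ i, (l i : ℝ) ^ 2 := by positivity
  linarith

theorem jap_pos (l : Fin p → ℤ) : 0 < jap l := zero_lt_one.trans_le (one_le_jap l)

theorem intLen_le_jap (l : Fin p → ℤ) : intLen l ≤ jap l := by
  refine Real.sqrt_le_sqrt ?_
  linarith

theorem jap_le_one_add_intLen (l : Fin p → ℤ) : jap l ≤ 1 + intLen l := by
  have h := jap_sq l
  have h1 := intLen_nonneg l
  exact abs_le_of_sq_le_sq' (by nlinarith) (by linarith) |>.2

theorem intLen_add_le (a b : Fin p → ℤ) : intLen (a + b) ≤ intLen a + intLen b := by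
  have : intVec (a + b) = intVec a + intVec b := by
    ext i
    simp [intVec]
  rw [intLen_eq_norm, intLen_eq_norm, intLen_eq_norm, this]
  exact norm_add_le _ _

theorem intVec_sub (a b : Fin p → ℤ) : intVec (a - b) = intVec a - intVec b := by
  ext i
  simp [intVec]

@[simp] theorem jap_neg (l : Fin p → ℤ) : jap (-l) = jap l := by simp [jap]

@[simp] theorem intLen_neg (l : Fin p → ℤ) : intLen (-l) = intLen l := by simp [intLen]

theorem jap_zero : jap (0 : Fin p → ℤ) = 1 := by simp [jap]

theorem jap_add_le (a b : Fin p → ℤ) : jap (a + b) ≤ jap a + jap b := by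
  have h := jap_sq (a + b)
  have h1 := jap_sq a
  have h2 := jap_sq b
  have h3 := intLen_add_le a b
  have h4 := mul_le_mul (intLen_le_jap a) (intLen_le_jap b) (intLen_nonneg b) (jap_pos a).le
  have h5 := intLen_nonneg (a + b)
  refine abs_le_of_sq_le_sq' ?_ (add_pos (jap_pos a) (jap_pos b)).le |>.2
  nlinarith

theorem jap_add_le_mul (a b : Fin p → ℤ) : jap (a + b) ≤ 2 * (jap a * jap b) := by
  have h := jap_add_le a b
  nlinarith [one_le_jap a, one_le_jap b]

theorem add_rpow_le_two_rpow {a b r : ℝ} (ha : 0 ≤ a) (hb : 0 ≤ b) (hr : 0 ≤ r) :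
    (a + b) ^ r ≤ 2 ^ r * (a ^ r + b ^ r) := by
  have h : ∀ {x y : ℝ}, 0 ≤ x → 0 ≤ y → x ≤ y → (x + y) ^ r ≤ 2 ^ r * (x ^ r + y ^ r) := by
    intro x y hx hy hxy
    calc (x + y) ^ r ≤ (2 * y) ^ r := Real.rpow_le_rpow (by linarith) (by linarith) hr
      _ = 2 ^ r * y ^ r := Real.mul_rpow (by norm_num) hy
      _ ≤ _ := by
        gcongr
        linarith [Real.rpow_nonneg hx r]
  rcases le_total a b with hab | hab
  · exact h ha hb hab
  · rw [add_comm a, add_comm (a ^ r)]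
    exact h hb ha hab

theorem jap_rpow_add_le {r : ℝ} (hr : 0 ≤ r) (a b : Fin p → ℤ) :
    jap (a + b) ^ r ≤ 2 ^ r * (jap a ^ r + jap b ^ r) :=
  (Real.rpow_le_rpow (jap_pos _).le (jap_add_le a b) hr).trans
    (add_rpow_le_two_rpow (jap_pos a).le (jap_pos b).le hr)

theorem summable_jap_rpow {r : ℝ} (hr : r < -(p : ℝ)) :
    Summable fun l : Fin p → ℤ => jap l ^ r := by
  classical
  let b := Pi.basisFun ℝ (Fin p)
  let Λ : Submodule ℤ (Fin p → ℝ) := Submodule.span ℤ (Set.range b)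
  have hmem : ∀ l : Fin p → ℤ, (fun i => (l i : ℝ)) ∈ Λ := by
    intro l
    have : (fun i => (l i : ℝ)) = ∑ i, l i • b i := by
      ext i
      simp [b, Finset.sum_apply, Pi.single_apply]
    rw [this]
    exact Submodule.sum_mem _ fun i _ =>
      Submodule.smul_mem _ _ (Submodule.subset_span ⟨i, rfl⟩)
  let e : (Fin p → ℤ) → Λ := fun l => ⟨fun i => (l i : ℝ), hmem l⟩
  have he : Function.Injective e := by
    intro l m h
    ext i
    have : (l i : ℝ) = m i := congrFun (congrArg Subtype.val h) i
    exact_mod_cast this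
  have hrank : Module.finrank ℤ Λ = p := by
    rw [ZLattice.rank ℝ Λ]
    simp
  have h := (ZLattice.summable_norm_rpow Λ r (by rw [hrank]; exact hr)).comp_injective he
  have h0 : r < 0 := hr.trans_le (by simp)
  refine Summable.of_nonneg_of_le (fun l => (Real.rpow_pos_of_pos (jap_pos l) r).le) (fun l => ?_)
    (h.add (hasSum_ite_eq (0 : Fin p → ℤ) (1 : ℝ)).summable)
  by_cases hl : l = 0
  · subst hl
    have : 0 ≤ ‖e 0‖ ^ r := by positivity
    simp only [Function.comp_apply, if_true, jap_zero, Real.one_rpow]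
    linarith
  · simp only [Function.comp_apply, if_neg hl, add_zero]
    refine Real.rpow_le_rpow_of_nonpos ?_ ?_ h0.le
    · rw [norm_pos_iff]
      intro hz
      exact hl (he (hz.trans (by ext i; simp [e])))
    · refine le_trans ?_ (intLen_le_jap l)
      change ‖(fun i => (l i : ℝ))‖ ≤ _
      rw [pi_norm_le_iff_of_nonneg (intLen_nonneg l)]
      intro i
      rw [intLen_eq_norm]
      exact (PiLp.norm_apply_le (intVec l) i)

end JapaneseBracket

section WeightedArrays

variable {n d : ℕ}

/-- Families of nonnegative coefficients indexed by a time frequency and a matrix entry. -/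
abbrev EArr (n d : ℕ) : Type := (Fin n → ℤ) → (Fin d → ℤ) → (Fin d → ℤ) → ℝ≥0∞

/-- The product of two families of operators, on the side of the time Fourier coefficients:
convolution in `l`, matrix product in `(j, j')`. -/
def econv (f g : EArr n d) : EArr n d := fun l j j' =>
  ∑' t : (Fin n → ℤ) × (Fin d → ℤ), f (l - t.1) j t.2 * g t.1 t.2 j'

/-- The weight `V(l, j - j') ⟨j⟩^b ⟨j'⟩^{-a}` of a coefficient. -/
def wt (V : (Fin n → ℤ) → (Fin d → ℤ) → ℝ) (a b : ℝ) (l : Fin n → ℤ) (j j' : Fin d → ℤ) : ℝ :=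
  V l (j - j') * (jap j ^ b * jap j' ^ (-a))

/-- The norm of `ℳ^s_{a,b}` with the additional weight `V(l, j - j')`, for nonnegative
coefficients. -/
def eNorm (s : ℝ) (V : (Fin n → ℤ) → (Fin d → ℤ) → ℝ) (a b : ℝ) (f : EArr n d) : ℝ≥0∞ :=
  sq2 fun t : (Fin n → ℤ) × (Fin d → ℤ) × (Fin d → ℤ) =>
    ENNReal.ofReal (jap t.1 ^ s) * (ENNReal.ofReal (wt V a b t.1 t.2.1 t.2.2) * f t.1 t.2.1 t.2.2)

theorem eNorm_mono {s : ℝ} {V : (Fin n → ℤ) → (Fin d → ℤ) → ℝ} {a b : ℝ} {f g : EArr n d}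
    (h : ∀ l j j', f l j j' ≤ g l j j') : eNorm s V a b f ≤ eNorm s V a b g :=
  sq2_mono fun t => by gcongr; exact h _ _ _

theorem eNorm_add_le {s : ℝ} {V : (Fin n → ℤ) → (Fin d → ℤ) → ℝ} {a b : ℝ} (f g : EArr n d) :
    eNorm s V a b (f + g) ≤ eNorm s V a b f + eNorm s V a b g := by
  refine le_trans (le_of_eq ?_) (sq2_add_le _ _)
  simp only [eNorm, Pi.add_apply, mul_add]

theorem eNorm_tsum_le {κ : Type*} {s : ℝ} {V : (Fin n → ℤ) → (Fin d → ℤ) → ℝ} {a b : ℝ}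
    (f : κ → EArr n d) :
    eNorm s V a b (fun l j j' => ∑' i, f i l j j') ≤ ∑' i, eNorm s V a b (f i) := by
  refine le_trans (le_of_eq ?_) (sq2_tsum_le _)
  simp only [eNorm, ENNReal.tsum_mul_left]

/-- The operator-valued time coefficients enter through their Hilbert--Schmidt norms. -/
theorem eNorm_eq_sq2 (s : ℝ) (V : (Fin n → ℤ) → (Fin d → ℤ) → ℝ) (a b : ℝ) (f : EArr n d) :
    eNorm s V a b f = sq2 fun l => ENNReal.ofReal (jap l ^ s) *
      sq2 fun t : (Fin d → ℤ) × (Fin d → ℤ) =>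
        ENNReal.ofReal (wt V a b l t.1 t.2) * f l t.1 t.2 := by
  rw [eNorm, sq2_prod]
  simp_rw [sq2_const_mul]

theorem sq2_econv_le (f g : EArr n d) (l : Fin n → ℤ) :
    sq2 (fun t : (Fin d → ℤ) × (Fin d → ℤ) => econv f g l t.1 t.2) ≤
      ∑' m, sq2 (fun t : (Fin d → ℤ) × (Fin d → ℤ) => f (l - m) t.1 t.2) *
        sq2 (fun t : (Fin d → ℤ) × (Fin d → ℤ) => g m t.1 t.2) := by
  have h : (fun t : (Fin d → ℤ) × (Fin d → ℤ) => econv f g l t.1 t.2) =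
      fun t => ∑' m, ∑' i, f (l - m) t.1 i * g m i t.2 := by
    ext t
    rw [econv, ENNReal.tsum_prod']
  rw [h]
  exact (sq2_tsum_le _).trans (ENNReal.tsum_le_tsum fun m => sq2_matMul_le _ _)

/-- The constant `(∑_l ⟨l⟩^{-2s})^{1/2}` of the embedding of `ℋ^s` into the absolutely convergent
Fourier series. -/
def embConst (n : ℕ) (s : ℝ) : ℝ≥0∞ := sq2 fun l : Fin n → ℤ => ENNReal.ofReal (jap l ^ (-s))

theorem embConst_lt_top {s : ℝ} (hs : (n : ℝ) < 2 * s) : embConst n s < ⊤ := by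
  have h := summable_jap_rpow (p := n) (r := -(2 * s)) (by linarith)
  refine ENNReal.rpow_lt_top_of_nonneg (by norm_num) ?_
  have h1 : ∀ l : Fin n → ℤ, ENNReal.ofReal (jap l ^ (-s)) ^ 2 =
      ENNReal.ofReal (jap l ^ (-(2 * s))) := by
    intro l
    rw [← ENNReal.ofReal_pow (Real.rpow_pos_of_pos (jap_pos l) _).le, ← Real.rpow_natCast,
      ← Real.rpow_mul (jap_pos l).le]
    congr 2
    push_cast
    ring
  simp_rw [h1]
  rw [← ENNReal.ofReal_tsum_of_nonneg (fun l => (Real.rpow_pos_of_pos (jap_pos l) _).le) h]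
  exact ENNReal.ofReal_ne_top

theorem tsum_le_embConst_mul (s : ℝ) (u : (Fin n → ℤ) → ℝ≥0∞) :
    ∑' l, u l ≤ embConst n s * sq2 fun l => ENNReal.ofReal (jap l ^ s) * u l := by
  refine le_trans (le_of_eq ?_) (tsum_mul_le_sq2 _ _)
  refine tsum_congr fun l => ?_
  rw [← mul_assoc, ← ENNReal.ofReal_mul (Real.rpow_pos_of_pos (jap_pos l) _).le,
    ← Real.rpow_add (jap_pos l)]
  simp

/-- `ℋ^s(𝕋^𝔫)` is an algebra for `s > 𝔫/2`. -/
theorem sq2_jap_convolution_le {s : ℝ} (hs : 0 ≤ s) (u v : (Fin n → ℤ) → ℝ≥0∞) :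
    sq2 (fun l => ENNReal.ofReal (jap l ^ s) * ∑' m, u (l - m) * v m) ≤
      ENNReal.ofReal (2 ^ s) * 2 * embConst n s *
        ((sq2 fun l => ENNReal.ofReal (jap l ^ s) * u l) *
          sq2 fun l => ENNReal.ofReal (jap l ^ s) * v l) := by
  set U := fun l => ENNReal.ofReal (jap l ^ s) * u l with hU
  set W := fun l => ENNReal.ofReal (jap l ^ s) * v l with hW
  have h1 : ∀ l, ENNReal.ofReal (jap l ^ s) * ∑' m, u (l - m) * v m ≤
      ENNReal.ofReal (2 ^ s) * (∑' m, U (l - m) * v m + ∑' m, u (l - m) * W m) := by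
    intro l
    rw [← ENNReal.tsum_add, ← ENNReal.tsum_mul_left, ← ENNReal.tsum_mul_left]
    refine ENNReal.tsum_le_tsum fun m => ?_
    have h2 : ENNReal.ofReal (jap l ^ s) ≤ ENNReal.ofReal (2 ^ s) *
        (ENNReal.ofReal (jap (l - m) ^ s) + ENNReal.ofReal (jap m ^ s)) := by
      rw [← ENNReal.ofReal_add (Real.rpow_pos_of_pos (jap_pos _) _).le
        (Real.rpow_pos_of_pos (jap_pos _) _).le, ← ENNReal.ofReal_mul (by positivity)]
      refine ENNReal.ofReal_le_ofReal ?_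
      have := jap_rpow_add_le hs (l - m) m
      rwa [sub_add_cancel] at this
    calc _ ≤ _ := mul_le_mul_left h2 _
      _ = _ := by simp only [hU, hW]; ring
  refine (sq2_mono h1).trans ?_
  rw [sq2_const_mul]
  have h3 : sq2 (fun l => ∑' m, U (l - m) * v m + ∑' m, u (l - m) * W m) ≤
      2 * embConst n s * (sq2 U * sq2 W) := by
    refine (sq2_add_le _ _).trans ?_
    have e1 := (sq2_convolution_le U v).trans
      (mul_le_mul_right (tsum_le_embConst_mul s v) _)
    have e2 := (sq2_convolution_le' u W).trans
      (mul_le_mul_left (tsum_le_embConst_mul s u) _)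
    calc _ ≤ _ := add_le_add e1 e2
      _ = _ := by ring
  calc _ ≤ _ := mul_le_mul_right h3 _
    _ = _ := by ring

/-- The constant of the product estimate in `ℳ^s`. -/
def prodConst (n : ℕ) (s : ℝ) : ℝ≥0∞ := ENNReal.ofReal (2 ^ s) * 2 * embConst n s

/-- The weights `V` of the norms: `V ≥ 1`, and `V` is subadditive up to the factor `c`. -/
structure IsWeight (c : ℝ) (V : (Fin n → ℤ) → (Fin d → ℤ) → ℝ) : Prop where
  one_le : ∀ l h, 1 ≤ V l h
  add_le : ∀ l m h k, V (l + m) (h + k) ≤ c * (V l h + V m k)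

theorem IsWeight.const_nonneg {c : ℝ} {V : (Fin n → ℤ) → (Fin d → ℤ) → ℝ} (h : IsWeight c V) :
    0 ≤ c := by
  have h1 := h.add_le 0 0 0 0
  have h2 := h.one_le 0 0
  simp only [add_zero] at h1
  nlinarith

/-- Pointwise form of the tame product estimate. -/
theorem ofReal_wt_mul_econv_le {c : ℝ} {V : (Fin n → ℤ) → (Fin d → ℤ) → ℝ}
    (hV : IsWeight c V) (a₁ a₂ a₃ : ℝ) (f g : EArr n d) (l : Fin n → ℤ) (j j' : Fin d → ℤ) :
    ENNReal.ofReal (wt V a₁ a₃ l j j') * econv f g l j j' ≤ ENNReal.ofReal c *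
      (econv (fun l j j' => ENNReal.ofReal (wt V a₂ a₃ l j j') * f l j j')
          (fun l j j' => ENNReal.ofReal (wt (fun _ _ => 1) a₁ a₂ l j j') * g l j j') l j j' +
        econv (fun l j j' => ENNReal.ofReal (wt (fun _ _ => 1) a₂ a₃ l j j') * f l j j')
          (fun l j j' => ENNReal.ofReal (wt V a₁ a₂ l j j') * g l j j') l j j') := by
  have hc := hV.const_nonneg
  simp only [econv]
  rw [← ENNReal.tsum_add, ← ENNReal.tsum_mul_left, ← ENNReal.tsum_mul_left]
  refine ENNReal.tsum_le_tsum fun t => ?_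
  have hw : wt V a₁ a₃ l j j' ≤ c * (wt V a₂ a₃ (l - t.1) j t.2 * wt (fun _ _ => 1) a₁ a₂ t.1 t.2 j'
      + wt (fun _ _ => 1) a₂ a₃ (l - t.1) j t.2 * wt V a₁ a₂ t.1 t.2 j') := by
    have h1 := hV.add_le (l - t.1) t.1 (j - t.2) (t.2 - j')
    rw [sub_add_cancel, sub_add_sub_cancel] at h1
    have h2 : jap t.2 ^ (-a₂) * jap t.2 ^ a₂ = 1 := by
      rw [← Real.rpow_add (jap_pos _)]
      simp
    have h3 : 0 ≤ jap j ^ a₃ * jap j' ^ (-a₁) :=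
      mul_nonneg (Real.rpow_nonneg (jap_pos _).le _) (Real.rpow_nonneg (jap_pos _).le _)
    simp only [wt]
    calc _ ≤ c * (V (l - t.1) (j - t.2) + V t.1 (t.2 - j')) * (jap j ^ a₃ * jap j' ^ (-a₁)) :=
          mul_le_mul_of_nonneg_right h1 h3
      _ = c * (V (l - t.1) (j - t.2) + V t.1 (t.2 - j')) * (jap j ^ a₃ * jap j' ^ (-a₁)) *
          (jap t.2 ^ (-a₂) * jap t.2 ^ a₂) := by rw [h2, mul_one]
      _ = _ := by ring
  have hnn : ∀ {U : (Fin n → ℤ) → (Fin d → ℤ) → ℝ}, (∀ l h, 1 ≤ U l h) →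
      ∀ a b l j j', 0 ≤ wt U a b l j j' := fun {U} hU a b l j j' =>
    mul_nonneg (zero_le_one.trans (hU _ _))
      (mul_nonneg (Real.rpow_nonneg (jap_pos _).le _) (Real.rpow_nonneg (jap_pos _).le _))
  have h1 : ∀ (l : Fin n → ℤ) (h : Fin d → ℤ), (1 : ℝ) ≤ (fun _ _ => 1) l h := fun _ _ => le_rfl
  have hw2 := ENNReal.ofReal_le_ofReal hw
  rw [ENNReal.ofReal_mul hc, ENNReal.ofReal_add
    (mul_nonneg (hnn hV.one_le _ _ _ _ _) (hnn h1 _ _ _ _ _))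
    (mul_nonneg (hnn h1 _ _ _ _ _) (hnn hV.one_le _ _ _ _ _)),
    ENNReal.ofReal_mul (hnn hV.one_le _ _ _ _ _), ENNReal.ofReal_mul (hnn h1 _ _ _ _ _)] at hw2
  calc _ ≤ _ := mul_le_mul_left hw2 _
    _ = _ := by ring

/-- The norm of `ℋ^s` with values in the Hilbert--Schmidt operators. -/
def sobolevHS (s : ℝ) (F : EArr n d) : ℝ≥0∞ :=
  sq2 fun t : (Fin n → ℤ) × (Fin d → ℤ) × (Fin d → ℤ) =>
    ENNReal.ofReal (jap t.1 ^ s) * F t.1 t.2.1 t.2.2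

theorem sobolevHS_econv_le {s : ℝ} (hs : 0 ≤ s) (F G : EArr n d) :
    sobolevHS s (econv F G) ≤ prodConst n s * (sobolevHS s F * sobolevHS s G) := by
  have e : ∀ F : EArr n d, sobolevHS s F = sq2 fun l => ENNReal.ofReal (jap l ^ s) *
      sq2 fun t : (Fin d → ℤ) × (Fin d → ℤ) => F l t.1 t.2 := by
    intro F
    rw [sobolevHS, sq2_prod]
    simp_rw [sq2_const_mul]
  rw [e, e, e]
  refine le_trans (sq2_mono fun l => ?_) (sq2_jap_convolution_le hs _ _)
  exact mul_le_mul_right (sq2_econv_le F G l) _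

/-- The tame product estimate: `V` falls on one factor only. -/
theorem eNorm_econv_le {s c : ℝ} (hs : 0 ≤ s) {V : (Fin n → ℤ) → (Fin d → ℤ) → ℝ}
    (hV : IsWeight c V) (a₁ a₂ a₃ : ℝ) (f g : EArr n d) :
    eNorm s V a₁ a₃ (econv f g) ≤ ENNReal.ofReal c * prodConst n s *
      (eNorm s V a₂ a₃ f * eNorm s (fun _ _ => 1) a₁ a₂ g +
        eNorm s (fun _ _ => 1) a₂ a₃ f * eNorm s V a₁ a₂ g) := by
  have hpt := ofReal_wt_mul_econv_le hV a₁ a₂ a₃ f g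
  have k1 := sobolevHS_econv_le hs (fun l j j' => ENNReal.ofReal (wt V a₂ a₃ l j j') * f l j j')
          (fun l j j' => ENNReal.ofReal (wt (fun _ _ => 1) a₁ a₂ l j j') * g l j j')
  have k2 := sobolevHS_econv_le hs
    (fun l j j' => ENNReal.ofReal (wt (fun _ _ => 1) a₂ a₃ l j j') * f l j j')
          (fun l j j' => ENNReal.ofReal (wt V a₁ a₂ l j j') * g l j j')
  generalize econv (fun l j j' => ENNReal.ofReal (wt V a₂ a₃ l j j') * f l j j')
          (fun l j j' => ENNReal.ofReal (wt (fun _ _ => 1) a₁ a₂ l j j') * g l j j') = A at *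
  generalize econv (fun l j j' => ENNReal.ofReal (wt (fun _ _ => 1) a₂ a₃ l j j') * f l j j')
          (fun l j j' => ENNReal.ofReal (wt V a₁ a₂ l j j') * g l j j') = B at *
  have h : eNorm s V a₁ a₃ (econv f g) ≤ ENNReal.ofReal c * (sobolevHS s A + sobolevHS s B) := by
    refine le_trans ?_ (mul_le_mul_right (sq2_add_le _ _) _)
    rw [← sq2_const_mul]
    refine sq2_mono fun t => ?_
    rw [← mul_add, mul_left_comm (ENNReal.ofReal c)]
    exact mul_le_mul_right (hpt _ _ _) _
  refine (h.trans (mul_le_mul_right (add_le_add k1 k2) _)).trans (le_of_eq ?_)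
  rw [← mul_add, ← mul_assoc]
  rfl

/-- Arrays of finite norm are absolutely summable in the time frequency. -/
theorem tsum_le_eNorm {s c : ℝ} {V : (Fin n → ℤ) → (Fin d → ℤ) → ℝ} (hV : IsWeight c V)
    (a b : ℝ) (f : EArr n d) (j j' : Fin d → ℤ) :
    ∑' l, ENNReal.ofReal (jap j ^ b * jap j' ^ (-a)) * f l j j' ≤
      embConst n s * eNorm s V a b f := by
  refine (tsum_le_embConst_mul s _).trans ?_
  rw [eNorm_eq_sq2]
  gcongr
  refine sq2_mono fun l => ?_
  gcongr
  refine le_trans ?_ (le_sq2 (fun t : (Fin d → ℤ) × (Fin d → ℤ) =>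
        ENNReal.ofReal (wt V a b l t.1 t.2) * f l t.1 t.2) (j, j'))
  gcongr
  exact le_mul_of_one_le_left
    (mul_nonneg (Real.rpow_nonneg (jap_pos _).le _) (Real.rpow_nonneg (jap_pos _).le _))
    (hV.one_le _ _)

theorem tsum_lt_top_of_eNorm {s c : ℝ} (hs : (n : ℝ) < 2 * s)
    {V : (Fin n → ℤ) → (Fin d → ℤ) → ℝ} (hV : IsWeight c V) {a b : ℝ} {f : EArr n d}
    (hf : eNorm s V a b f < ⊤) (j j' : Fin d → ℤ) : ∑' l, f l j j' < ⊤ := by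
  have h := (tsum_le_eNorm (s := s) hV a b f j j').trans_lt
    (ENNReal.mul_lt_top (embConst_lt_top hs) hf)
  rw [ENNReal.tsum_mul_left] at h
  refine ENNReal.lt_top_of_mul_ne_top_right h.ne ?_
  rw [Ne, ENNReal.ofReal_eq_zero, not_le]
  exact mul_pos (Real.rpow_pos_of_pos (jap_pos _) _) (Real.rpow_pos_of_pos (jap_pos _) _)

end WeightedArrays

/-! ### Arrays of Fourier coefficients and the families of operators they define -/

section FourierArrays

variable {n d : ℕ}

/-- The time Fourier coefficients of a family of operators: `x l j j'` is `(R̂(l))_j^{j'}`. -/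
abbrev Arr (n d : ℕ) : Type := (Fin n → ℤ) → (Fin d → ℤ) → (Fin d → ℤ) → ℂ

/-- The product of two families of operators, in terms of their time Fourier coefficients. -/
def conv (x y : Arr n d) : Arr n d := fun l j j' =>
  ∑' t : (Fin n → ℤ) × (Fin d → ℤ), x (l - t.1) j t.2 * y t.1 t.2 j'

/-- The moduli of the coefficients. -/
def absA (x : Arr n d) : EArr n d := fun l j j' => ‖x l j j'‖ₑ

/-- The norm of `ℳ^s_{a,b}`, with the additional weight `V(l, j - j')`. -/
def nrm (s : ℝ) (V : (Fin n → ℤ) → (Fin d → ℤ) → ℝ) (a b : ℝ) (x : Arr n d) : ℝ≥0∞ :=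
  eNorm s V a b (absA x)

theorem summable_of_tsum_enorm_lt_top {ι : Type*} {f : ι → ℂ} (h : ∑' i, ‖f i‖ₑ < ⊤) :
    Summable f := by
  refine Summable.of_nnnorm ?_
  rw [← ENNReal.tsum_coe_ne_top_iff_summable]
  exact h.ne

theorem absA_conv_le (x y : Arr n d) (l : Fin n → ℤ) (j j' : Fin d → ℤ) :
    absA (conv x y) l j j' ≤ econv (absA x) (absA y) l j j' := by
  refine enorm_tsum_le_tsum_enorm.trans (le_of_eq ?_)
  simp only [econv, absA, enorm_mul]

section Norm

variable {s a b : ℝ} {V : (Fin n → ℤ) → (Fin d → ℤ) → ℝ}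

theorem nrm_mono {x y : Arr n d} (h : ∀ l j j', ‖x l j j'‖ ≤ ‖y l j j'‖) :
    nrm s V a b x ≤ nrm s V a b y :=
  eNorm_mono fun l j j' => enorm_le_iff_norm_le.2 (h l j j')

theorem nrm_add_le (x y : Arr n d) : nrm s V a b (x + y) ≤ nrm s V a b x + nrm s V a b y :=
  (eNorm_mono fun _ _ _ => enorm_add_le _ _).trans (eNorm_add_le (absA x) (absA y))

theorem nrm_neg (x : Arr n d) : nrm s V a b (-x) = nrm s V a b x := by
  have : absA (-x) = absA x := by
    ext l j j'
    simp [absA]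
  rw [nrm, nrm, this]

theorem nrm_sub_le (x y : Arr n d) : nrm s V a b (x - y) ≤ nrm s V a b x + nrm s V a b y := by
  rw [sub_eq_add_neg, ← nrm_neg y]
  exact nrm_add_le _ _

theorem nrm_zero : nrm s V a b (0 : Arr n d) = 0 := by
  simp [nrm, eNorm, absA, sq2]

theorem isWeight_one : IsWeight 1 (fun (_ : Fin n → ℤ) (_ : Fin d → ℤ) => (1 : ℝ)) :=
  ⟨fun _ _ => le_rfl, fun _ _ _ _ => by norm_num⟩

theorem prodConst_lt_top (hs : (n : ℝ) < 2 * s) : prodConst n s < ⊤ :=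
  ENNReal.mul_lt_top (ENNReal.mul_lt_top ENNReal.ofReal_lt_top (by simp)) (embConst_lt_top hs)

end Norm

/-- The coefficients of all matrix entries are absolutely summable in time. -/
def TimeSummable (x : Arr n d) : Prop := ∀ j j', ∑' l, ‖x l j j'‖ₑ < ⊤

/-- All series in the product of `x` and `y` converge absolutely, and the product is
`TimeSummable`. -/
def Mulable (x y : Arr n d) : Prop := ∀ j j', ∑' l, econv (absA x) (absA y) l j j' < ⊤

theorem timeSummable_of_nrm {s c a b : ℝ} (hs : (n : ℝ) < 2 * s)
    {V : (Fin n → ℤ) → (Fin d → ℤ) → ℝ} (hV : IsWeight c V) {x : Arr n d}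
    (hx : nrm s V a b x < ⊤) : TimeSummable x :=
  fun j j' => tsum_lt_top_of_eNorm hs hV hx j j'

theorem eNorm_econv_lt_top {s a₁ a₂ a₃ : ℝ} (hs0 : 0 ≤ s) (hs : (n : ℝ) < 2 * s) {f g : EArr n d}
    (hf : eNorm s (fun _ _ => 1) a₂ a₃ f < ⊤) (hg : eNorm s (fun _ _ => 1) a₁ a₂ g < ⊤) :
    eNorm s (fun _ _ => 1) a₁ a₃ (econv f g) < ⊤ := by
  refine (eNorm_econv_le hs0 isWeight_one a₁ a₂ a₃ f g).trans_lt ?_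
  exact ENNReal.mul_lt_top (ENNReal.mul_lt_top ENNReal.ofReal_lt_top (prodConst_lt_top hs))
    (ENNReal.add_lt_top.2 ⟨ENNReal.mul_lt_top hf hg, ENNReal.mul_lt_top hf hg⟩)

theorem mulable_of_nrm {s a₁ a₂ a₃ : ℝ} (hs0 : 0 ≤ s) (hs : (n : ℝ) < 2 * s) {x y : Arr n d}
    (hx : nrm s (fun _ _ => 1) a₂ a₃ x < ⊤) (hy : nrm s (fun _ _ => 1) a₁ a₂ y < ⊤) :
    Mulable x y :=
  fun j j' => tsum_lt_top_of_eNorm hs isWeight_one (eNorm_econv_lt_top hs0 hs hx hy) j j'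

theorem Mulable.lt_top {x y : Arr n d} (h : Mulable x y) (l : Fin n → ℤ) (j j' : Fin d → ℤ) :
    econv (absA x) (absA y) l j j' < ⊤ := (ENNReal.le_tsum l).trans_lt (h j j')

theorem Mulable.summable {x y : Arr n d} (h : Mulable x y) (l : Fin n → ℤ) (j j' : Fin d → ℤ) :
    Summable fun t : (Fin n → ℤ) × (Fin d → ℤ) => x (l - t.1) j t.2 * y t.1 t.2 j' := by
  refine summable_of_tsum_enorm_lt_top ((le_of_eq ?_).trans_lt (h.lt_top l j j'))
  simp only [econv, absA, enorm_mul]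

theorem conv_sub_left {x x' y : Arr n d} (h : Mulable x y) (h' : Mulable x' y) :
    conv (x - x') y = conv x y - conv x' y := by
  ext l j j'
  simp only [conv, Pi.sub_apply, sub_mul]
  exact (h.summable l j j').tsum_sub (h'.summable l j j')

theorem conv_sub_right {x y y' : Arr n d} (h : Mulable x y) (h' : Mulable x y') :
    conv x (y - y') = conv x y - conv x y' := by
  ext l j j'
  simp only [conv, Pi.sub_apply, mul_sub]
  exact (h.summable l j j').tsum_sub (h'.summable l j j')

theorem conv_neg_left (x y : Arr n d) : conv (-x) y = -conv x y := by
  ext l j j'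
  simp only [conv, Pi.neg_apply, neg_mul, tsum_neg]

theorem conv_zero_left (y : Arr n d) : conv 0 y = 0 := by
  ext l j j'
  simp [conv]

theorem conv_zero_right (x : Arr n d) : conv x 0 = 0 := by
  ext l j j'
  simp [conv]

/-- The product is associative wherever the triple series converges absolutely. -/
theorem conv_assoc {x y z : Arr n d}
    (h : ∀ l j j', econv (absA x) (econv (absA y) (absA z)) l j j' < ⊤) :
    conv (conv x y) z = conv x (conv y z) := by
  ext l j j'
  let I := (Fin n → ℤ) × (Fin d → ℤ)
  let F : I → I → ℂ := fun t u => x (l - t.1) j t.2 * (y (t.1 - u.1) t.2 u.2 * z u.1 u.2 j')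
  have hF : Summable (Function.uncurry F) := by
    refine summable_of_tsum_enorm_lt_top ((le_of_eq ?_).trans_lt (h l j j'))
    rw [ENNReal.tsum_prod']
    simp only [econv, absA, Function.uncurry, F, enorm_mul, ENNReal.tsum_mul_left, I]
  have h1 : conv x (conv y z) l j j' = ∑' t, ∑' u, F t u := by
    simp only [conv, F, tsum_mul_left, I]
  have h2 : conv (conv x y) z l j j' = ∑' u, ∑' t, F t u := by
    simp only [conv, F, I]
    refine tsum_congr fun u => ?_
    rw [← tsum_mul_right]
    rw [← Equiv.tsum_eq ((Equiv.subRight u.1).prodCongr (Equiv.refl (Fin d → ℤ)))]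
    refine tsum_congr fun t => ?_
    simp only [Equiv.prodCongr_apply, Prod.map, Equiv.subRight_apply, Equiv.refl_apply,
      sub_sub_sub_cancel_right]
    ring
  rw [h1, h2, hF.tsum_comm]

/-- The family of operators with given time Fourier coefficients. -/
def ev (x : Arr n d) : OpFamily n d := fun θ j j' => ∑' l, x l j j' * UnitAddTorus.mFourier l θ

theorem norm_mFourier_apply (l : Fin n → ℤ) (θ : UnitAddTorus (Fin n)) :
    ‖UnitAddTorus.mFourier l θ‖ = 1 := by
  simp only [UnitAddTorus.mFourier, ContinuousMap.coe_mk, norm_prod, fourier_apply,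
    Circle.norm_coe, Finset.prod_const_one]

theorem enorm_mul_mFourier (c : ℂ) (l : Fin n → ℤ) (θ : UnitAddTorus (Fin n)) :
    ‖c * UnitAddTorus.mFourier l θ‖ₑ = ‖c‖ₑ := by
  rw [enorm_mul, ← ofReal_norm (UnitAddTorus.mFourier l θ), norm_mFourier_apply]
  simp

theorem TimeSummable.summable {x : Arr n d} (hx : TimeSummable x) (j j' : Fin d → ℤ) :
    Summable fun l => ‖x l j j'‖ :=
  (summable_of_tsum_enorm_lt_top (hx j j')).norm

theorem TimeSummable.summable_ev {x : Arr n d} (hx : TimeSummable x) (j j' : Fin d → ℤ)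
    (θ : UnitAddTorus (Fin n)) : Summable fun l => x l j j' * UnitAddTorus.mFourier l θ := by
  refine summable_of_tsum_enorm_lt_top ?_
  simp only [enorm_mul_mFourier]
  exact hx j j'

theorem TimeSummable.hasSum_mFourier {x : Arr n d} (hx : TimeSummable x) (j j' : Fin d → ℤ) :
    Summable fun l => x l j j' • (UnitAddTorus.mFourier l : C(UnitAddTorus (Fin n), ℂ)) := by
  refine Summable.of_norm ?_
  simp only [norm_smul, UnitAddTorus.mFourier_norm, mul_one]
  exact hx.summable j j'

theorem TimeSummable.ev_eq {x : Arr n d} (hx : TimeSummable x) (j j' : Fin d → ℤ)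
    (θ : UnitAddTorus (Fin n)) : ev x θ j j' =
      (∑' l, x l j j' • (UnitAddTorus.mFourier l : C(UnitAddTorus (Fin n), ℂ))) θ := by
  have := (ContinuousMap.evalCLM ℂ θ).hasSum (hx.hasSum_mFourier j j').hasSum
  exact this.tsum_eq

theorem TimeSummable.continuous_ev {x : Arr n d} (hx : TimeSummable x) (j j' : Fin d → ℤ) :
    Continuous fun θ => ev x θ j j' := by
  simp only [hx.ev_eq]
  exact ContinuousMap.continuous _

section

attribute [local instance] instMeasureSpaceUnitAddCircle
  instIsProbabilityMeasureUnitAddCircleVolume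

theorem timeCoeff_ev {x : Arr n d} (hx : TimeSummable x) : timeCoeff (ev x) = x := by
  ext l j j'
  let f : C(UnitAddTorus (Fin n), ℂ) := ∑' l, x l j j' • UnitAddTorus.mFourier l
  have hf : (fun θ => ev x θ j j') = f := by
    ext θ
    exact hx.ev_eq j j' θ
  have h1 := (ContinuousMap.toLp (E := ℂ) 2 MeasureTheory.MeasureSpace.volume ℂ).hasSum
    (hx.hasSum_mFourier j j').hasSum
  have h2 : UnitAddTorus.mFourierBasis.repr (ContinuousMap.toLp (E := ℂ) 2
      MeasureTheory.MeasureSpace.volume ℂ f) l = UnitAddTorus.mFourierCoeff f l := by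
    rw [UnitAddTorus.mFourierBasis_repr, UnitAddTorus.mFourierCoeff_toLp]
  have h3 := (innerSL ℂ ((UnitAddTorus.mFourierBasis (d := Fin n)) l)).hasSum h1
  have h4 : ∀ m, innerSL ℂ ((UnitAddTorus.mFourierBasis (d := Fin n)) l)
      (ContinuousMap.toLp (E := ℂ) 2 MeasureTheory.MeasureSpace.volume ℂ
        (x m j j' • UnitAddTorus.mFourier m)) = if m = l then x m j j' else 0 := by
    intro m
    have := orthonormal_iff_ite.1 (UnitAddTorus.mFourierBasis (d := Fin n)).orthonormal l m
    simp only [UnitAddTorus.coe_mFourierBasis, UnitAddTorus.mFourierLp] at this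
    simp only [map_smul, innerSL_apply_apply, UnitAddTorus.coe_mFourierBasis, smul_eq_mul,
      UnitAddTorus.mFourierLp, this, eq_comm (a := l)]
    simp
  simp only [h4] at h3
  have h5 := h3.unique (hasSum_single l fun m hm => if_neg hm)
  rw [if_pos rfl] at h5
  rw [HilbertBasis.repr_apply_apply] at h2
  rw [timeCoeff, hf, ← h2]
  exact h5

end

theorem ev_timeCoeff {R : OpFamily n d} (hc : ∀ j j', Continuous fun θ => R θ j j')
    (hR : TimeSummable (timeCoeff R)) : ev (timeCoeff R) = R := by
  ext θ j j'
  let f : C(UnitAddTorus (Fin n), ℂ) := ⟨fun θ => R θ j j', hc j j'⟩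
  have := UnitAddTorus.hasSum_mFourier_series_apply_of_summable (f := f)
    (summable_of_tsum_enorm_lt_top (hR j j')) θ
  exact this.tsum_eq

theorem ev_injective {x y : Arr n d} (hx : TimeSummable x) (hy : TimeSummable y)
    (h : ev x = ev y) : x = y := by
  rw [← timeCoeff_ev hx, h, timeCoeff_ev hy]

theorem ev_sub {x y : Arr n d} (hx : TimeSummable x) (hy : TimeSummable y) :
    ev (x - y) = ev x - ev y := by
  ext θ j j'
  simp only [ev, Pi.sub_apply, sub_mul, Matrix.sub_apply]
  exact (hx.summable_ev j j' θ).tsum_sub (hy.summable_ev j j' θ)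

theorem ev_add {x y : Arr n d} (hx : TimeSummable x) (hy : TimeSummable y) :
    ev (x + y) = ev x + ev y := by
  ext θ j j'
  simp only [ev, Pi.add_apply, add_mul, Matrix.add_apply]
  exact (hx.summable_ev j j' θ).tsum_add (hy.summable_ev j j' θ)

theorem TimeSummable.sub {x y : Arr n d} (hx : TimeSummable x) (hy : TimeSummable y) :
    TimeSummable (x - y) := fun j j' =>
  (ENNReal.tsum_le_tsum fun _ => enorm_sub_le).trans_lt
    (by rw [ENNReal.tsum_add]; exact ENNReal.add_lt_top.2 ⟨hx j j', hy j j'⟩)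

/-- The product of arrays is the pointwise product of the families of operators. -/
theorem hasMatMul_ev {x y : Arr n d} (hx : TimeSummable x) (hy : TimeSummable y)
    (h : Mulable x y) (θ : UnitAddTorus (Fin n)) :
    HasMatMul (ev x θ) (ev y θ) (ev (conv x y) θ) := by
  intro j j'
  let L := Fin n → ℤ
  let J := Fin d → ℤ
  let e := fun l : L => UnitAddTorus.mFourier l θ
  -- the terms of the product, indexed by the middle index and by the two frequencies
  let G : J × (L × L) → ℂ := fun t => (x t.2.1 j t.1 * e t.2.1) * (y t.2.2 t.1 j' * e t.2.2)
  let E : L × (L × J) ≃ J × (L × L) :=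
    { toFun := fun t => (t.2.2, (t.1 - t.2.1, t.2.1))
      invFun := fun t => (t.2.1 + t.2.2, (t.2.2, t.1))
      left_inv := fun t => by simp
      right_inv := fun t => by simp }
  let F : L × (L × J) → ℂ := fun t => (x (t.1 - t.2.1) j t.2.2 * y t.2.1 t.2.2 j') * e t.1
  have hGE : G ∘ E = F := by
    ext t
    have : e t.1 = e (t.1 - t.2.1) * e t.2.1 := by
      simp only [e]
      rw [← UnitAddTorus.mFourier_add, sub_add_cancel]
    simp only [G, E, F, Function.comp_apply, Equiv.coe_fn_mk, this]
    ring
  have hF : Summable F := by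
    refine summable_of_tsum_enorm_lt_top ((le_of_eq ?_).trans_lt (h j j'))
    rw [ENNReal.tsum_prod']
    refine tsum_congr fun l => tsum_congr fun t => ?_
    simp only [F, e]
    rw [enorm_mul_mFourier, enorm_mul]
    rfl
  have htot : HasSum F (ev (conv x y) θ j j') := by
    have h1 : ∑' t, F t = ∑' l, ∑' t, F (l, t) := hF.tsum_prod
    have h2 : ∑' l, ∑' t, F (l, t) = ev (conv x y) θ j j' := by
      refine tsum_congr fun l => ?_
      rw [conv, ← tsum_mul_right]
    rw [← h2, ← h1]
    exact hF.hasSum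
  rw [← hGE] at htot
  have hG : HasSum G (ev (conv x y) θ j j') := E.hasSum_iff.1 htot
  have hfib : ∀ k, HasSum (fun u : L × L => G (k, u)) (ev x θ j k * ev y θ k j') := by
    intro k
    have h1 : HasSum (fun l => x l j k * e l) (ev x θ j k) := (hx.summable_ev j k θ).hasSum
    have h2 : HasSum (fun l => y l k j' * e l) (ev y θ k j') := (hy.summable_ev k j' θ).hasSum
    have h3 : Summable fun u : L × L => (x u.1 j k * e u.1) * (y u.2 k j' * e u.2) :=
      hG.summable.prod_factor k
    have h4 := HasSum.mul h1 h2 h3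
    exact h4
  exact hG.prod_fiberwise hfib

end FourierArrays

/-! ### Neumann series -/

section Neumann

variable {n d : ℕ}

/-- The real constant of the product estimates. -/
def mulConst (n : ℕ) (s c : ℝ) : ℝ := 4 * c * (prodConst n s).toReal

theorem IsWeight.half_le {c : ℝ} {V : (Fin n → ℤ) → (Fin d → ℤ) → ℝ} (h : IsWeight c V) :
    1 / 2 ≤ c := by
  have h1 := h.add_le 0 0 0 0
  have h2 := h.one_le 0 0
  simp only [add_zero] at h1
  nlinarith

theorem mulConst_nonneg {c : ℝ} (hc : 0 ≤ c) (s : ℝ) : 0 ≤ mulConst n s c := by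
  unfold mulConst
  positivity

theorem eNorm_econv_le_mulConst {s c : ℝ} (hs0 : 0 ≤ s) (hs : (n : ℝ) < 2 * s)
    {V : (Fin n → ℤ) → (Fin d → ℤ) → ℝ} (hV : IsWeight c V) (a₁ a₂ a₃ : ℝ) (f g : EArr n d) :
    eNorm s V a₁ a₃ (econv f g) ≤ ENNReal.ofReal (mulConst n s c) *
      (eNorm s V a₂ a₃ f * eNorm s (fun _ _ => 1) a₁ a₂ g +
        eNorm s (fun _ _ => 1) a₂ a₃ f * eNorm s V a₁ a₂ g) := by
  refine (eNorm_econv_le hs0 hV a₁ a₂ a₃ f g).trans ?_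
  have hc := hV.const_nonneg
  rw [mulConst, ENNReal.ofReal_mul (by positivity), ENNReal.ofReal_toReal (prodConst_lt_top hs).ne]
  gcongr
  linarith

theorem eNorm_one_econv_le_mulConst {s c : ℝ} (hs0 : 0 ≤ s) (hs : (n : ℝ) < 2 * s)
    {V : (Fin n → ℤ) → (Fin d → ℤ) → ℝ} (hV : IsWeight c V) (a₁ a₂ a₃ : ℝ) (f g : EArr n d) :
    eNorm s (fun _ _ => 1) a₁ a₃ (econv f g) ≤ ENNReal.ofReal (mulConst n s c) *
      (eNorm s (fun _ _ => 1) a₂ a₃ f * eNorm s (fun _ _ => 1) a₁ a₂ g) := by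
  refine (eNorm_econv_le hs0 isWeight_one a₁ a₂ a₃ f g).trans ?_
  have hc := hV.half_le
  rw [← two_mul, ← mul_assoc]
  gcongr
  rw [mulConst, ENNReal.ofReal_mul (by linarith), ENNReal.ofReal_toReal (prodConst_lt_top hs).ne,
    ENNReal.ofReal_one, one_mul, mul_comm]
  gcongr
  rw [← ENNReal.ofReal_ofNat]
  exact ENNReal.ofReal_le_ofReal (by linarith)

theorem econv_mono {f f' g g' : EArr n d} (h : ∀ l j j', f l j j' ≤ f' l j j')
    (h' : ∀ l j j', g l j j' ≤ g' l j j') (l : Fin n → ℤ) (j j' : Fin d → ℤ) :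
    econv f g l j j' ≤ econv f' g' l j j' :=
  ENNReal.tsum_le_tsum fun _ => mul_le_mul' (h _ _ _) (h' _ _ _)

/-- The powers `f, f ⋆ f, f ⋆ (f ⋆ f), …` of a nonnegative array. -/
def epow (f : EArr n d) : ℕ → EArr n d
  | 0 => f
  | k + 1 => econv f (epow f k)

/-- The powers `u, u ⋆ u, u ⋆ (u ⋆ u), …`. -/
def cpow (u : Arr n d) : ℕ → Arr n d
  | 0 => u
  | k + 1 => conv u (cpow u k)

theorem absA_cpow_le (u : Arr n d) (k : ℕ) (l : Fin n → ℤ) (j j' : Fin d → ℤ) :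
    absA (cpow u k) l j j' ≤ epow (absA u) k l j j' := by
  induction k generalizing l j j' with
  | zero => exact le_rfl
  | succ k ih =>
    exact (absA_conv_le _ _ _ _ _).trans (econv_mono (fun _ _ _ => le_rfl) ih _ _ _)

/-- The Neumann series `∑_{k ≥ 1} u^k`. -/
def neumann (u : Arr n d) : Arr n d := fun l j j' => ∑' k, cpow u k l j j'

/-- The majorant of the Neumann series. -/
def eneumann (f : EArr n d) : EArr n d := fun l j j' => ∑' k, epow f k l j j'

theorem absA_neumann_le (u : Arr n d) (l : Fin n → ℤ) (j j' : Fin d → ℤ) :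
    absA (neumann u) l j j' ≤ eneumann (absA u) l j j' :=
  enorm_tsum_le_tsum_enorm.trans (ENNReal.tsum_le_tsum fun k => absA_cpow_le u k l j j')

section Bounds

variable {s c r : ℝ} {V : (Fin n → ℤ) → (Fin d → ℤ) → ℝ}

/-- Powers grow geometrically, also in the norm with the weight `V`, with a ratio that only
involves the norm without weight. -/
theorem eNorm_epow_le (hs0 : 0 ≤ s) (hs : (n : ℝ) < 2 * s) (hV : IsWeight c V) {f : EArr n d}
    (hf : 4 * (ENNReal.ofReal (mulConst n s c) * eNorm s (fun _ _ => 1) r r f) ≤ 1) (k : ℕ) :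
    eNorm s (fun _ _ => 1) r r (epow f k) ≤ (4 : ℝ≥0∞)⁻¹ ^ k * eNorm s (fun _ _ => 1) r r f ∧
      eNorm s V r r (epow f k) ≤ (2 : ℝ≥0∞)⁻¹ ^ k * eNorm s V r r f := by
  have hf' : ENNReal.ofReal (mulConst n s c) * eNorm s (fun _ _ => 1) r r f ≤ (4 : ℝ≥0∞)⁻¹ := by
    rw [ENNReal.le_inv_iff_mul_le, mul_comm]
    exact hf
  set A := eNorm s (fun _ _ => 1) r r f
  set B := eNorm s V r r f
  set κ := ENNReal.ofReal (mulConst n s c)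
  induction k with
  | zero => simp [epow, A, B]
  | succ k ih =>
    constructor
    · calc _ ≤ κ * (A * ((4 : ℝ≥0∞)⁻¹ ^ k * A)) :=
            (eNorm_one_econv_le_mulConst hs0 hs hV r r r f (epow f k)).trans
              (by gcongr; exact ih.1)
        _ = (κ * A) * (4 : ℝ≥0∞)⁻¹ ^ k * A := by ring
        _ ≤ (4 : ℝ≥0∞)⁻¹ * (4 : ℝ≥0∞)⁻¹ ^ k * A := by gcongr
        _ = _ := by rw [pow_succ']
    · calc _ ≤ κ * (B * ((4 : ℝ≥0∞)⁻¹ ^ k * A) + A * ((2 : ℝ≥0∞)⁻¹ ^ k * B)) :=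
            (eNorm_econv_le_mulConst hs0 hs hV r r r f (epow f k)).trans
              (by gcongr; exacts [ih.1, ih.2])
        _ = (κ * A) * ((4 : ℝ≥0∞)⁻¹ ^ k + (2 : ℝ≥0∞)⁻¹ ^ k) * B := by ring
        _ ≤ (4 : ℝ≥0∞)⁻¹ * ((2 : ℝ≥0∞)⁻¹ ^ k + (2 : ℝ≥0∞)⁻¹ ^ k) * B := by
            gcongr
            norm_num
        _ = _ := by
            rw [← two_mul, pow_succ', ← mul_assoc]
            congr 2
            have h4 : (4 : ℝ≥0∞) = 2 * 2 := by norm_num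
            rw [h4, ENNReal.mul_inv (by simp) (by simp), mul_assoc,
              ENNReal.inv_mul_cancel (by simp) (by simp), mul_one]

theorem eNorm_eneumann_le (hs0 : 0 ≤ s) (hs : (n : ℝ) < 2 * s) (hV : IsWeight c V) {f : EArr n d}
    (hf : 4 * (ENNReal.ofReal (mulConst n s c) * eNorm s (fun _ _ => 1) r r f) ≤ 1) :
    eNorm s V r r (eneumann f) ≤ 2 * eNorm s V r r f := by
  refine (eNorm_tsum_le (fun k => epow f k)).trans ?_
  refine (ENNReal.tsum_le_tsum fun k => (eNorm_epow_le hs0 hs hV hf k).2).trans ?_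
  rw [ENNReal.tsum_mul_right, ENNReal.tsum_geometric, ENNReal.one_sub_inv_two, inv_inv]

theorem nrm_neumann_le (hs0 : 0 ≤ s) (hs : (n : ℝ) < 2 * s) (hV : IsWeight c V) {u : Arr n d}
    (hu : 4 * (ENNReal.ofReal (mulConst n s c) * nrm s (fun _ _ => 1) r r u) ≤ 1) :
    nrm s V r r (neumann u) ≤ 2 * nrm s V r r u :=
  (eNorm_mono (absA_neumann_le u)).trans (eNorm_eneumann_le hs0 hs hV hu)

theorem eNorm_one_eneumann_le (hs0 : 0 ≤ s) (hs : (n : ℝ) < 2 * s) (hV : IsWeight c V)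
    {f : EArr n d}
    (hf : 4 * (ENNReal.ofReal (mulConst n s c) * eNorm s (fun _ _ => 1) r r f) ≤ 1) :
    eNorm s (fun _ _ => 1) r r (eneumann f) ≤ 2 * eNorm s (fun _ _ => 1) r r f := by
  refine (eNorm_tsum_le (fun k => epow f k)).trans ?_
  refine (ENNReal.tsum_le_tsum fun k => (eNorm_epow_le hs0 hs hV hf k).1.trans
    (mul_le_mul_left (pow_le_pow_left' (ENNReal.inv_le_inv.2
      (by norm_num : (2 : ℝ≥0∞) ≤ 4)) k) _)).trans ?_
  rw [ENNReal.tsum_mul_right, ENNReal.tsum_geometric, ENNReal.one_sub_inv_two, inv_inv]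

theorem nrm_one_neumann_le (hs0 : 0 ≤ s) (hs : (n : ℝ) < 2 * s) (hV : IsWeight c V) {u : Arr n d}
    (hu : 4 * (ENNReal.ofReal (mulConst n s c) * nrm s (fun _ _ => 1) r r u) ≤ 1) :
    nrm s (fun _ _ => 1) r r (neumann u) ≤ 2 * nrm s (fun _ _ => 1) r r u :=
  (eNorm_mono (absA_neumann_le u)).trans (eNorm_one_eneumann_le hs0 hs hV hu)

theorem eNorm_lt_top_entry (hs : (n : ℝ) < 2 * s) {a b : ℝ} {f : EArr n d}
    (h : eNorm s (fun _ _ => 1) a b f < ⊤) (l : Fin n → ℤ) (j j' : Fin d → ℤ) : f l j j' < ⊤ :=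
  (ENNReal.le_tsum l).trans_lt (tsum_lt_top_of_eNorm hs isWeight_one h j j')

theorem nrm_cpow_lt_top (hs0 : 0 ≤ s) (hs : (n : ℝ) < 2 * s) {u : Arr n d}
    (hfin : nrm s (fun _ _ => 1) r r u < ⊤) (k : ℕ) :
    nrm s (fun _ _ => 1) r r (cpow u k) < ⊤ := by
  induction k with
  | zero => exact hfin
  | succ k ih =>
    exact (eNorm_mono (absA_conv_le _ _)).trans_lt (eNorm_econv_lt_top hs0 hs hfin ih)

theorem conv_assoc_of_nrm {a₁ a₂ a₃ a₄ : ℝ} (hs0 : 0 ≤ s) (hs : (n : ℝ) < 2 * s) {x y z : Arr n d}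
    (hx : nrm s (fun _ _ => 1) a₃ a₄ x < ⊤) (hy : nrm s (fun _ _ => 1) a₂ a₃ y < ⊤)
    (hz : nrm s (fun _ _ => 1) a₁ a₂ z < ⊤) : conv (conv x y) z = conv x (conv y z) :=
  conv_assoc fun l j j' => eNorm_lt_top_entry hs
    (eNorm_econv_lt_top hs0 hs hx (eNorm_econv_lt_top hs0 hs hy hz)) l j j'

/-- Powers commute with the base. -/
theorem cpow_succ' (hs0 : 0 ≤ s) (hs : (n : ℝ) < 2 * s) {u : Arr n d}
    (hfin : nrm s (fun _ _ => 1) r r u < ⊤) (k : ℕ) :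
    cpow u (k + 1) = conv (cpow u k) u := by
  induction k with
  | zero => rfl
  | succ k ih =>
    conv_lhs => rw [cpow, ih]
    rw [cpow, conv_assoc_of_nrm hs0 hs hfin (nrm_cpow_lt_top hs0 hs hfin k) hfin]

theorem summable_cpow (hs0 : 0 ≤ s) (hs : (n : ℝ) < 2 * s) (hV : IsWeight c V) {u : Arr n d}
    (hfin : nrm s (fun _ _ => 1) r r u < ⊤)
    (hu : 4 * (ENNReal.ofReal (mulConst n s c) * nrm s (fun _ _ => 1) r r u) ≤ 1)
    (l : Fin n → ℤ) (j j' : Fin d → ℤ) : Summable fun k => cpow u k l j j' := by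
  refine summable_of_tsum_enorm_lt_top ?_
  refine (ENNReal.tsum_le_tsum fun k => absA_cpow_le u k l j j').trans_lt ?_
  exact eNorm_lt_top_entry hs ((eNorm_one_eneumann_le hs0 hs hV hu).trans_lt
    (ENNReal.mul_lt_top (by simp) hfin)) l j j'

/-- The Neumann series `y` of `u` satisfies `y = u + u y`. -/
theorem neumann_eq_left (hs0 : 0 ≤ s) (hs : (n : ℝ) < 2 * s) (hV : IsWeight c V) {u : Arr n d}
    (hfin : nrm s (fun _ _ => 1) r r u < ⊤)
    (hu : 4 * (ENNReal.ofReal (mulConst n s c) * nrm s (fun _ _ => 1) r r u) ≤ 1) :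
    neumann u = u + conv u (neumann u) := by
  ext l j j'
  have hE := (eNorm_one_eneumann_le hs0 hs hV hu).trans_lt (ENNReal.mul_lt_top (by simp) hfin)
  have h2 : neumann u l j j' = u l j j' + ∑' k, cpow u (k + 1) l j j' := by
    rw [neumann, (summable_cpow hs0 hs hV hfin hu l j j').tsum_eq_zero_add]
    rfl
  rw [h2]
  simp only [Pi.add_apply, cpow, conv, neumann]
  congr 1
  simp only [← tsum_mul_left]
  refine Summable.tsum_comm (f := fun (t : (Fin n → ℤ) × (Fin d → ℤ)) k =>
    u (l - t.1) j t.2 * cpow u k t.1 t.2 j') ?_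
  refine summable_of_tsum_enorm_lt_top (lt_of_le_of_lt ?_
    (eNorm_lt_top_entry hs (eNorm_econv_lt_top hs0 hs hfin hE) l j j'))
  rw [ENNReal.tsum_prod']
  simp only [Function.uncurry, enorm_mul, ENNReal.tsum_mul_left]
  refine ENNReal.tsum_le_tsum fun t => mul_le_mul_right ?_ _
  exact ENNReal.tsum_le_tsum fun k => absA_cpow_le u k _ _ _

/-- The Neumann series `y` of `u` satisfies `y = u + y u`. -/
theorem neumann_eq_right (hs0 : 0 ≤ s) (hs : (n : ℝ) < 2 * s) (hV : IsWeight c V) {u : Arr n d}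
    (hfin : nrm s (fun _ _ => 1) r r u < ⊤)
    (hu : 4 * (ENNReal.ofReal (mulConst n s c) * nrm s (fun _ _ => 1) r r u) ≤ 1) :
    neumann u = u + conv (neumann u) u := by
  ext l j j'
  have hE := (eNorm_one_eneumann_le hs0 hs hV hu).trans_lt (ENNReal.mul_lt_top (by simp) hfin)
  have h2 : neumann u l j j' = u l j j' + ∑' k, cpow u (k + 1) l j j' := by
    rw [neumann, (summable_cpow hs0 hs hV hfin hu l j j').tsum_eq_zero_add]
    rfl
  rw [h2]
  simp only [Pi.add_apply, cpow_succ' hs0 hs hfin, conv, neumann]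
  congr 1
  simp only [← tsum_mul_right]
  refine Summable.tsum_comm (f := fun (t : (Fin n → ℤ) × (Fin d → ℤ)) k =>
    cpow u k (l - t.1) j t.2 * u t.1 t.2 j') ?_
  refine summable_of_tsum_enorm_lt_top (lt_of_le_of_lt ?_
    (eNorm_lt_top_entry hs (eNorm_econv_lt_top hs0 hs hE hfin) l j j'))
  rw [ENNReal.tsum_prod']
  simp only [Function.uncurry, enorm_mul, ENNReal.tsum_mul_right]
  refine ENNReal.tsum_le_tsum fun t => mul_le_mul_left ?_ _
  exact ENNReal.tsum_le_tsum fun k => absA_cpow_le u k _ _ _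

end Bounds
end Neumann

/-! ### Bounds that are Lipschitz in the parameter -/

section LipschitzBounds

variable {n d : ℕ}

/-- `M` bounds both the supremum over `O` and the Lipschitz constant on `O` of `f`, with respect to
the norm `N`. -/
def LipBd {E : Type*} [Sub E] (N : E → ℝ≥0∞) (O : Set (Param n d)) (f : Param n d → E) (M : ℝ) :
    Prop :=
  (∀ w ∈ O, N (f w) ≤ ENNReal.ofReal M) ∧
    ∀ w₁ ∈ O, ∀ w₂ ∈ O, N (f w₁ - f w₂) ≤ ENNReal.ofReal (M * ‖w₁ - w₂‖)

section General

variable {E : Type*} {N : E → ℝ≥0∞} {O O' : Set (Param n d)} {M M' : ℝ}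

theorem LipBd.mono_set [Sub E] {f : Param n d → E} (h : LipBd N O f M) (hO : O' ⊆ O) :
    LipBd N O' f M :=
  ⟨fun w hw => h.1 w (hO hw), fun w₁ h₁ w₂ h₂ => h.2 w₁ (hO h₁) w₂ (hO h₂)⟩

theorem LipBd.mono [Sub E] {f : Param n d → E} (h : LipBd N O f M) (hM : M ≤ M') :
    LipBd N O f M' :=
  ⟨fun w hw => (h.1 w hw).trans (ENNReal.ofReal_le_ofReal hM), fun w₁ h₁ w₂ h₂ =>
    (h.2 w₁ h₁ w₂ h₂).trans
      (ENNReal.ofReal_le_ofReal (mul_le_mul_of_nonneg_right hM (norm_nonneg _)))⟩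

theorem LipBd.congr [Sub E] {f g : Param n d → E} (h : LipBd N O f M) (hfg : ∀ w ∈ O, g w = f w) :
    LipBd N O g M :=
  ⟨fun w hw => by rw [hfg w hw]; exact h.1 w hw, fun w₁ h₁ w₂ h₂ => by
    rw [hfg w₁ h₁, hfg w₂ h₂]; exact h.2 w₁ h₁ w₂ h₂⟩

theorem LipBd.add [AddCommGroup E] (hN : ∀ x y, N (x + y) ≤ N x + N y) {f g : Param n d → E}
    (hM : 0 ≤ M) (hM' : 0 ≤ M') (hf : LipBd N O f M) (hg : LipBd N O g M') :
    LipBd N O (fun w => f w + g w) (M + M') := by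
  refine ⟨fun w hw => ?_, fun w₁ h₁ w₂ h₂ => ?_⟩
  · rw [ENNReal.ofReal_add hM hM']
    exact (hN _ _).trans (add_le_add (hf.1 w hw) (hg.1 w hw))
  · rw [add_mul, ENNReal.ofReal_add (by positivity) (by positivity), add_sub_add_comm]
    exact (hN _ _).trans (add_le_add (hf.2 w₁ h₁ w₂ h₂) (hg.2 w₁ h₁ w₂ h₂))

theorem LipBd.neg [AddCommGroup E] (hN : ∀ x, N (-x) = N x) {f : Param n d → E}
    (hf : LipBd N O f M) : LipBd N O (fun w => -f w) M := by
  refine ⟨fun w hw => by rw [hN]; exact hf.1 w hw, fun w₁ h₁ w₂ h₂ => ?_⟩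
  rw [neg_sub_neg, ← neg_sub, hN]
  exact hf.2 w₁ h₁ w₂ h₂

theorem LipBd.sub [AddCommGroup E] (hN : ∀ x y, N (x + y) ≤ N x + N y) (hN' : ∀ x, N (-x) = N x)
    {f g : Param n d → E}
    (hM : 0 ≤ M) (hM' : 0 ≤ M') (hf : LipBd N O f M) (hg : LipBd N O g M') :
    LipBd N O (fun w => f w - g w) (M + M') := by
  simp only [sub_eq_add_neg]
  exact hf.add hN hM hM' (hg.neg hN')

/-- A norm `‖f‖^{Lip} ≤ M` gives `LipBd`. -/
theorem lipBd_of_lipNorm_le [AddGroup E] (h0 : N 0 = 0) {f : Param n d → E}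
    (h : lipNorm N 1 O f ≤ ENNReal.ofReal M) : LipBd N O f M := by
  unfold lipNorm at h
  rw [ENNReal.ofReal_one, one_mul] at h
  have h1 := le_self_add.trans h
  have h2 := le_add_self.trans h
  refine ⟨fun w hw => (le_iSup₂ (f := fun w (_ : w ∈ O) => N (f w)) w hw).trans h1,
    fun w₁ hw₁ w₂ hw₂ => ?_⟩
  by_cases hw : w₁ = w₂
  · simp [hw, h0]
  have hpos : 0 < ‖w₁ - w₂‖ := norm_pos_iff.2 (sub_ne_zero.2 hw)
  have h3 : N (f w₁ - f w₂) / ENNReal.ofReal ‖w₁ - w₂‖ ≤ ENNReal.ofReal M := by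
    refine le_trans ?_ h2
    refine le_iSup₂_of_le w₁ hw₁ (le_iSup₂_of_le w₂ hw₂ (le_iSup_of_le hw le_rfl))
  rw [ENNReal.div_le_iff (by simpa using sub_ne_zero.2 hw) ENNReal.ofReal_ne_top] at h3
  rwa [ENNReal.ofReal_mul' hpos.le]

/-- Conversely, `LipBd` controls the norm `‖f‖^{Lip}` up to the factor two. -/
theorem LipBd.lipNorm_le [Sub E] {f : Param n d → E} (hM : 0 ≤ M) (h : LipBd N O f M) :
    lipNorm N 1 O f ≤ ENNReal.ofReal (2 * M) := by
  unfold lipNorm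
  rw [ENNReal.ofReal_one, one_mul, two_mul, ENNReal.ofReal_add hM hM]
  refine add_le_add (iSup₂_le h.1) ?_
  refine iSup₂_le fun w₁ hw₁ => iSup₂_le fun w₂ hw₂ => iSup_le fun hw => ?_
  have hpos : 0 < ‖w₁ - w₂‖ := norm_pos_iff.2 (sub_ne_zero.2 hw)
  rw [ENNReal.div_le_iff (by simpa using sub_ne_zero.2 hw) ENNReal.ofReal_ne_top,
    ← ENNReal.ofReal_mul' hpos.le]
  exact h.2 w₁ hw₁ w₂ hw₂

end General

theorem IsWeight.one {c : ℝ} {V : (Fin n → ℤ) → (Fin d → ℤ) → ℝ} (h : IsWeight c V) :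
    IsWeight c (fun (_ : Fin n → ℤ) (_ : Fin d → ℤ) => (1 : ℝ)) :=
  ⟨fun _ _ => le_rfl, fun _ _ _ _ => by linarith [h.half_le]⟩

section Operations

variable {s c : ℝ} {V : (Fin n → ℤ) → (Fin d → ℤ) → ℝ} {O : Set (Param n d)}

theorem nrm_conv_le_ofReal (hs0 : 0 ≤ s) (hs : (n : ℝ) < 2 * s) (hV : IsWeight c V)
    {a₁ a₂ a₃ A A' B B' : ℝ} {x y : Arr n d} (hA : 0 ≤ A) (hA' : 0 ≤ A') (hB : 0 ≤ B)
    (hB' : 0 ≤ B') (hx : nrm s (fun _ _ => 1) a₂ a₃ x ≤ ENNReal.ofReal A)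
    (hx' : nrm s V a₂ a₃ x ≤ ENNReal.ofReal A')
    (hy : nrm s (fun _ _ => 1) a₁ a₂ y ≤ ENNReal.ofReal B)
    (hy' : nrm s V a₁ a₂ y ≤ ENNReal.ofReal B') :
    nrm s V a₁ a₃ (conv x y) ≤ ENNReal.ofReal (mulConst n s c * (A' * B + A * B')) := by
  have h1 : nrm s V a₁ a₃ (conv x y) ≤ ENNReal.ofReal (mulConst n s c) *
      (ENNReal.ofReal A' * ENNReal.ofReal B + ENNReal.ofReal A * ENNReal.ofReal B') :=
    ((eNorm_mono (absA_conv_le x y)).trans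
      (eNorm_econv_le_mulConst hs0 hs hV a₁ a₂ a₃ _ _)).trans
      (mul_le_mul_right (add_le_add (mul_le_mul' hx' hy) (mul_le_mul' hx hy')) _)
  rw [← ENNReal.ofReal_mul hA', ← ENNReal.ofReal_mul hA] at h1
  rwa [← ENNReal.ofReal_add (by positivity) (by positivity),
    ← ENNReal.ofReal_mul (mulConst_nonneg hV.const_nonneg s)] at h1

theorem nrm_lt_top {a b A : ℝ} {U : (Fin n → ℤ) → (Fin d → ℤ) → ℝ} {x : Arr n d}
    (h : nrm s U a b x ≤ ENNReal.ofReal A) : nrm s U a b x < ⊤ :=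
  h.trans_lt ENNReal.ofReal_lt_top

theorem lipBd_conv (hs0 : 0 ≤ s) (hs : (n : ℝ) < 2 * s) (hV : IsWeight c V)
    {a₁ a₂ a₃ A A' B B' : ℝ} {x y : Param n d → Arr n d}
    (hA : 0 ≤ A) (hA' : 0 ≤ A') (hB : 0 ≤ B) (hB' : 0 ≤ B')
    (hx : LipBd (nrm s (fun _ _ => 1) a₂ a₃) O x A) (hx' : LipBd (nrm s V a₂ a₃) O x A')
    (hy : LipBd (nrm s (fun _ _ => 1) a₁ a₂) O y B) (hy' : LipBd (nrm s V a₁ a₂) O y B') :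
    LipBd (nrm s V a₁ a₃) O (fun w => conv (x w) (y w))
      (2 * mulConst n s c * (A' * B + A * B')) := by
  have hκ := mulConst_nonneg (n := n) hV.const_nonneg s
  refine ⟨fun w hw => (nrm_conv_le_ofReal hs0 hs hV hA hA' hB hB' (hx.1 w hw) (hx'.1 w hw)
    (hy.1 w hw) (hy'.1 w hw)).trans (ENNReal.ofReal_le_ofReal ?_), fun w₁ h₁ w₂ h₂ => ?_⟩
  · have : 0 ≤ mulConst n s c * (A' * B + A * B') := by positivity
    linarith
  have hm : ∀ {u v : Arr n d} {A B : ℝ}, nrm s (fun _ _ => 1) a₂ a₃ u ≤ ENNReal.ofReal A →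
      nrm s (fun _ _ => 1) a₁ a₂ v ≤ ENNReal.ofReal B → Mulable u v := fun hu hv =>
    mulable_of_nrm hs0 hs (nrm_lt_top hu) (nrm_lt_top hv)
  have e : conv (x w₁) (y w₁) - conv (x w₂) (y w₂) =
      conv (x w₁ - x w₂) (y w₁) + conv (x w₂) (y w₁ - y w₂) := by
    rw [conv_sub_left (hm (hx.1 w₁ h₁) (hy.1 w₁ h₁)) (hm (hx.1 w₂ h₂) (hy.1 w₁ h₁)),
      conv_sub_right (hm (hx.1 w₂ h₂) (hy.1 w₁ h₁)) (hm (hx.1 w₂ h₂) (hy.1 w₂ h₂))]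
    abel
  rw [e]
  set δ := ‖w₁ - w₂‖
  have hδ : 0 ≤ δ := norm_nonneg _
  have e1 := nrm_conv_le_ofReal hs0 hs hV (mul_nonneg hA hδ) (mul_nonneg hA' hδ) hB hB'
    (hx.2 w₁ h₁ w₂ h₂) (hx'.2 w₁ h₁ w₂ h₂) (hy.1 w₁ h₁) (hy'.1 w₁ h₁)
  have e2 := nrm_conv_le_ofReal hs0 hs hV hA hA' (mul_nonneg hB hδ) (mul_nonneg hB' hδ)
    (hx.1 w₂ h₂) (hx'.1 w₂ h₂) (hy.2 w₁ h₁ w₂ h₂) (hy'.2 w₁ h₁ w₂ h₂)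
  refine (nrm_add_le _ _).trans ((add_le_add e1 e2).trans ?_)
  rw [← ENNReal.ofReal_add (by positivity) (by positivity)]
  exact ENNReal.ofReal_le_ofReal (le_of_eq (by ring))

theorem le_two_mul_of_le_add_div_four {D E : ℝ≥0∞} {e : ℝ} (he : 0 ≤ e) (hD : D ≠ ⊤)
    (h : D ≤ E + ENNReal.ofReal (D.toReal / 4)) (hE : E ≤ ENNReal.ofReal e) :
    D ≤ ENNReal.ofReal (2 * e) := by
  have h1 : D ≤ ENNReal.ofReal (e + D.toReal / 4) := by
    rw [ENNReal.ofReal_add he (by positivity)]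
    exact h.trans (add_le_add_left hE _)
  have h2 := ENNReal.toReal_mono ENNReal.ofReal_ne_top h1
  rw [ENNReal.toReal_ofReal (by positivity)] at h2
  rw [← ENNReal.ofReal_toReal hD]
  exact ENNReal.ofReal_le_ofReal (by linarith)

/-- The Neumann series is Lipschitz in the parameter: subtract the equations `y = u + u y` at two
parameters and absorb the difference of the solutions. -/
theorem lipBd_neumann (hs0 : 0 ≤ s) (hs : (n : ℝ) < 2 * s) (hV : IsWeight c V)
    {r A B : ℝ} {u : Param n d → Arr n d} (hA : 0 ≤ A) (hB : 0 ≤ B)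
    (hu : LipBd (nrm s (fun _ _ => 1) r r) O u A) (hu' : LipBd (nrm s V r r) O u B)
    (hsmall : 4 * (mulConst n s c * A) ≤ 1) :
    LipBd (nrm s V r r) O (fun w => neumann (u w)) (8 * B) := by
  have hκ := mulConst_nonneg (n := n) hV.const_nonneg s
  have hsm : ∀ w ∈ O, 4 * (ENNReal.ofReal (mulConst n s c) * nrm s (fun _ _ => 1) r r (u w)) ≤ 1 := by
    intro w hw
    calc _ ≤ 4 * (ENNReal.ofReal (mulConst n s c) * ENNReal.ofReal A) := by
          gcongr
          exact hu.1 w hw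
      _ = ENNReal.ofReal (4 * (mulConst n s c * A)) := by
          rw [ENNReal.ofReal_mul (by norm_num), ENNReal.ofReal_mul hκ, ENNReal.ofReal_ofNat]
      _ ≤ 1 := by
          rw [← ENNReal.ofReal_one]
          exact ENNReal.ofReal_le_ofReal hsmall
  have hy : ∀ w ∈ O, nrm s (fun _ _ => 1) r r (neumann (u w)) ≤ ENNReal.ofReal (2 * A) := by
    intro w hw
    rw [ENNReal.ofReal_mul (by norm_num), ENNReal.ofReal_ofNat]
    exact (nrm_one_neumann_le hs0 hs hV (hsm w hw)).trans (mul_le_mul_right (hu.1 w hw) _)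
  have hy' : ∀ w ∈ O, nrm s V r r (neumann (u w)) ≤ ENNReal.ofReal (2 * B) := by
    intro w hw
    rw [ENNReal.ofReal_mul (by norm_num), ENNReal.ofReal_ofNat]
    exact (nrm_neumann_le hs0 hs hV (hsm w hw)).trans (mul_le_mul_right (hu'.1 w hw) _)
  refine ⟨fun w hw => (hy' w hw).trans (ENNReal.ofReal_le_ofReal (by linarith)),
    fun w₁ h₁ w₂ h₂ => ?_⟩
  set δ := ‖w₁ - w₂‖
  have hδ : 0 ≤ δ := norm_nonneg _
  have hm : ∀ {u v : Arr n d} {A B : ℝ}, nrm s (fun _ _ => 1) r r u ≤ ENNReal.ofReal A →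
      nrm s (fun _ _ => 1) r r v ≤ ENNReal.ofReal B → Mulable u v := fun hu hv =>
    mulable_of_nrm hs0 hs (nrm_lt_top hu) (nrm_lt_top hv)
  set y₁ := neumann (u w₁)
  set y₂ := neumann (u w₂)
  have hy₁ : y₁ = u w₁ + conv (u w₁) y₁ :=
    neumann_eq_left hs0 hs hV (nrm_lt_top (hu.1 w₁ h₁)) (hsm w₁ h₁)
  have hy₂ : y₂ = u w₂ + conv (u w₂) y₂ :=
    neumann_eq_left hs0 hs hV (nrm_lt_top (hu.1 w₂ h₂)) (hsm w₂ h₂)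
  have e : y₁ - y₂ = ((u w₁ - u w₂) + conv (u w₁ - u w₂) y₁) +
      conv (u w₂) (y₁ - y₂) := by
    rw [conv_sub_left (hm (hu.1 w₁ h₁) (hy w₁ h₁)) (hm (hu.1 w₂ h₂) (hy w₁ h₁)),
      conv_sub_right (hm (hu.1 w₂ h₂) (hy w₁ h₁)) (hm (hu.1 w₂ h₂) (hy w₂ h₂))]
    conv_lhs => rw [hy₁, hy₂]
    abel
  have hfin : ∀ {U : (Fin n → ℤ) → (Fin d → ℤ) → ℝ} {b : ℝ},
      nrm s U r r y₁ ≤ ENNReal.ofReal b → nrm s U r r y₂ ≤ ENNReal.ofReal b →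
      nrm s U r r (y₁ - y₂) ≠ ⊤ := fun h h' =>
    ((nrm_sub_le _ _).trans_lt (ENNReal.add_lt_top.2 ⟨nrm_lt_top h, nrm_lt_top h'⟩)).ne
  have hf1 := hfin (hy w₁ h₁) (hy w₂ h₂)
  have hf2 := hfin (hy' w₁ h₁) (hy' w₂ h₂)
  have hD : nrm s (fun _ _ => 1) r r (y₁ - y₂) ≤ ENNReal.ofReal (2 * (2 * A * δ)) := by
    have e1 := nrm_conv_le_ofReal hs0 hs hV.one (mul_nonneg hA hδ) (mul_nonneg hA hδ)
      (by positivity : 0 ≤ 2 * A) (by positivity : 0 ≤ 2 * A)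
      (hu.2 w₁ h₁ w₂ h₂) (hu.2 w₁ h₁ w₂ h₂) (hy w₁ h₁) (hy w₁ h₁)
    have e2 : nrm s (fun _ _ => 1) r r (conv (u w₂) (y₁ - y₂)) ≤ ENNReal.ofReal
        ((nrm s (fun _ _ => 1) r r (y₁ - y₂)).toReal / 4) := by
      refine ((eNorm_mono (absA_conv_le _ _)).trans
        (eNorm_one_econv_le_mulConst hs0 hs hV r r r _ _)).trans ?_
      refine (mul_le_mul_right (mul_le_mul' (hu.1 w₂ h₂) (ENNReal.ofReal_toReal hf1).ge) _).trans ?_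
      rw [← ENNReal.ofReal_mul hA, ← ENNReal.ofReal_mul hκ]
      refine ENNReal.ofReal_le_ofReal ?_
      nlinarith [ENNReal.toReal_nonneg (a := nrm s (fun _ _ => 1) r r (y₁ - y₂))]
    refine le_two_mul_of_le_add_div_four (E := nrm s (fun _ _ => 1) r r (u w₁ - u w₂) +
      nrm s (fun _ _ => 1) r r (conv (u w₁ - u w₂) y₁)) (by positivity) hf1 ?_ ?_
    · conv_lhs => rw [e]
      exact (nrm_add_le _ _).trans (add_le_add (nrm_add_le _ _) e2)
    · refine (add_le_add (hu.2 w₁ h₁ w₂ h₂) e1).trans ?_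
      rw [← ENNReal.ofReal_add (by positivity) (by positivity)]
      refine ENNReal.ofReal_le_ofReal ?_
      nlinarith [mul_nonneg hA hδ]
  have e1 := nrm_conv_le_ofReal hs0 hs hV (mul_nonneg hA hδ) (mul_nonneg hB hδ)
    (by positivity : 0 ≤ 2 * A) (by positivity : 0 ≤ 2 * B)
    (hu.2 w₁ h₁ w₂ h₂) (hu'.2 w₁ h₁ w₂ h₂) (hy w₁ h₁) (hy' w₁ h₁)
  have e2 := nrm_conv_le_ofReal hs0 hs hV hA hB (by positivity : 0 ≤ 2 * (2 * A * δ))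
    ENNReal.toReal_nonneg (hu.1 w₂ h₂) (hu'.1 w₂ h₂) hD (ENNReal.ofReal_toReal hf2).ge
  set D := (nrm s V r r (y₁ - y₂)).toReal
  have hD0 : 0 ≤ D := ENNReal.toReal_nonneg
  have e3 : nrm s V r r (conv (u w₂) (y₁ - y₂)) ≤
      ENNReal.ofReal (B * δ) + ENNReal.ofReal (D / 4) := by
    refine e2.trans ?_
    rw [← ENNReal.ofReal_add (by positivity) (by positivity)]
    refine ENNReal.ofReal_le_ofReal ?_
    nlinarith [mul_nonneg hB hδ]
  have hE : nrm s V r r (u w₁ - u w₂) + nrm s V r r (conv (u w₁ - u w₂) y₁) +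
      ENNReal.ofReal (B * δ) ≤ ENNReal.ofReal (4 * B * δ) := by
    refine (add_le_add_left (add_le_add (hu'.2 w₁ h₁ w₂ h₂) e1) _).trans ?_
    rw [← ENNReal.ofReal_add (by positivity) (by positivity),
      ← ENNReal.ofReal_add (by positivity) (by positivity)]
    refine ENNReal.ofReal_le_ofReal ?_
    nlinarith [mul_nonneg hB hδ]
  have hfinal : nrm s V r r (y₁ - y₂) ≤ ENNReal.ofReal (2 * (4 * B * δ)) := by
    refine le_two_mul_of_le_add_div_four (by positivity) hf2 ?_ hE
    conv_lhs => rw [e]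
    refine ((nrm_add_le _ _).trans (add_le_add (nrm_add_le _ _) e3)).trans (le_of_eq ?_)
    rw [add_assoc, add_assoc, add_assoc]
  exact hfinal.trans (ENNReal.ofReal_le_ofReal (by linarith))

end Operations
end LipschitzBounds

/-! ### The algebra of one step -/

section MatrixProducts

variable {d : ℕ}

theorem HasMatMul.add_left {A A' B C C' : OpMatrix d} (h : HasMatMul A B C)
    (h' : HasMatMul A' B C') : HasMatMul (A + A') B (C + C') := fun j j' => by
  simpa only [Matrix.add_apply, add_mul] using (h j j').add (h' j j')

theorem HasMatMul.add_right {A B B' C C' : OpMatrix d} (h : HasMatMul A B C)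
    (h' : HasMatMul A B' C') : HasMatMul A (B + B') (C + C') := fun j j' => by
  simpa only [Matrix.add_apply, mul_add] using (h j j').add (h' j j')

theorem hasMatMul_diagonal_left (v : (Fin d → ℤ) → ℂ) (B : OpMatrix d) :
    HasMatMul (Matrix.diagonal v) B (Matrix.of fun j j' => v j * B j j') := fun j j' => by
  have h := hasSum_single (f := fun k => Matrix.diagonal v j k * B k j') j fun k hk => by
    rw [Matrix.diagonal_apply_ne _ hk.symm, zero_mul]
  simpa using h

theorem hasMatMul_diagonal_right (A : OpMatrix d) (v : (Fin d → ℤ) → ℂ) :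
    HasMatMul A (Matrix.diagonal v) (Matrix.of fun j j' => A j j' * v j') := fun j j' => by
  have h := hasSum_single (f := fun k => A j k * Matrix.diagonal v k j') j' fun k hk => by
    rw [Matrix.diagonal_apply_ne _ hk, mul_zero]
  simpa using h

theorem hasMatMul_one_left (B : OpMatrix d) : HasMatMul 1 B B := by
  intro j j'
  simpa using hasMatMul_diagonal_left (fun _ => 1) B j j'

theorem hasMatMul_one_right (A : OpMatrix d) : HasMatMul A 1 A := by
  intro j j'
  simpa using hasMatMul_diagonal_right A (fun _ => 1) j j'

theorem HasMatMul.mul_diagonal {A B C : OpMatrix d} (h : HasMatMul A B C)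
    (v : (Fin d → ℤ) → ℂ) :
    HasMatMul A (Matrix.of fun j j' => B j j' * v j') (Matrix.of fun j j' => C j j' * v j') := fun j j' => by
  simpa only [mul_assoc, Matrix.of_apply] using (h j j').mul_right (v j')

end MatrixProducts

section KamStep

variable {n d : ℕ}

open Classical in
/-- The part of an array on the modes `(l, j - j') ∈ S`. -/
def projA (S : Set ((Fin n → ℤ) × (Fin d → ℤ))) (p : Arr n d) : Arr n d := fun l j j' =>
  if (l, j - j') ∈ S then p l j j' else 0

/-- The divisors of the homological equation. -/
def divisor (ω : Fin n → ℝ) (lam : (Fin d → ℤ) → ℂ) (l : Fin n → ℤ) (j j' : Fin d → ℤ) : ℂ :=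
  Complex.I * (dotInt ω l : ℂ) - lam j + lam j'

/-- The time-averaged diagonal of `p`, when the mode `(0, 0)` is in `S`. -/
def meanA (S : Set ((Fin n → ℤ) × (Fin d → ℤ))) (p : Arr n d) : Arr n d := projA (S ∩ {0}) p

/-- The solution `x` of the homological equation
`ω · ∂_φ x = [diag lam, x] + Π_S p - diag p̂(0)`. -/
def solA (S : Set ((Fin n → ℤ) × (Fin d → ℤ))) (ω : Fin n → ℝ) (lam : (Fin d → ℤ) → ℂ)
    (p : Arr n d) : Arr n d := fun l j j' => projA (S \ {0}) p l j j' / divisor ω lam l j j'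

/-- What is left of `(diag lam + p) (1 + x) - ω · ∂_φ x` after subtraction of
`(1 + x) (diag lam + diag p̂(0))`. -/
def restA (S : Set ((Fin n → ℤ) × (Fin d → ℤ))) (ω : Fin n → ℝ) (lam : (Fin d → ℤ) → ℂ)
    (p : Arr n d) : Arr n d :=
  p - projA S p + conv p (solA S ω lam p) - conv (solA S ω lam p) (meanA S p)

/-- The new perturbation `(1 + x)⁻¹` applied to `restA`. -/
def stepA (S : Set ((Fin n → ℤ) × (Fin d → ℤ))) (ω : Fin n → ℝ) (lam : (Fin d → ℤ) → ℂ)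
    (p : Arr n d) : Arr n d :=
  restA S ω lam p + conv (neumann (-solA S ω lam p)) (restA S ω lam p)

variable {S : Set ((Fin n → ℤ) × (Fin d → ℤ))} {ω : Fin n → ℝ} {lam : (Fin d → ℤ) → ℂ}
  {p : Arr n d}

theorem solA_mul_divisor
    (hdiv : ∀ l j j', (l, j - j') ∈ S \ {0} → divisor ω lam l j j' ≠ 0)
    (l : Fin n → ℤ) (j j' : Fin d → ℤ) :
    solA S ω lam p l j j' * divisor ω lam l j j' = projA S p l j j' - meanA S p l j j' := by
  by_cases h : (l, j - j') ∈ S \ {0}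
  · rw [solA, div_mul_cancel₀ _ (hdiv l j j' h)]
    have h3 : (l, j - j') ∉ S ∩ {0} := fun h3 => h.2 h3.2
    rw [meanA, projA, projA, projA, if_pos h, if_pos h.1, if_neg h3, sub_zero]
  · have h1 : solA S ω lam p l j j' = 0 := by rw [solA, projA, if_neg h, zero_div]
    rw [h1, zero_mul]
    by_cases h2 : (l, j - j') ∈ S
    · have h3 : (l, j - j') ∈ S ∩ {0} := ⟨h2, by_contra fun h3 => h ⟨h2, h3⟩⟩
      simp [projA, meanA, h2, h3]
    · have h3 : (l, j - j') ∉ S ∩ {0} := fun h3 => h2 h3.1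
      simp only [projA, meanA, if_neg h2, if_neg h3, sub_zero]

theorem meanA_eq_zero {l : Fin n → ℤ} {j j' : Fin d → ℤ} (h : ¬(l = 0 ∧ j = j')) :
    meanA S p l j j' = 0 := by
  refine if_neg fun h' => h ?_
  have := Prod.mk_eq_zero.1 (h'.2 : (l, j - j') = 0)
  exact ⟨this.1, sub_eq_zero.1 this.2⟩

theorem conv_meanA (x : Arr n d) (l : Fin n → ℤ) (j j' : Fin d → ℤ) :
    conv x (meanA S p) l j j' = x l j j' * meanA S p 0 j' j' := by
  rw [conv, tsum_eq_single ((0 : Fin n → ℤ), j')]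
  · simp
  · intro t ht
    rw [meanA_eq_zero (fun h => ht (Prod.ext h.1 h.2)), mul_zero]

theorem ev_meanA (θ : UnitAddTorus (Fin n)) :
    ev (meanA S p) θ = Matrix.diagonal fun j => meanA S p 0 j j := by
  ext j j'
  by_cases h : j = j'
  · subst h
    rw [Matrix.diagonal_apply_eq, ev, tsum_eq_single 0]
    · simp [UnitAddTorus.mFourier_zero]
    · intro l hl
      rw [meanA_eq_zero (fun h => hl h.1), zero_mul]
  · rw [Matrix.diagonal_apply_ne _ h, ev]
    have : ∀ l, meanA S p l j j' = 0 := fun l => meanA_eq_zero fun h' => h h'.2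
    simp [this]

theorem mFourier_torusShift (l : Fin n → ℤ) (θ : UnitAddTorus (Fin n)) (ω : Fin n → ℝ) (t : ℝ) :
    UnitAddTorus.mFourier l (torusShift θ ω t) =
      UnitAddTorus.mFourier l θ * Complex.exp (t * (Complex.I * (dotInt ω l : ℂ))) := by
  have h : ∀ i, fourier (l i) (torusShift θ ω t i) =
      fourier (l i) (θ i) * Complex.exp (t * (Complex.I * (ω i * l i))) := by
    intro i
    rw [torusShift, fourier_apply, smul_add, AddCircle.toCircle_add, Circle.coe_mul,
      ← fourier_apply, ← fourier_apply, fourier_coe_apply]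
    congr 2
    have : (Real.pi : ℂ) ≠ 0 := by exact_mod_cast Real.pi_ne_zero
    push_cast
    field_simp
  simp only [UnitAddTorus.mFourier, ContinuousMap.coe_mk, h, Finset.prod_mul_distrib]
  rw [← Complex.exp_sum]
  congr 2
  rw [dotInt]
  push_cast
  rw [Finset.mul_sum, Finset.mul_sum]

/-- A family with finitely many time frequencies is differentiable along `ω`. -/
theorem hasOmegaDeriv_ev {x : Arr n d} {F : Finset (Fin n → ℤ)} (ω : Fin n → ℝ)
    (hF : ∀ l ∉ F, ∀ j j', x l j j' = 0) :
    HasOmegaDeriv ω (ev x) (ev fun l j j' => Complex.I * (dotInt ω l : ℂ) * x l j j') := by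
  intro θ j j'
  have h1 : ∀ θ', ev x θ' j j' = ∑ l ∈ F, x l j j' * UnitAddTorus.mFourier l θ' := fun θ' =>
    tsum_eq_sum fun l hl => by rw [hF l hl, zero_mul]
  have h2 : ev (fun l j j' => Complex.I * (dotInt ω l : ℂ) * x l j j') θ j j' =
      ∑ l ∈ F, Complex.I * (dotInt ω l : ℂ) * x l j j' * UnitAddTorus.mFourier l θ :=
    tsum_eq_sum fun l hl => by simp only [hF l hl, mul_zero, zero_mul]
  rw [h2]
  simp only [h1, mFourier_torusShift]
  refine HasDerivAt.fun_sum fun l _ => ?_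
  have h3 : HasDerivAt (fun t : ℝ => Complex.exp (t * (Complex.I * (dotInt ω l : ℂ))))
      (Complex.I * (dotInt ω l : ℂ)) 0 := by
    have := ((hasDerivAt_id (0 : ℝ)).ofReal_comp.mul_const
      (Complex.I * (dotInt ω l : ℂ))).cexp
    simpa using this
  have h4 := (h3.const_mul (UnitAddTorus.mFourier l θ)).const_mul (x l j j')
  refine h4.congr_deriv ?_
  ring

theorem nrm_projA_le {s a b : ℝ} {V : (Fin n → ℤ) → (Fin d → ℤ) → ℝ} :
    nrm s V a b (projA S p) ≤ nrm s V a b p :=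
  nrm_mono fun l j j' => by
    unfold projA
    split_ifs
    · exact le_rfl
    · simp

theorem projA_sub (p q : Arr n d) : projA S (p - q) = projA S p - projA S q := by
  ext l j j'
  simp only [projA, Pi.sub_apply]
  split_ifs <;> simp

/-- One step of the scheme conjugates `diag lam + p` to `diag lam' + p'`. -/
theorem isPushforward_step {s c a b : ℝ} (hs0 : 0 ≤ s) (hs : (n : ℝ) < 2 * s)
    {V : (Fin n → ℤ) → (Fin d → ℤ) → ℝ} (hV : IsWeight c V)
    (hS : Set.Finite (Prod.fst '' S))
    (hdiv : ∀ l j j', (l, j - j') ∈ S \ {0} → divisor ω lam l j j' ≠ 0)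
    (hp : nrm s (fun _ _ => 1) a b p < ⊤)
    (hx : ∀ r ∈ ({a, b} : Set ℝ), nrm s (fun _ _ => 1) r r (solA S ω lam p) < ⊤)
    (hsm : ∀ r ∈ ({a, b} : Set ℝ), 4 * (ENNReal.ofReal (mulConst n s c) *
      nrm s (fun _ _ => 1) r r (solA S ω lam p)) ≤ 1)
    (hmem : ∀ r ∈ ({a, b} : Set ℝ), ∀ x : Arr n d, nrm s (fun _ _ => 1) r r x < ⊤ →
      MemM s r r (ev x)) :
    IsPushforward s b a ω (fun θ => 1 + ev (solA S ω lam p) θ)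
      (diagPlus lam (ev p))
      (diagPlus (fun j => lam j + meanA S p 0 j j) (ev (stepA S ω lam p))) := by
  set x := solA S ω lam p with hxdef
  set y := neumann (-x) with hydef
  set z := meanA S p with hz
  set q := restA S ω lam p with hq
  have ha : a ∈ ({a, b} : Set ℝ) := by simp
  have hb : b ∈ ({a, b} : Set ℝ) := by simp
  have hx' : ∀ r ∈ ({a, b} : Set ℝ), nrm s (fun _ _ => 1) r r (-x) < ⊤ := by
    simpa only [nrm_neg] using hx
  have hsm' : ∀ r ∈ ({a, b} : Set ℝ), 4 * (ENNReal.ofReal (mulConst n s c) *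
      nrm s (fun _ _ => 1) r r (-x)) ≤ 1 := by simpa only [nrm_neg] using hsm
  have hy : ∀ r ∈ ({a, b} : Set ℝ), nrm s (fun _ _ => 1) r r y < ⊤ := fun r hr =>
    (nrm_one_neumann_le hs0 hs hV (hsm' r hr)).trans_lt (ENNReal.mul_lt_top (by simp) (hx' r hr))
  have hzn : nrm s (fun _ _ => 1) a b z < ⊤ := nrm_projA_le.trans_lt hp
  have hM : ∀ {u v : Arr n d} {a₁ a₂ a₃ : ℝ}, nrm s (fun _ _ => 1) a₂ a₃ u < ⊤ →
      nrm s (fun _ _ => 1) a₁ a₂ v < ⊤ → Mulable u v := fun hu hv => mulable_of_nrm hs0 hs hu hv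
  have hfc : ∀ {u v : Arr n d} {a₁ a₂ a₃ : ℝ}, nrm s (fun _ _ => 1) a₂ a₃ u < ⊤ →
      nrm s (fun _ _ => 1) a₁ a₂ v < ⊤ → nrm s (fun _ _ => 1) a₁ a₃ (conv u v) < ⊤ :=
    fun hu hv => (eNorm_mono (absA_conv_le _ _)).trans_lt (eNorm_econv_lt_top hs0 hs hu hv)
  have hT : ∀ {u : Arr n d} {a₁ a₂ : ℝ}, nrm s (fun _ _ => 1) a₁ a₂ u < ⊤ → TimeSummable u :=
    fun hu => timeSummable_of_nrm hs isWeight_one hu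
  have hqn : nrm s (fun _ _ => 1) a b q < ⊤ := by
    have h1 : nrm s (fun _ _ => 1) a b (p - projA S p) < ⊤ := (nrm_sub_le _ _).trans_lt
      (ENNReal.add_lt_top.2 ⟨hp, nrm_projA_le.trans_lt hp⟩)
    have h2 := hfc hp (hx a ha)
    have h3 := hfc (hx b hb) hzn
    exact (nrm_sub_le _ _).trans_lt (ENNReal.add_lt_top.2
      ⟨(nrm_add_le _ _).trans_lt (ENNReal.add_lt_top.2 ⟨h1, h2⟩), h3⟩)
  have hTx := hT (hx b hb)
  have hTy := hT (hy b hb)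
  -- `1 + y` is the inverse of `1 + x`
  have hyx : conv y x = -x - y := by
    have h := neumann_eq_right hs0 hs hV (hx' b hb) (hsm' b hb)
    have h2 : conv y (-x) = -conv y x := by
      ext l j j'
      simp [conv, tsum_neg]
    rw [← hydef, h2] at h
    rw [eq_sub_iff_add_eq, ← sub_eq_zero]
    nth_rewrite 2 [h]
    abel
  have hxy : conv x y = -x - y := by
    have h := neumann_eq_left hs0 hs hV (hx' b hb) (hsm' b hb)
    rw [← hydef, conv_neg_left] at h
    rw [eq_sub_iff_add_eq, ← sub_eq_zero]
    nth_rewrite 2 [h]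
    abel
  have hev : ev (-x - y) = -ev x - ev y := by
    rw [ev_sub _ hTy]
    · congr 1
      ext θ j j'
      simp [ev, tsum_neg]
    · intro j j'
      simpa using hTx j j'
  have hinv1 : ∀ θ, HasMatMul (1 + ev y θ) (1 + ev x θ) 1 := by
    intro θ
    have h := hasMatMul_ev hTy hTx (hM (hy b hb) (hx b hb)) θ
    rw [hyx, hev] at h
    have := (hasMatMul_one_left (1 + ev x θ)).add_left ((hasMatMul_one_right (ev y θ)).add_right h)
    convert this using 1
    simp only [Pi.sub_apply, Pi.neg_apply]
    abel
  have hinv2 : ∀ θ, HasMatMul (1 + ev x θ) (1 + ev y θ) 1 := by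
    intro θ
    have h := hasMatMul_ev hTx hTy (hM (hx b hb) (hy b hb)) θ
    rw [hxy, hev] at h
    have := (hasMatMul_one_left (1 + ev y θ)).add_left ((hasMatMul_one_right (ev x θ)).add_right h)
    convert this using 1
    simp only [Pi.sub_apply, Pi.neg_apply]
    abel
  let D : Arr n d := fun l j j' => Complex.I * (dotInt ω l : ℂ) * x l j j'
  have hF : ∀ l ∉ hS.toFinset, ∀ j j', x l j j' = 0 := by
    intro l hl j j'
    have : (l, j - j') ∉ S \ {0} := fun h => hl (by
      rw [Set.Finite.mem_toFinset]
      exact ⟨_, h.1, rfl⟩)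
    rw [hxdef, solA, projA, if_neg this, zero_div]
  refine ⟨fun θ => 1 + ev y θ, ev D, fun θ => (Matrix.diagonal lam + ev p θ) +
    ((Matrix.of fun j j' => lam j * ev x θ j j') + ev (conv p x) θ), ⟨fun θ => ⟨hinv1 θ, hinv2 θ⟩, ?_, ?_⟩,
    ?_, ?_, ?_⟩
  · simpa using hmem b hb y (hy b hb)
  · simpa using hmem a ha y (hy a ha)
  · intro θ j j'
    have h := (hasOmegaDeriv_ev ω hF θ j j').const_add ((1 : OpMatrix d) j j')
    exact h
  · intro θ
    refine (hasMatMul_one_right _).add_right ?_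
    exact (hasMatMul_diagonal_left _ _).add_left (hasMatMul_ev (hT hp) (hT (hx a ha))
      (hM hp (hx a ha)) θ)
  · intro θ
    have h1 := (hinv1 θ).mul_diagonal (fun j => lam j + z 0 j j)
    have h2 := (hasMatMul_one_left (ev q θ)).add_left
      (hasMatMul_ev hTy (hT hqn) (hM (hy b hb) hqn) θ)
    have h3 := h1.add_right h2
    convert h3 using 1
    · -- the identity of coefficients behind the homological equation
      have hid : ∀ l j j', p l j j' + lam j * x l j j' + conv p x l j j' - D l j j' =
          z l j j' + x l j j' * (lam j' + z 0 j' j') + q l j j' := by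
        intro l j j'
        have hhom := solA_mul_divisor (p := p) hdiv l j j'
        rw [divisor] at hhom
        have hqe : q l j j' = p l j j' - projA S p l j j' + conv p x l j j' -
            x l j j' * z 0 j' j' := by
          rw [hq, hz, hxdef, ← conv_meanA]
          rfl
        rw [hqe]
        simp only [D]
        linear_combination -hhom
      ext j j'
      have s1 := (hT hp).summable_ev j j' θ
      have s2 := hTx.summable_ev j j' θ
      have s3 := (hT (hfc hp (hx a ha))).summable_ev j j' θ
      have s4 : Summable fun l => D l j j' * UnitAddTorus.mFourier l θ :=
        summable_of_ne_finset_zero (s := hS.toFinset) fun l hl => by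
          simp only [D]
          rw [hF l hl, mul_zero, zero_mul]
      have s5 := (hT hzn).summable_ev j j' θ
      have s6 := (hT hqn).summable_ev j j' θ
      have e1 := ((s1.hasSum.add (s2.hasSum.mul_left (lam j))).add s3.hasSum).sub s4.hasSum
      have e2 := (s5.hasSum.add (s2.hasSum.mul_right (lam j' + z 0 j' j'))).add s6.hasSum
      have e3 := e1.unique (e2.congr_fun fun l => by
        have := hid l j j'
        linear_combination (UnitAddTorus.mFourier l θ) * this)
      change ev p θ j j' + lam j * ev x θ j j' + ev (conv p x) θ j j' - ev D θ j j' =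
        ev z θ j j' + ev x θ j j' * (lam j' + z 0 j' j') + ev q θ j j' at e3
      rw [hz, ev_meanA, ← hz] at e3
      simp only [Matrix.sub_apply, Matrix.add_apply, Matrix.of_apply]
      by_cases hjj : j = j'
      · subst hjj
        simp only [Matrix.diagonal_apply_eq, Matrix.one_apply_eq] at e3 ⊢
        linear_combination e3
      · simp only [Matrix.diagonal_apply_ne _ hjj, Matrix.one_apply_ne hjj] at e3 ⊢
        linear_combination e3
    · rw [diagPlus, stepA, ev_add (hT hqn) (hT (hfc (hy b hb) hqn))]
      simp only [Pi.add_apply]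
      congr 1
      ext j j'
      by_cases hjj : j = j'
      · subst hjj
        simp
      · simp [Matrix.diagonal_apply_ne _ hjj, Matrix.one_apply_ne hjj]

end KamStep

/-! ### Reality and reversibility -/

section Parity

variable {n d : ℕ}

/-- For `ε = -1` the coefficients of a real and reversible family, for `ε = 1` those of a real and
reversibility preserving one: complex conjugation and the reflection
`(l, j, j') ↦ (-l, -j, -j')` both act as multiplication by `ε`. -/
structure HasParity (ε : ℂ) (x : Arr n d) : Prop where
  conj : ∀ l j j', (starRingEnd ℂ) (x l j j') = ε * x l j j'
  refl : ∀ l j j', x (-l) (-j) (-j') = ε * x l j j'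

theorem HasParity.add {ε : ℂ} {x y : Arr n d} (hx : HasParity ε x) (hy : HasParity ε y) :
    HasParity ε (x + y) :=
  ⟨fun l j j' => by simp [hx.conj, hy.conj, mul_add], fun l j j' => by
    simp [hx.refl, hy.refl, mul_add]⟩

theorem HasParity.neg {ε : ℂ} {x : Arr n d} (hx : HasParity ε x) : HasParity ε (-x) :=
  ⟨fun l j j' => by simp [hx.conj], fun l j j' => by simp [hx.refl]⟩

theorem HasParity.sub {ε : ℂ} {x y : Arr n d} (hx : HasParity ε x) (hy : HasParity ε y) :
    HasParity ε (x - y) := by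
  rw [sub_eq_add_neg]
  exact hx.add hy.neg

theorem HasParity.conv {ε ε' : ℂ} {x y : Arr n d} (hx : HasParity ε x) (hy : HasParity ε' y) :
    HasParity (ε * ε') (conv x y) := by
  refine ⟨fun l j j' => ?_, fun l j j' => ?_⟩
  · rw [_root_.conv, Complex.conj_tsum, ← tsum_mul_left]
    refine tsum_congr fun t => ?_
    rw [map_mul, hx.conj, hy.conj]
    ring
  · rw [_root_.conv, _root_.conv, ← tsum_mul_left, ← Equiv.tsum_eq (Equiv.neg _)]
    refine tsum_congr fun t => ?_
    rw [Equiv.neg_apply, Prod.fst_neg, Prod.snd_neg, ← neg_sub', hx.refl, hy.refl]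
    ring

theorem HasParity.projA {ε : ℂ} {p : Arr n d} {S : Set ((Fin n → ℤ) × (Fin d → ℤ))}
    (hp : HasParity ε p) (hS : ∀ t, -t ∈ S ↔ t ∈ S) : HasParity ε (projA S p) := by
  refine ⟨fun l j j' => ?_, fun l j j' => ?_⟩
  · rw [_root_.projA]
    split_ifs
    · exact hp.conj l j j'
    · simp
  · have h : (-l, -j - -j') ∈ S ↔ (l, j - j') ∈ S := by
      rw [← hS (l, j - j'), Prod.neg_mk, neg_sub']
    rw [_root_.projA, _root_.projA]
    by_cases h' : (l, j - j') ∈ S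
    · rw [if_pos (h.2 h'), if_pos h', hp.refl]
    · rw [if_neg (fun h2 => h' (h.1 h2)), if_neg h', mul_zero]

theorem HasParity.neumann {u : Arr n d} (hu : HasParity 1 u) : HasParity 1 (neumann u) := by
  have h : ∀ k, HasParity 1 (cpow u k) := by
    intro k
    induction k with
    | zero => exact hu
    | succ k ih =>
      have := hu.conv ih
      rwa [one_mul] at this
  refine ⟨fun l j j' => ?_, fun l j j' => ?_⟩
  · rw [_root_.neumann, Complex.conj_tsum, ← tsum_mul_left]
    exact tsum_congr fun k => (h k).conj l j j'
  · rw [_root_.neumann, _root_.neumann, ← tsum_mul_left]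
    exact tsum_congr fun k => (h k).refl l j j'

variable {S : Set ((Fin n → ℤ) × (Fin d → ℤ))} {ω : Fin n → ℝ} {lam : (Fin d → ℤ) → ℂ}
  {p : Arr n d}

theorem dotInt_neg (x : Fin n → ℝ) (l : Fin n → ℤ) : dotInt x (-l) = -dotInt x l := by
  simp [dotInt]

theorem HasParity.solA (hp : HasParity (-1) p) (hS : ∀ t, -t ∈ S ↔ t ∈ S)
    (hc : ∀ j, (starRingEnd ℂ) (lam j) = -lam j) (hr : ∀ j, lam (-j) = -lam j) :
    HasParity 1 (solA S ω lam p) := by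
  have h := hp.projA (S := S \ {0}) (fun t => by
    rw [Set.mem_sdiff, Set.mem_sdiff, hS, Set.mem_singleton_iff, Set.mem_singleton_iff, neg_eq_zero])
  have h1 : ∀ l j j', (starRingEnd ℂ) (divisor ω lam l j j') = -divisor ω lam l j j' := by
    intro l j j'
    simp only [divisor, map_add, map_sub, map_mul, hc, Complex.conj_I, Complex.conj_ofReal]
    ring
  have h2 : ∀ l j j', divisor ω lam (-l) (-j) (-j') = -divisor ω lam l j j' := by
    intro l j j'
    simp only [divisor, hr, dotInt_neg]
    push_cast
    ring
  refine ⟨fun l j j' => ?_, fun l j j' => ?_⟩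
  · rw [_root_.solA, map_div₀, h.conj, h1, neg_mul, one_mul, neg_div_neg_eq, one_mul]
  · rw [_root_.solA, _root_.solA, h.refl, h2, neg_mul, one_mul, neg_div_neg_eq, one_mul]

theorem HasParity.meanA (hp : HasParity (-1) p) (hS : ∀ t, -t ∈ S ↔ t ∈ S) :
    HasParity (-1) (meanA S p) :=
  hp.projA fun t => by
    rw [Set.mem_inter_iff, Set.mem_inter_iff, hS, Set.mem_singleton_iff, Set.mem_singleton_iff,
      neg_eq_zero]

theorem HasParity.stepA (hp : HasParity (-1) p) (hS : ∀ t, -t ∈ S ↔ t ∈ S)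
    (hc : ∀ j, (starRingEnd ℂ) (lam j) = -lam j) (hr : ∀ j, lam (-j) = -lam j) :
    HasParity (-1) (stepA S ω lam p) := by
  have hx := hp.solA (ω := ω) hS hc hr
  have hq : HasParity (-1) (restA S ω lam p) := by
    have h1 := hp.conv hx
    have h2 := hx.conv (hp.meanA hS)
    rw [mul_one] at h1
    rw [one_mul] at h2
    exact ((hp.sub (hp.projA hS)).add h1).sub h2
  have h3 := hx.neg.neumann.conv hq
  rw [one_mul] at h3
  exact hq.add h3

theorem mFourier_neg_apply (l : Fin n → ℤ) (θ : UnitAddTorus (Fin n)) :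
    UnitAddTorus.mFourier l (-θ) = UnitAddTorus.mFourier (-l) θ := by
  simp [UnitAddTorus.mFourier, fourier_apply]

theorem conj_ev (x : Arr n d) (θ : UnitAddTorus (Fin n)) (j j' : Fin d → ℤ) :
    (starRingEnd ℂ) (ev x θ j j') =
      ∑' l, (starRingEnd ℂ) (x (-l) j j') * UnitAddTorus.mFourier l θ := by
  rw [ev, Complex.conj_tsum, ← Equiv.tsum_eq (Equiv.neg _)]
  refine tsum_congr fun l => ?_
  rw [Equiv.neg_apply, map_mul, ← UnitAddTorus.mFourier_neg, neg_neg]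

theorem ev_neg_apply (x : Arr n d) (θ : UnitAddTorus (Fin n)) (j j' : Fin d → ℤ) :
    ev x (-θ) j j' = ∑' l, x (-l) j j' * UnitAddTorus.mFourier l θ := by
  rw [ev, ← Equiv.tsum_eq (Equiv.neg _)]
  refine tsum_congr fun l => ?_
  rw [Equiv.neg_apply, mFourier_neg_apply, neg_neg]

theorem HasParity.isRealFamily (hp : HasParity (-1) p) : IsRealFamily (ev p) := by
  intro θ j j'
  rw [conj_ev]
  refine tsum_congr fun l => ?_
  rw [hp.conj, hp.refl]
  ring

theorem HasParity.isReversibleFamily (hp : HasParity (-1) p) : IsReversibleFamily (ev p) := by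
  intro θ j j'
  rw [ev_neg_apply, ev, ← tsum_neg]
  refine tsum_congr fun l => ?_
  have := hp.refl l j (-j')
  rw [neg_neg] at this
  rw [this]
  ring

theorem hasParity_of_real_of_reversible (hp : TimeSummable p) (h1 : IsRealFamily (ev p))
    (h2 : IsReversibleFamily (ev p)) : HasParity (-1) p := by
  have hT : TimeSummable fun l j j' => p (-l) (-j) (-j') := by
    intro j j'
    have := hp (-j) (-j')
    rwa [← Equiv.tsum_eq (Equiv.neg _)] at this
  have e1 : p = fun l j j' => (starRingEnd ℂ) (p (-l) (-j) (-j')) := by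
    refine ev_injective hp (fun j j' => ?_) ?_
    · simpa using hT j j'
    · ext θ j j'
      rw [h1 θ j j', conj_ev]
      rfl
  have e2 : p = fun l j j' => -p (-l) (-j) (-j') := by
    refine ev_injective hp (fun j j' => ?_) ?_
    · simpa using hT j j'
    · ext θ j j'
      have := h2 θ j (-j')
      rw [neg_neg] at this
      rw [this, ev_neg_apply, ev, ← tsum_neg]
      simp only [neg_mul]
  have e3 : ∀ l j j', p (-l) (-j) (-j') = -1 * p l j j' := fun l j j' => by
    have : p l j j' = -p (-l) (-j) (-j') := congrFun (congrFun (congrFun e2 l) j) j'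
    rw [this]
    ring
  refine ⟨fun l j j' => ?_, e3⟩
  have := congrFun (congrFun (congrFun e1 l) j) j'
  simp only [e3] at this
  conv_lhs => rw [this]
  simp

end Parity

/-! ### The homological equation -/

section StepEstimates

variable {n d : ℕ}

theorem wt_nonneg {V : (Fin n → ℤ) → (Fin d → ℤ) → ℝ} (hV : ∀ l h, 0 ≤ V l h) (a b : ℝ)
    (l : Fin n → ℤ) (j j' : Fin d → ℤ) : 0 ≤ wt V a b l j j' :=
  mul_nonneg (hV _ _)
    (mul_nonneg (Real.rpow_nonneg (jap_pos _).le _) (Real.rpow_nonneg (jap_pos _).le _))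

theorem nrm_le_of_wt_le {s a b a' b' C : ℝ} {V V' : (Fin n → ℤ) → (Fin d → ℤ) → ℝ}
    {x y : Arr n d} (hC : 0 ≤ C) (hV : ∀ l h, 0 ≤ V l h) (hV' : ∀ l h, 0 ≤ V' l h)
    (h : ∀ l j j', wt V a b l j j' * ‖x l j j'‖ ≤ C * (wt V' a' b' l j j' * ‖y l j j'‖)) :
    nrm s V a b x ≤ ENNReal.ofReal C * nrm s V' a' b' y := by
  rw [nrm, nrm, eNorm, eNorm, ← sq2_const_mul]
  refine sq2_mono fun t => ?_
  rw [mul_left_comm (ENNReal.ofReal C)]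
  refine mul_le_mul' le_rfl ?_
  simp only [absA, ← ofReal_norm]
  rw [← ENNReal.ofReal_mul (wt_nonneg hV _ _ _ _ _), ← ENNReal.ofReal_mul
    (wt_nonneg hV' _ _ _ _ _), ← ENNReal.ofReal_mul hC]
  exact ENNReal.ofReal_le_ofReal (h _ _ _)

theorem jap_le_mul_jap_sub (j j' : Fin d → ℤ) : jap j ≤ 2 * (jap (j - j') * jap j') := by
  have := jap_add_le_mul (j - j') j'
  rwa [sub_add_cancel] at this

theorem jap_sub_comm (j j' : Fin d → ℤ) : jap (j - j') = jap (j' - j) := by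
  rw [← jap_neg, neg_sub]

/-- The smoothing by `2m = 4τ + 4` derivatives pays for the loss `⟨j⟩^{2τ} ⟨j'⟩^{2τ}` in the
Melnikov conditions, up to a power of `⟨j - j'⟩`. -/
theorem jap_rpow_mul_le {τ σ r : ℝ} (hτ : 0 ≤ τ)
    (hr : r ∈ ({σ - kamM τ, σ + kamM τ} : Set ℝ)) (j j' : Fin d → ℤ) :
    (jap j ^ (2 * τ) * jap j' ^ (2 * τ)) * (jap j ^ r * jap j' ^ (-r)) ≤
      2 ^ (2 * τ) * jap (j - j') ^ (2 * τ) *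
        (jap j ^ (σ + kamM τ) * jap j' ^ (-(σ - kamM τ))) := by
  have hj := jap_pos j
  have hj' := jap_pos j'
  have hh := jap_pos (j - j')
  have key : ∀ i i' : Fin d → ℤ, jap i ^ (2 * τ) ≤
      2 ^ (2 * τ) * jap (i - i') ^ (2 * τ) * jap i' ^ (2 * τ) := by
    intro i i'
    rw [← Real.mul_rpow (by norm_num) (jap_pos _).le, ← Real.mul_rpow
      (mul_pos two_pos (jap_pos _)).le (jap_pos _).le, mul_assoc]
    exact Real.rpow_le_rpow (jap_pos _).le (jap_le_mul_jap_sub i i') (by linarith)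
  rcases hr with rfl | hr
  · have h1 := key j' j
    rw [jap_sub_comm j' j] at h1
    have h2 : jap j ^ (2 * τ) * jap j ^ (2 * τ) * jap j ^ (σ - kamM τ) ≤ jap j ^ (σ + kamM τ) := by
      rw [← Real.rpow_add hj, ← Real.rpow_add hj]
      refine Real.rpow_le_rpow_of_exponent_le (one_le_jap j) ?_
      unfold kamM
      linarith
    calc (jap j ^ (2 * τ) * jap j' ^ (2 * τ)) * (jap j ^ (σ - kamM τ) * jap j' ^ (-(σ - kamM τ)))
        ≤ (jap j ^ (2 * τ) * (2 ^ (2 * τ) * jap (j - j') ^ (2 * τ) * jap j ^ (2 * τ))) *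
          (jap j ^ (σ - kamM τ) * jap j' ^ (-(σ - kamM τ))) := by gcongr
      _ = 2 ^ (2 * τ) * jap (j - j') ^ (2 * τ) *
          ((jap j ^ (2 * τ) * jap j ^ (2 * τ) * jap j ^ (σ - kamM τ)) *
            jap j' ^ (-(σ - kamM τ))) := by ring
      _ ≤ _ := by gcongr
  · rw [Set.mem_singleton_iff] at hr
    subst hr
    have h1 := key j j'
    have h2 : jap j' ^ (2 * τ) * jap j' ^ (2 * τ) * jap j' ^ (-(σ + kamM τ)) ≤
        jap j' ^ (-(σ - kamM τ)) := by
      rw [← Real.rpow_add hj', ← Real.rpow_add hj']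
      refine Real.rpow_le_rpow_of_exponent_le (one_le_jap j') ?_
      unfold kamM
      linarith
    calc (jap j ^ (2 * τ) * jap j' ^ (2 * τ)) * (jap j ^ (σ + kamM τ) * jap j' ^ (-(σ + kamM τ)))
        ≤ ((2 ^ (2 * τ) * jap (j - j') ^ (2 * τ) * jap j' ^ (2 * τ)) * jap j' ^ (2 * τ)) *
          (jap j ^ (σ + kamM τ) * jap j' ^ (-(σ + kamM τ))) := by gcongr
      _ = 2 ^ (2 * τ) * jap (j - j') ^ (2 * τ) * (jap j ^ (σ + kamM τ) *
          (jap j' ^ (2 * τ) * jap j' ^ (2 * τ) * jap j' ^ (-(σ + kamM τ)))) := by ring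
      _ ≤ _ := by gcongr

variable {S : Set ((Fin n → ℤ) × (Fin d → ℤ))} {O : Set (Param n d)}

/-- The solution of the homological equation on `O`, where the divisors obey Melnikov conditions and
are Lipschitz in the parameter. The function `G` compares the loss with the weights. -/
theorem lipBd_solA {s σ τ γ Λ G M r : ℝ} (hτ : 0 ≤ τ) (hγ : 0 < γ) (hγ1 : γ ≤ 1) (hΛ : 1 ≤ Λ)
    (hG : 0 ≤ G) (hM : 0 ≤ M) {V V' : (Fin n → ℤ) → (Fin d → ℤ) → ℝ}
    (hV : ∀ l h, 0 ≤ V l h) (hV' : ∀ l h, 0 ≤ V' l h)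
    (hVV' : ∀ l h, (l, h) ∈ S →
      V l h * ((jap l + jap h) * jap l ^ (2 * τ) * jap h ^ (2 * τ)) ≤ G * V' l h)
    {lam : Param n d → (Fin d → ℤ) → ℂ} {p : Param n d → Arr n d}
    (hlow : ∀ w ∈ O, ∀ l j j', (l, j - j') ∈ S \ {0} →
      γ / (jap l ^ τ * jap j ^ τ * jap j' ^ τ) ≤ ‖divisor (freq w) (lam w) l j j'‖)
    (hlip : ∀ w₁ ∈ O, ∀ w₂ ∈ O, ∀ l j j',
      ‖divisor (freq w₁) (lam w₁) l j j' - divisor (freq w₂) (lam w₂) l j j'‖ ≤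
        Λ * (jap l + jap (j - j')) * ‖w₁ - w₂‖)
    (hp : LipBd (nrm s V' (σ - kamM τ) (σ + kamM τ)) O p M)
    (hr : r ∈ ({σ - kamM τ, σ + kamM τ} : Set ℝ)) :
    LipBd (nrm s V r r) O (fun w => solA S (freq w) (lam w) (p w))
      (2 * (2 ^ (2 * τ) * (γ⁻¹ ^ 2 * Λ * G)) * M) := by
  set C := 2 ^ (2 * τ) * (γ⁻¹ ^ 2 * Λ * G) with hCdef
  have hC : 0 ≤ C := by positivity
  -- the factor by which the division enlarges the coefficients
  let E : (Fin n → ℤ) → (Fin d → ℤ) → (Fin d → ℤ) → ℝ := fun l j j' =>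
    γ⁻¹ ^ 2 * Λ * (jap l + jap (j - j')) * jap l ^ (2 * τ) * (jap j ^ (2 * τ) * jap j' ^ (2 * τ))
  have hE : ∀ l j j', (l, j - j') ∈ S → wt V r r l j j' * E l j j' ≤
      C * wt V' (σ - kamM τ) (σ + kamM τ) l j j' := by
    intro l j j' hS
    have h1 := jap_rpow_mul_le hτ hr j j'
    have h2 := hVV' l (j - j') hS
    have hl := jap_pos l
    have hj := jap_pos j
    have hj' := jap_pos j'
    have hh := jap_pos (j - j')
    have hv := hV l (j - j')
    simp only [wt, E]
    calc V l (j - j') * (jap j ^ r * jap j' ^ (-r)) * (γ⁻¹ ^ 2 * Λ * (jap l + jap (j - j')) *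
          jap l ^ (2 * τ) * (jap j ^ (2 * τ) * jap j' ^ (2 * τ)))
        = γ⁻¹ ^ 2 * Λ * (V l (j - j') * ((jap l + jap (j - j')) * jap l ^ (2 * τ))) *
          ((jap j ^ (2 * τ) * jap j' ^ (2 * τ)) * (jap j ^ r * jap j' ^ (-r))) := by ring
      _ ≤ γ⁻¹ ^ 2 * Λ * (V l (j - j') * ((jap l + jap (j - j')) * jap l ^ (2 * τ))) *
          (2 ^ (2 * τ) * jap (j - j') ^ (2 * τ) *
            (jap j ^ (σ + kamM τ) * jap j' ^ (-(σ - kamM τ)))) := by gcongr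
      _ = γ⁻¹ ^ 2 * Λ * 2 ^ (2 * τ) * (V l (j - j') *
          ((jap l + jap (j - j')) * jap l ^ (2 * τ) * jap (j - j') ^ (2 * τ))) *
            (jap j ^ (σ + kamM τ) * jap j' ^ (-(σ - kamM τ))) := by ring
      _ ≤ γ⁻¹ ^ 2 * Λ * 2 ^ (2 * τ) * (G * V' l (j - j')) *
            (jap j ^ (σ + kamM τ) * jap j' ^ (-(σ - kamM τ))) := by gcongr
      _ = _ := by rw [hCdef]; ring
  have hEnn : ∀ l j j', 0 ≤ E l j j' := fun l j j' => by
    have hl := jap_pos l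
    have hj := jap_pos j
    have hj' := jap_pos j'
    have hh := jap_pos (j - j')
    simp only [E]
    positivity
  have hγi : 1 ≤ γ⁻¹ := (one_le_inv₀ hγ).2 hγ1
  -- lower bounds for the divisors in the form in which they are used
  let e : (Fin n → ℤ) → (Fin d → ℤ) → (Fin d → ℤ) → ℝ := fun l j j' =>
    γ⁻¹ * (jap l ^ τ * jap j ^ τ * jap j' ^ τ)
  have he0 : ∀ l j j', 1 ≤ e l j j' := fun l j j' => by
    have h1 := Real.one_le_rpow (one_le_jap l) hτ
    have h2 := Real.one_le_rpow (one_le_jap j) hτ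
    have h3 := Real.one_le_rpow (one_le_jap j') hτ
    exact one_le_mul_of_one_le_of_one_le hγi (one_le_mul_of_one_le_of_one_le
      (one_le_mul_of_one_le_of_one_le h1 h2) h3)
  have hinv : ∀ w ∈ O, ∀ l j j', (l, j - j') ∈ S \ {0} →
      ‖(divisor (freq w) (lam w) l j j')⁻¹‖ ≤ e l j j' := by
    intro w hw l j j' hS
    have h1 := hlow w hw l j j' hS
    have hl := jap_pos l
    have hj := jap_pos j
    have hj' := jap_pos j'
    have h2 : 0 < γ / (jap l ^ τ * jap j ^ τ * jap j' ^ τ) := by positivity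
    rw [norm_inv]
    refine (inv_anti₀ h2 h1).trans (le_of_eq ?_)
    simp only [e]
    field_simp
  have hsq : ∀ l j j', e l j j' * e l j j' * (Λ * (jap l + jap (j - j'))) = E l j j' := by
    intro l j j'
    have h : ∀ x : ℝ, 0 < x → x ^ τ * x ^ τ = x ^ (2 * τ) := fun x hx => by
      rw [← Real.rpow_add hx]
      congr 1
      ring
    simp only [e, E, ← h _ (jap_pos l), ← h _ (jap_pos j), ← h _ (jap_pos j')]
    ring
  have hee : ∀ l j j', e l j j' ≤ E l j j' := by
    intro l j j'
    rw [← hsq]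
    have h1 := he0 l j j'
    have h2 : 1 ≤ Λ * (jap l + jap (j - j')) := one_le_mul_of_one_le_of_one_le hΛ
      (by linarith [one_le_jap l, jap_pos (j - j')])
    have h3 : 0 ≤ e l j j' := zero_le_one.trans h1
    calc e l j j' = e l j j' * 1 * 1 := by ring
      _ ≤ _ := by gcongr
  have hdom : ∀ {x y : Arr n d}, (∀ l j j', (l, j - j') ∈ S \ {0} →
      ‖x l j j'‖ ≤ E l j j' * ‖y l j j'‖) → (∀ l j j', (l, j - j') ∉ S \ {0} → x l j j' = 0) →
      nrm s V r r x ≤ ENNReal.ofReal C * nrm s V' (σ - kamM τ) (σ + kamM τ) y := by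
    intro x y h1 h2
    refine nrm_le_of_wt_le hC hV hV' fun l j j' => ?_
    have hw := wt_nonneg hV r r l j j'
    have hE0 := hEnn l j j'
    have hw' := wt_nonneg hV' (σ - kamM τ) (σ + kamM τ) l j j'
    by_cases hS : (l, j - j') ∈ S \ {0}
    · calc wt V r r l j j' * ‖x l j j'‖ ≤ wt V r r l j j' * (E l j j' * ‖y l j j'‖) := by
            gcongr
            exact h1 l j j' hS
        _ = (wt V r r l j j' * E l j j') * ‖y l j j'‖ := by ring
        _ ≤ (C * wt V' (σ - kamM τ) (σ + kamM τ) l j j') * ‖y l j j'‖ := by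
            exact mul_le_mul_of_nonneg_right (hE l j j' hS.1) (norm_nonneg _)
        _ = _ := by ring
    · rw [h2 l j j' hS, norm_zero, mul_zero]
      positivity
  have hsol0 : ∀ w l j j', (l, j - j') ∉ S \ {0} → solA S (freq w) (lam w) (p w) l j j' = 0 := by
    intro w l j j' hS
    rw [solA, projA, if_neg hS, zero_div]
  have hsol1 : ∀ w l j j', (l, j - j') ∈ S \ {0} → solA S (freq w) (lam w) (p w) l j j' =
      p w l j j' * (divisor (freq w) (lam w) l j j')⁻¹ := by
    intro w l j j' hS
    rw [solA, projA, if_pos hS, div_eq_mul_inv]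
  refine ⟨fun w hw => ?_, fun w₁ h₁ w₂ h₂ => ?_⟩
  · refine (hdom (y := p w) (fun l j j' hS => ?_) (hsol0 w)).trans ?_
    · rw [hsol1 w l j j' hS, norm_mul, mul_comm]
      gcongr
      exact (hinv w hw l j j' hS).trans (hee l j j')
    · refine (mul_le_mul_right (hp.1 w hw) _).trans ?_
      rw [← ENNReal.ofReal_mul hC]
      refine ENNReal.ofReal_le_ofReal ?_
      nlinarith [mul_nonneg hC hM]
  · classical
    set δ := ‖w₁ - w₂‖ with hδdef
    have hδ : 0 ≤ δ := norm_nonneg _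
    let u : Arr n d := fun l j j' => if (l, j - j') ∈ S \ {0} then
      (p w₁ l j j' - p w₂ l j j') * (divisor (freq w₁) (lam w₁) l j j')⁻¹ else 0
    let v : Arr n d := fun l j j' => if (l, j - j') ∈ S \ {0} then
      p w₂ l j j' * ((divisor (freq w₁) (lam w₁) l j j')⁻¹ -
        (divisor (freq w₂) (lam w₂) l j j')⁻¹) else 0
    have huv : solA S (freq w₁) (lam w₁) (p w₁) - solA S (freq w₂) (lam w₂) (p w₂) = u + v := by
      ext l j j'
      simp only [Pi.sub_apply, Pi.add_apply, u, v]
      by_cases hS : (l, j - j') ∈ S \ {0}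
      · rw [hsol1 _ _ _ _ hS, hsol1 _ _ _ _ hS, if_pos hS, if_pos hS]
        ring
      · rw [hsol0 _ _ _ _ hS, hsol0 _ _ _ _ hS, if_neg hS, if_neg hS]
        ring
    have hu : nrm s V r r u ≤ ENNReal.ofReal (C * (M * δ)) := by
      refine (hdom (y := p w₁ - p w₂) (fun l j j' hS => ?_) (fun l j j' hS => if_neg hS)).trans ?_
      · have hE0 := hEnn l j j'
        have e1 : u l j j' = (p w₁ l j j' - p w₂ l j j') *
            (divisor (freq w₁) (lam w₁) l j j')⁻¹ := if_pos hS
        change ‖u l j j'‖ ≤ _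
        rw [e1, norm_mul, mul_comm]
        exact mul_le_mul_of_nonneg_right ((hinv w₁ h₁ l j j' hS).trans (hee l j j'))
          (norm_nonneg _)
      · rw [ENNReal.ofReal_mul hC]
        exact mul_le_mul_right (hp.2 w₁ h₁ w₂ h₂) _
    have hv : nrm s V r r v ≤ ENNReal.ofReal (C * (M * δ)) := by
      refine (hdom (y := fun l j j' => (δ : ℂ) * p w₂ l j j') (fun l j j' hS => ?_)
        (fun l j j' hS => if_neg hS)).trans ?_
      · have e2 : v l j j' = p w₂ l j j' * ((divisor (freq w₁) (lam w₁) l j j')⁻¹ -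
            (divisor (freq w₂) (lam w₂) l j j')⁻¹) := if_pos hS
        have hne : ∀ w ∈ O, divisor (freq w) (lam w) l j j' ≠ 0 := by
          intro w hw h0
          have h1 := hlow w hw l j j' hS
          rw [h0, norm_zero] at h1
          have hl := jap_pos l
          have hj := jap_pos j
          have hj' := jap_pos j'
          have h2 : 0 < γ / (jap l ^ τ * jap j ^ τ * jap j' ^ τ) := by positivity
          linarith
        have hdiff : ‖(divisor (freq w₁) (lam w₁) l j j')⁻¹ -
            (divisor (freq w₂) (lam w₂) l j j')⁻¹‖ ≤ E l j j' * δ := by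
          have e1 : (divisor (freq w₁) (lam w₁) l j j')⁻¹ -
              (divisor (freq w₂) (lam w₂) l j j')⁻¹ =
              (divisor (freq w₁) (lam w₁) l j j')⁻¹ * (divisor (freq w₂) (lam w₂) l j j')⁻¹ *
              (divisor (freq w₂) (lam w₂) l j j' - divisor (freq w₁) (lam w₁) l j j') := by
            have := hne w₁ h₁
            have := hne w₂ h₂
            field_simp
          have h3 := hlip w₂ h₂ w₁ h₁ l j j'
          rw [norm_sub_rev w₂ w₁, ← hδdef] at h3
          have h4 : 0 ≤ e l j j' := zero_le_one.trans (he0 l j j')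
          rw [e1, norm_mul, norm_mul, ← hsq, mul_assoc (e l j j' * e l j j')]
          exact mul_le_mul (mul_le_mul (hinv w₁ h₁ l j j' hS) (hinv w₂ h₂ l j j' hS)
            (norm_nonneg _) h4) h3 (norm_nonneg _) (mul_nonneg h4 h4)
        change ‖v l j j'‖ ≤ _
        rw [e2, norm_mul, norm_mul, Complex.norm_real, Real.norm_of_nonneg hδ]
        calc ‖p w₂ l j j'‖ * _ ≤ ‖p w₂ l j j'‖ * (E l j j' * δ) := by gcongr
          _ = _ := by ring
      · have h5 : nrm s V' (σ - kamM τ) (σ + kamM τ) (fun l j j' => (δ : ℂ) * p w₂ l j j') ≤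
            ENNReal.ofReal (M * δ) := by
          rw [mul_comm M, ENNReal.ofReal_mul hδ]
          refine (nrm_le_of_wt_le (y := p w₂) hδ hV' hV' fun l j j' => le_of_eq ?_).trans
            (mul_le_mul_right (hp.1 w₂ h₂) _)
          rw [norm_mul, Complex.norm_real, Real.norm_of_nonneg hδ]
          ring
        rw [ENNReal.ofReal_mul hC]
        exact mul_le_mul_right h5 _
    rw [huv]
    refine (nrm_add_le _ _).trans ((add_le_add hu hv).trans ?_)
    rw [← ENNReal.ofReal_add (by positivity) (by positivity)]
    exact ENNReal.ofReal_le_ofReal (le_of_eq (by ring))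

end StepEstimates

/-! ### The quadratic estimates of one step -/

section StepBounds

variable {n d : ℕ} {S : Set ((Fin n → ℤ) × (Fin d → ℤ))} {O : Set (Param n d)}

theorem sub_projA (p : Arr n d) : p - projA S p = projA Sᶜ p := by
  ext l j j'
  simp only [projA, Pi.sub_apply, Set.mem_compl_iff]
  split_ifs <;> simp_all

theorem LipBd.projA {s a b M : ℝ} {V : (Fin n → ℤ) → (Fin d → ℤ) → ℝ} {p : Param n d → Arr n d}
    (hp : LipBd (nrm s V a b) O p M) (S : Set ((Fin n → ℤ) × (Fin d → ℤ))) :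
    LipBd (nrm s V a b) O (fun w => _root_.projA S (p w)) M :=
  ⟨fun w hw => nrm_projA_le.trans (hp.1 w hw), fun w₁ h₁ w₂ h₂ => by
    rw [← projA_sub]
    exact nrm_projA_le.trans (hp.2 w₁ h₁ w₂ h₂)⟩

/-- Away from `S` a low norm is controlled by a high norm, with a gain. -/
theorem LipBd.sub_projA {s a b B g : ℝ} {V W : (Fin n → ℤ) → (Fin d → ℤ) → ℝ}
    {p : Param n d → Arr n d} (hp : LipBd (nrm s W a b) O p B) (hg : 0 ≤ g)
    (hV : ∀ l h, 0 ≤ V l h) (hW : ∀ l h, 0 ≤ W l h)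
    (hVW : ∀ l h, (l, h) ∉ S → V l h ≤ g * W l h) :
    LipBd (nrm s V a b) O (fun w => p w - _root_.projA S (p w)) (g * B) := by
  have key : ∀ x : Arr n d, nrm s V a b (_root_.projA Sᶜ x) ≤
      ENNReal.ofReal g * nrm s W a b x := fun x => by
    refine nrm_le_of_wt_le hg hV hW fun l j j' => ?_
    have h1 := jap_pos j
    have h2 := jap_pos j'
    have h3 := hW l (j - j')
    by_cases h : (l, j - j') ∈ Sᶜ
    · rw [_root_.projA, if_pos h]
      have h4 := hVW l (j - j') h
      simp only [wt]
      calc _ ≤ g * W l (j - j') * (jap j ^ b * jap j' ^ (-a)) * ‖x l j j'‖ := by gcongr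
        _ = _ := by ring
    · rw [_root_.projA, if_neg h, norm_zero, mul_zero]
      have := wt_nonneg hW a b l j j'
      positivity
  simp only [_root_.sub_projA]
  refine ⟨fun w hw => ?_, fun w₁ h₁ w₂ h₂ => ?_⟩
  · rw [ENNReal.ofReal_mul hg]
    exact (key _).trans (mul_le_mul_right (hp.1 w hw) _)
  · rw [← projA_sub, mul_assoc, ENNReal.ofReal_mul hg]
    exact (key _).trans (mul_le_mul_right (hp.2 w₁ h₁ w₂ h₂) _)

/-- The quadratic estimates of one step. With `x` bounded by `C` times `p`, the new perturbation is
the truncation error `T` up to a term quadratic in `p`, and its high norm stays comparable to that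
of `p`. -/
theorem lipBd_stepA {s c a b A B C T : ℝ} (hs0 : 0 ≤ s) (hs : (n : ℝ) < 2 * s)
    {W : (Fin n → ℤ) → (Fin d → ℤ) → ℝ} (hW : IsWeight c W)
    {lam : Param n d → (Fin d → ℤ) → ℂ} {p : Param n d → Arr n d}
    (hA : 0 ≤ A) (hB : 0 ≤ B) (hC : 0 ≤ C) (hT0 : 0 ≤ T)
    (hsmall : 32 * mulConst n s c * (C * A) ≤ 1)
    (hp : LipBd (nrm s (fun _ _ => 1) a b) O p A) (hp' : LipBd (nrm s W a b) O p B)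
    (hT : LipBd (nrm s (fun _ _ => 1) a b) O (fun w => p w - projA S (p w)) T)
    (hx : ∀ r ∈ ({a, b} : Set ℝ),
      LipBd (nrm s (fun _ _ => 1) r r) O (fun w => solA S (freq w) (lam w) (p w)) (C * A))
    (hx' : ∀ r ∈ ({a, b} : Set ℝ),
      LipBd (nrm s W r r) O (fun w => solA S (freq w) (lam w) (p w)) (C * B)) :
    LipBd (nrm s (fun _ _ => 1) a b) O (fun w => stepA S (freq w) (lam w) (p w))
        (2 * T + 16 * mulConst n s c * C * A ^ 2) ∧
      LipBd (nrm s W a b) O (fun w => stepA S (freq w) (lam w) (p w)) (3 * B) := by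
  wlog hTA : T ≤ A generalizing T
  · push Not at hTA
    have h1 : LipBd (nrm s (fun _ _ => 1) a b) O (fun w => p w - projA S (p w)) A := by
      simp only [sub_projA]
      exact hp.projA _
    have := this hA h1 le_rfl
    exact ⟨this.1.mono (by linarith), this.2⟩
  set κ := mulConst n s c with hκdef
  have hκ : 0 ≤ κ := mulConst_nonneg (n := n) hW.const_nonneg s
  have hX : 0 ≤ C * A := mul_nonneg hC hA
  have hY : 0 ≤ C * B := mul_nonneg hC hB
  have ha : a ∈ ({a, b} : Set ℝ) := by simp
  have hb : b ∈ ({a, b} : Set ℝ) := by simp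
  have hadd : ∀ {V : (Fin n → ℤ) → (Fin d → ℤ) → ℝ} (x y : Arr n d),
      nrm s V a b (x + y) ≤ nrm s V a b x + nrm s V a b y := fun x y => nrm_add_le x y
  have hneg : ∀ {V : (Fin n → ℤ) → (Fin d → ℤ) → ℝ} (x : Arr n d),
      nrm s V a b (-x) = nrm s V a b x := fun x => nrm_neg x
  have hT' : LipBd (nrm s W a b) O (fun w => p w - projA S (p w)) B := by
    simp only [sub_projA]
    exact hp'.projA _
  have hz := hp.projA (S ∩ {0})
  have hz' := hp'.projA (S ∩ {0})
  have u1 := lipBd_conv hs0 hs hW.one hA hA hX hX hp hp (hx a ha) (hx a ha)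
  have u1' := lipBd_conv hs0 hs hW hA hB hX hY hp hp' (hx a ha) (hx' a ha)
  have u2 := lipBd_conv hs0 hs hW.one hX hX hA hA (hx b hb) (hx b hb) hz hz
  have u2' := lipBd_conv hs0 hs hW hX hY hA hB (hx b hb) (hx' b hb) hz hz'
  have hq := ((hT.add hadd hT0 (by positivity) u1).sub hadd hneg (by positivity)
    (by positivity) u2)
  have hq' := ((hT'.add hadd hB (by positivity) u1').sub hadd hneg (by positivity)
    (by positivity) u2')
  have hQ : T + 2 * mulConst n s c * (A * (C * A) + A * (C * A)) +
      2 * mulConst n s c * (C * A * A + C * A * A) = T + 8 * κ * C * A ^ 2 := by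
    rw [← hκdef]; ring
  have hQ' : B + 2 * mulConst n s c * (B * (C * A) + A * (C * B)) +
      2 * mulConst n s c * (C * B * A + C * A * B) ≤ 5 / 4 * B := by
    rw [← hκdef]
    nlinarith
  rw [hQ] at hq
  replace hq' := hq'.mono hQ'
  set Q := T + 8 * κ * C * A ^ 2 with hQdef
  have hQ0 : 0 ≤ Q := by positivity
  have hQA : Q ≤ 5 / 4 * A := by
    rw [hQdef]
    nlinarith
  have hneg' : ∀ {V : (Fin n → ℤ) → (Fin d → ℤ) → ℝ} {r : ℝ} (x : Arr n d),
      nrm s V r r (-x) = nrm s V r r x := fun x => nrm_neg x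
  have hy := lipBd_neumann hs0 hs hW.one hX hX ((hx b hb).neg hneg') ((hx b hb).neg hneg')
    (by rw [← hκdef]; nlinarith [mul_nonneg hκ hX])
  have hy' := lipBd_neumann hs0 hs hW hX hY ((hx b hb).neg hneg') ((hx' b hb).neg hneg')
    (by rw [← hκdef]; nlinarith [mul_nonneg hκ hX])
  have v := lipBd_conv hs0 hs hW.one (by positivity) (by positivity) hQ0 hQ0 hy hy hq hq
  have v' := lipBd_conv hs0 hs hW (by positivity) (by positivity) hQ0 (by positivity) hy hy' hq hq'
  rw [← hκdef] at v v'
  constructor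
  · refine (hq.add hadd hQ0 (by positivity) v).mono ?_
    have h1 : 2 * κ * (8 * (C * A) * Q + 8 * (C * A) * Q) = (32 * κ * (C * A)) * Q := by ring
    rw [h1]
    have h2 : (32 * κ * (C * A)) * Q ≤ 1 * Q := mul_le_mul_of_nonneg_right hsmall hQ0
    rw [hQdef] at h2 ⊢
    linarith
  · refine (hq'.add hadd (by positivity) (by positivity) v').mono ?_
    have h1 : 2 * κ * (8 * (C * B) * Q + 8 * (C * A) * (5 / 4 * B)) =
        16 * κ * C * B * Q + 20 * κ * (C * A) * B := by ring
    have h2 : 16 * κ * C * B * Q ≤ 16 * κ * C * B * (5 / 4 * A) := by gcongr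
    rw [h1]
    nlinarith

end StepBounds

/-! ### Cut-off modes, the higher regularity norm, and the norms of families -/

section Weights

variable {n d : ℕ}

/-- The weight `⟨l⟩^β + ⟨h⟩^β` of the higher regularity norm. -/
def highWeight (n d : ℕ) (β : ℝ) (l : Fin n → ℤ) (h : Fin d → ℤ) : ℝ := jap l ^ β + jap h ^ β

theorem isWeight_highWeight {β : ℝ} (hβ : 0 ≤ β) : IsWeight (2 ^ β) (highWeight n d β) := by
  refine ⟨fun l h => ?_, fun l m h k => ?_⟩
  · have h1 := Real.one_le_rpow (one_le_jap l) hβ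
    have h2 := Real.one_le_rpow (one_le_jap h) hβ
    unfold highWeight
    linarith
  · have h1 := jap_rpow_add_le hβ l m
    have h2 := jap_rpow_add_le hβ h k
    unfold highWeight
    linarith

/-- The modes `|l|, |h| ≤ N`; none at all as long as `N` is below a threshold. -/
def kamModes (n d : ℕ) (Nbar N : ℝ) : Set ((Fin n → ℤ) × (Fin d → ℤ)) :=
  {t | Nbar ≤ N ∧ intLen t.1 ≤ N ∧ intLen t.2 ≤ N}

theorem neg_mem_kamModes {Nbar N : ℝ} (t : (Fin n → ℤ) × (Fin d → ℤ)) :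
    -t ∈ kamModes n d Nbar N ↔ t ∈ kamModes n d Nbar N := by
  simp [kamModes]

theorem abs_le_intLen {p : ℕ} (l : Fin p → ℤ) (i : Fin p) : |(l i : ℝ)| ≤ intLen l := by
  rw [intLen, ← Real.sqrt_sq_eq_abs]
  exact Real.sqrt_le_sqrt (Finset.single_le_sum (f := fun i => (l i : ℝ) ^ 2)
    (fun i _ => sq_nonneg _) (Finset.mem_univ i))

theorem finite_kamModes (Nbar N : ℝ) : (Prod.fst '' kamModes n d Nbar N).Finite := by
  refine (Set.finite_Icc (fun _ : Fin n => -⌈N⌉) fun _ => ⌈N⌉).subset ?_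
  rintro _ ⟨t, ht, rfl⟩
  have h : ∀ i, |(t.1 i : ℝ)| ≤ ⌈N⌉ := fun i =>
    (abs_le_intLen t.1 i).trans (ht.2.1.trans (Int.le_ceil N))
  refine ⟨fun i => ?_, fun i => ?_⟩
  · have := (abs_le.1 (h i)).1
    exact_mod_cast this
  · have := (abs_le.1 (h i)).2
    exact_mod_cast this

/-- Outside the modes below `N`, the high norm gains a factor `N^β`. -/
theorem one_le_mul_highWeight {β Nbar N : ℝ} (hβ : 0 ≤ β) (hN : 0 < N) (hNbar : Nbar ≤ N)
    {l : Fin n → ℤ} {h : Fin d → ℤ} (hlh : (l, h) ∉ kamModes n d Nbar N) :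
    1 ≤ N ^ (-β) * highWeight n d β l h := by
  have h0 : N ^ (-β) * N ^ β = 1 := by rw [← Real.rpow_add hN, neg_add_cancel, Real.rpow_zero]
  rw [← h0]
  refine mul_le_mul_of_nonneg_left ?_ (Real.rpow_nonneg hN.le _)
  have hj := Real.rpow_nonneg (jap_pos l).le β
  have hj' := Real.rpow_nonneg (jap_pos h).le β
  unfold highWeight
  by_cases h1 : intLen l ≤ N
  · have h2 : N ≤ jap h := by
      by_contra h3
      exact hlh ⟨hNbar, h1, (intLen_le_jap h).trans (not_le.1 h3).le⟩
    have := Real.rpow_le_rpow hN.le h2 hβ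
    linarith
  · have := Real.rpow_le_rpow hN.le ((not_le.1 h1).le.trans (intLen_le_jap l)) hβ
    linarith

theorem loss_le_of_mem_kamModes {τ Nbar N : ℝ} (hτ : 0 ≤ τ) (hN : 1 ≤ N)
    {l : Fin n → ℤ} {h : Fin d → ℤ} (hlh : (l, h) ∈ kamModes n d Nbar N) :
    (jap l + jap h) * jap l ^ (2 * τ) * jap h ^ (2 * τ) ≤
      2 * 2 ^ (4 * τ + 1) * N ^ (4 * τ + 1) := by
  have h1 : jap l ≤ 2 * N := (jap_le_one_add_intLen l).trans (by linarith [hlh.2.1])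
  have h2 : jap h ≤ 2 * N := (jap_le_one_add_intLen h).trans (by linarith [hlh.2.2])
  have hl := jap_pos l
  have hh := jap_pos h
  have hN0 : 0 < 2 * N := by linarith
  calc (jap l + jap h) * jap l ^ (2 * τ) * jap h ^ (2 * τ)
      ≤ (2 * N + 2 * N) * (2 * N) ^ (2 * τ) * (2 * N) ^ (2 * τ) := by gcongr
    _ = 2 * ((2 * N) ^ (1 : ℝ) * (2 * N) ^ (2 * τ) * (2 * N) ^ (2 * τ)) := by
        rw [Real.rpow_one]; ring
    _ = 2 * (2 * N) ^ (4 * τ + 1) := by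
        rw [← Real.rpow_add hN0, ← Real.rpow_add hN0]
        congr 2
        ring
    _ = _ := by
        rw [Real.mul_rpow (by norm_num) (by linarith)]
        ring

/-- The loss of the homological equation is also covered by the high norm of the datum. -/
theorem loss_le_highWeight {τ β : ℝ} (hτ : 0 ≤ τ) (hβ : 4 * τ + 1 ≤ β)
    (l : Fin n → ℤ) (h : Fin d → ℤ) :
    (jap l + jap h) * jap l ^ (2 * τ) * jap h ^ (2 * τ) ≤ 2 * highWeight n d β l h := by
  have hl := jap_pos l
  have hh := jap_pos h
  set M := max (jap l) (jap h) with hM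
  have hM1 : 1 ≤ M := (one_le_jap l).trans (le_max_left _ _)
  have hM0 : 0 < M := by linarith
  have h1 : jap l ≤ M := le_max_left _ _
  have h2 : jap h ≤ M := le_max_right _ _
  have h3 : M ^ β ≤ highWeight n d β l h := by
    have hj := Real.rpow_nonneg hl.le β
    have hj' := Real.rpow_nonneg hh.le β
    unfold highWeight
    rcases max_choice (jap l) (jap h) with h | h <;> rw [hM, h] <;> linarith
  calc (jap l + jap h) * jap l ^ (2 * τ) * jap h ^ (2 * τ)
      ≤ (M + M) * M ^ (2 * τ) * M ^ (2 * τ) := by gcongr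
    _ = 2 * (M ^ (1 : ℝ) * M ^ (2 * τ) * M ^ (2 * τ)) := by rw [Real.rpow_one]; ring
    _ = 2 * M ^ (4 * τ + 1) := by
        rw [← Real.rpow_add hM0, ← Real.rpow_add hM0]
        congr 2
        ring
    _ ≤ 2 * M ^ β := by
        gcongr
    _ ≤ _ := by linarith

end Weights

section Norms

variable {n d : ℕ}

/-- The array of time Fourier coefficients of a family of operators. -/
def coeffArr (R : OpFamily n d) : Arr n d := fun l j j' => timeCoeff R l j j'

theorem coeffArr_ev {x : Arr n d} (hx : TimeSummable x) : coeffArr (ev x) = x :=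
  timeCoeff_ev hx

theorem ev_coeffArr {R : OpFamily n d} (hc : ∀ j j', Continuous fun θ => R θ j j')
    (hR : TimeSummable (coeffArr R)) : ev (coeffArr R) = R :=
  ev_timeCoeff hc hR

theorem hsNorm_sq (a b : ℝ) (R : OpMatrix d) : hsNorm a b R ^ 2 =
    ∑' k : Fin d → ℤ, ∑' k' : Fin d → ℤ,
      (ENNReal.ofReal (jap k ^ b * jap k' ^ (-a)) * ‖R k k'‖ₑ) ^ 2 := by
  rw [hsNorm, ← ENNReal.rpow_natCast, ← ENNReal.rpow_mul]
  norm_num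
  refine tsum_congr fun k => tsum_congr fun k' => ?_
  have h1 := jap_pos k
  have h2 := jap_pos k'
  rw [← ofReal_norm, ← ENNReal.ofReal_mul (by positivity), ← ENNReal.ofReal_pow (by positivity)]
  congr 1
  rw [mul_pow, mul_pow, ← Real.rpow_mul_natCast h1.le, ← Real.rpow_mul_natCast h2.le]
  push_cast
  rw [mul_comm b 2, neg_mul, mul_comm a 2]
  ring

theorem mNorm_eq (s a b : ℝ) (R : OpFamily n d) :
    mNorm s a b R = nrm s (fun _ _ => 1) a b (coeffArr R) := by
  rw [mNorm, nrm, eNorm, sq2]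
  congr 1
  rw [ENNReal.tsum_prod']
  refine tsum_congr fun l => ?_
  rw [ENNReal.tsum_prod', hsNorm_sq, ← ENNReal.tsum_mul_left]
  refine tsum_congr fun k => ?_
  rw [← ENNReal.tsum_mul_left]
  refine tsum_congr fun k' => ?_
  have h1 := jap_pos l
  simp only [wt, absA, coeffArr, one_mul]
  rw [mul_pow (ENNReal.ofReal (jap l ^ s)), ← ENNReal.ofReal_pow (Real.rpow_nonneg h1.le s),
    ← Real.rpow_mul_natCast h1.le, mul_comm 2 s]
  rfl

theorem nrm_jap_rpow (s β a b : ℝ) (x : Arr n d) :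
    nrm s (fun l _ => jap l ^ β) a b x = nrm (s + β) (fun _ _ => 1) a b x := by
  rw [nrm, nrm, eNorm, eNorm]
  congr 1
  ext t
  have h : ∀ r : ℝ, 0 ≤ jap t.1 ^ r := fun r => Real.rpow_nonneg (jap_pos _).le r
  rw [wt, wt, one_mul, Real.rpow_add (jap_pos _), ENNReal.ofReal_mul (h β),
    ENNReal.ofReal_mul (h s), mul_assoc, mul_assoc]

theorem coeffArr_nablaPow (β : ℝ) (R : OpFamily n d) (l : Fin n → ℤ) (j j' : Fin d → ℤ) :
    coeffArr (nablaPow β R) l j j' = ((jap (j - j') ^ β : ℝ) : ℂ) * coeffArr R l j j' := by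
  simp only [coeffArr, timeCoeff, nablaPow, UnitAddTorus.mFourierCoeff, smul_eq_mul]
  rw [← MeasureTheory.integral_const_mul]
  congr 1
  ext t
  ring

theorem mNorm_nablaPow (s β a b : ℝ) (R : OpFamily n d) : mNorm s a b (nablaPow β R) =
    nrm s (fun _ h => jap h ^ β) a b (coeffArr R) := by
  rw [mNorm_eq, nrm, nrm, eNorm, eNorm]
  congr 1
  ext t
  have h0 : 0 ≤ jap (t.2.1 - t.2.2) ^ β := Real.rpow_nonneg (jap_pos _).le _
  rw [wt, wt, one_mul, ENNReal.ofReal_mul h0, absA, absA, coeffArr_nablaPow, enorm_mul,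
    ← ofReal_norm (_ : ℂ), Complex.norm_real, Real.norm_of_nonneg h0]
  ring

theorem nrm_highWeight_le (s β a b : ℝ) (x : Arr n d) : nrm s (highWeight n d β) a b x ≤
    nrm s (fun l _ => jap l ^ β) a b x + nrm s (fun _ h => jap h ^ β) a b x := by
  rw [nrm, nrm, nrm, eNorm, eNorm, eNorm]
  refine le_trans (le_of_eq ?_) (sq2_add_le _ _)
  congr 1
  ext t
  have h1 : 0 ≤ jap t.1 ^ β := Real.rpow_nonneg (jap_pos _).le _
  have h2 : 0 ≤ jap (t.2.1 - t.2.2) ^ β := Real.rpow_nonneg (jap_pos _).le _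
  have h3 : 0 ≤ jap t.2.1 ^ b * jap t.2.2 ^ (-a) :=
    mul_nonneg (Real.rpow_nonneg (jap_pos _).le _) (Real.rpow_nonneg (jap_pos _).le _)
  simp only [wt, highWeight]
  rw [add_mul, ENNReal.ofReal_add (by positivity) (by positivity)]
  ring

theorem nrm_weight_mono {s a b : ℝ} {V V' : (Fin n → ℤ) → (Fin d → ℤ) → ℝ}
    (h : ∀ l k, V l k ≤ V' l k) (x : Arr n d) : nrm s V a b x ≤ nrm s V' a b x := by
  rw [nrm, nrm, eNorm, eNorm]
  refine sq2_mono fun t => ?_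
  gcongr
  simp only [wt]
  have := jap_pos t.2.1
  have := jap_pos t.2.2
  gcongr
  exact h _ _

theorem lipNorm_congr {E : Type*} [Sub E] {N : E → ℝ≥0∞} {g : ℝ} {O : Set (Param n d)}
    {f f' : Param n d → E} (h : ∀ w ∈ O, f w = f' w) : lipNorm N g O f = lipNorm N g O f' := by
  unfold lipNorm
  congr 1
  · exact iSup_congr fun w => iSup_congr fun hw => by rw [h w hw]
  · congr 1
    exact iSup_congr fun w₁ => iSup_congr fun h₁ => iSup_congr fun w₂ => iSup_congr fun h₂ => by
      rw [h w₁ h₁, h w₂ h₂]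

theorem nablaPow_sub (β : ℝ) (R R' : OpFamily n d) :
    nablaPow β (R - R') = nablaPow β R - nablaPow β R' := by
  ext θ j j'
  simp [nablaPow, mul_sub]

theorem timeSummable_coeffArr {s a b : ℝ} (hs : (n : ℝ) < 2 * s) {R : OpFamily n d}
    (hR : mNorm s a b R < ⊤) :
    TimeSummable (coeffArr R) :=
  timeSummable_of_nrm hs isWeight_one (by rwa [mNorm_eq] at hR)

theorem mNorm_ev {s a b : ℝ} (hs : (n : ℝ) < 2 * s) {x : Arr n d}
    (hx : nrm s (fun _ _ => 1) a b x < ⊤) (s' a' b' : ℝ) :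
    mNorm s' a' b' (ev x) = nrm s' (fun _ _ => 1) a' b' x := by
  rw [mNorm_eq, coeffArr_ev (timeSummable_of_nrm hs isWeight_one hx)]

theorem memM_ev {s a b : ℝ} (hs : (n : ℝ) < 2 * s) {x : Arr n d}
    (hx : nrm s (fun _ _ => 1) a b x < ⊤) : MemM s a b (ev x) :=
  ⟨(timeSummable_of_nrm hs isWeight_one hx).continuous_ev, by rwa [mNorm_ev hs hx]⟩

variable {s a b M : ℝ} {O : Set (Param n d)}

/-- Bounds for arrays are bounds for families of operators: it suffices that the norm `N` of
`T (ev x)` is at most `nrm s V a b x`. -/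
theorem lipNorm_ev_le (hs : (n : ℝ) < 2 * s) {p : Param n d → Arr n d} {A : ℝ}
    (hA : LipBd (nrm s (fun _ _ => 1) a b) O p A) {V : (Fin n → ℤ) → (Fin d → ℤ) → ℝ}
    {E : Type*} [Sub E] (N : E → ℝ≥0∞) (T : OpFamily n d → E) (hT : ∀ R R', T R - T R' = T (R - R'))
    (hN : ∀ x : Arr n d, nrm s (fun _ _ => 1) a b x < ⊤ → N (T (ev x)) ≤ nrm s V a b x)
    (hM : 0 ≤ M) (hp : LipBd (nrm s V a b) O p M) :
    lipNorm N 1 O (fun w => T (ev (p w))) ≤ ENNReal.ofReal (2 * M) := by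
  refine LipBd.lipNorm_le hM ⟨fun w hw => ?_, fun w₁ h₁ w₂ h₂ => ?_⟩
  · exact (hN _ (nrm_lt_top (hA.1 w hw))).trans (hp.1 w hw)
  · rw [hT, ← ev_sub (timeSummable_of_nrm hs isWeight_one (nrm_lt_top (hA.1 w₁ h₁)))
      (timeSummable_of_nrm hs isWeight_one (nrm_lt_top (hA.1 w₂ h₂)))]
    exact (hN _ (nrm_lt_top (hA.2 w₁ h₁ w₂ h₂))).trans (hp.2 w₁ h₁ w₂ h₂)

theorem mLip_ev_le (hs : (n : ℝ) < 2 * s) {p : Param n d → Arr n d} (hM : 0 ≤ M)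
    (hp : LipBd (nrm s (fun _ _ => 1) a b) O p M) :
    mLip s a b O (fun w => ev (p w)) ≤ ENNReal.ofReal (2 * M) :=
  lipNorm_ev_le hs hp (mNorm s a b) id (fun _ _ => rfl)
    (fun _ hx => (mNorm_ev hs hx s a b).le) hM hp

theorem mLipHigh_ev_le (hs : (n : ℝ) < 2 * s) {β A : ℝ} {p : Param n d → Arr n d}
    (hA : LipBd (nrm s (fun _ _ => 1) a b) O p A) (hM : 0 ≤ M)
    (hp : LipBd (nrm s (highWeight n d β) a b) O p M) :
    mLipHigh β s a b O (fun w => ev (p w)) ≤ ENNReal.ofReal (4 * M) := by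
  have h1 : mLip (s + β) a b O (fun w => ev (p w)) ≤ ENNReal.ofReal (2 * M) :=
    lipNorm_ev_le hs hA (V := highWeight n d β) (mNorm (s + β) a b) id (fun _ _ => rfl)
      (fun x hx => by
        rw [id, mNorm_ev hs hx, ← nrm_jap_rpow]
        refine nrm_weight_mono (fun l k => ?_) x
        have := Real.rpow_nonneg (jap_pos k).le β
        unfold highWeight
        linarith) hM hp
  have h2 : mLip s a b O (fun w => nablaPow β (ev (p w))) ≤ ENNReal.ofReal (2 * M) :=
    lipNorm_ev_le hs hA (V := highWeight n d β) (mNorm s a b) (nablaPow β)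
      (fun _ _ => (nablaPow_sub _ _ _).symm)
      (fun x hx => by
        rw [mNorm_nablaPow, coeffArr_ev (timeSummable_of_nrm hs isWeight_one hx)]
        refine nrm_weight_mono (fun l k => ?_) x
        have := Real.rpow_nonneg (jap_pos l).le β
        unfold highWeight
        linarith) hM hp
  refine (add_le_add h1 h2).trans (le_of_eq ?_)
  rw [← ENNReal.ofReal_add (by positivity) (by positivity)]
  congr 1
  ring

/-- A family of operators of finite norm is determined by its time Fourier coefficients, and
bounds for the family are bounds for the coefficients. -/
theorem lipBd_coeffArr (hs : (n : ℝ) < 2 * s) {R : Param n d → OpFamily n d}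
    (hc : ∀ w ∈ O, ∀ j j', Continuous fun θ => R w θ j j')
    (hR : ∀ w ∈ O, mNorm s a b (R w) < ⊤) {V : (Fin n → ℤ) → (Fin d → ℤ) → ℝ}
    {E : Type*} [AddGroup E] (N : E → ℝ≥0∞) (T : OpFamily n d → E) (h0 : N 0 = 0)
    (hT : ∀ R R', T R - T R' = T (R - R'))
    (hN : ∀ R : OpFamily n d, nrm s V a b (coeffArr R) = N (T R))
    (h : lipNorm N 1 O (fun w => T (R w)) ≤ ENNReal.ofReal M) :
    LipBd (nrm s V a b) O (fun w => coeffArr (R w)) M := by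
  have h1 := lipBd_of_lipNorm_le h0 h
  have hts : ∀ w ∈ O, TimeSummable (coeffArr (R w)) := fun w hw =>
    timeSummable_coeffArr hs (hR w hw)
  refine ⟨fun w hw => by rw [hN]; exact h1.1 w hw, fun w₁ h₁ w₂ h₂ => ?_⟩
  have e : coeffArr (R w₁) - coeffArr (R w₂) = coeffArr (R w₁ - R w₂) := by
    conv_rhs => rw [← ev_coeffArr (hc w₁ h₁) (hts w₁ h₁), ← ev_coeffArr (hc w₂ h₂) (hts w₂ h₂),
      ← ev_sub (hts w₁ h₁) (hts w₂ h₂), coeffArr_ev ((hts w₁ h₁).sub (hts w₂ h₂))]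
  rw [e, hN, ← hT]
  exact h1.2 w₁ h₁ w₂ h₂

theorem mNorm_zero (s a b : ℝ) : mNorm s a b (0 : OpFamily n d) = 0 := by
  have : coeffArr (0 : OpFamily n d) = (0 : Arr n d) := by
    ext l j j'
    simp [coeffArr, timeCoeff, UnitAddTorus.mFourierCoeff]
  rw [mNorm_eq, this, nrm_zero]

theorem lipBd_of_mLip_le (hs : (n : ℝ) < 2 * s) {R : Param n d → OpFamily n d}
    (hc : ∀ w ∈ O, ∀ j j', Continuous fun θ => R w θ j j')
    (h : mLip s a b O R ≤ ENNReal.ofReal M) :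
    LipBd (nrm s (fun _ _ => 1) a b) O (fun w => coeffArr (R w)) M :=
  lipBd_coeffArr hs hc (fun w hw => ((lipBd_of_lipNorm_le (mNorm_zero _ _ _) h).1 w hw).trans_lt
    ENNReal.ofReal_lt_top) (mNorm s a b) id (mNorm_zero _ _ _) (fun _ _ => rfl)
    (fun R => (mNorm_eq _ _ _ R).symm) h

theorem lipBd_of_mLipHigh_le (hs : (n : ℝ) < 2 * s) {β A : ℝ} {R : Param n d → OpFamily n d}
    (hc : ∀ w ∈ O, ∀ j j', Continuous fun θ => R w θ j j')
    (hA : mLip s a b O R ≤ ENNReal.ofReal A) (hM : 0 ≤ M)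
    (h : mLipHigh β s a b O R ≤ ENNReal.ofReal M) :
    LipBd (nrm s (highWeight n d β) a b) O (fun w => coeffArr (R w)) (2 * M) := by
  have hfin : ∀ w ∈ O, mNorm s a b (R w) < ⊤ := fun w hw =>
    ((lipBd_of_lipNorm_le (mNorm_zero _ _ _) hA).1 w hw).trans_lt ENNReal.ofReal_lt_top
  have h1 := lipBd_coeffArr hs hc hfin (V := fun l _ => jap l ^ β) (mNorm (s + β) a b) id
    (mNorm_zero _ _ _) (fun _ _ => rfl)
    (fun R => by rw [nrm_jap_rpow, id, mNorm_eq]) (le_self_add.trans h)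
  have h2 := lipBd_coeffArr hs hc hfin (V := fun _ k => jap k ^ β) (mNorm s a b) (nablaPow β)
    (mNorm_zero _ _ _) (fun _ _ => (nablaPow_sub _ _ _).symm)
    (fun R => (mNorm_nablaPow s β a b R).symm) (le_add_self.trans h)
  refine ⟨fun w hw => ?_, fun w₁ hw₁ w₂ hw₂ => ?_⟩
  · rw [two_mul, ENNReal.ofReal_add hM hM]
    exact (nrm_highWeight_le _ _ _ _ _).trans (add_le_add (h1.1 w hw) (h2.1 w hw))
  · rw [mul_assoc, two_mul, ENNReal.ofReal_add (by positivity) (by positivity)]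
    exact (nrm_highWeight_le _ _ _ _ _).trans
      (add_le_add (h1.2 w₁ hw₁ w₂ hw₂) (h2.2 w₁ hw₁ w₂ hw₂))

/-- The diagonal of a smoothing operator decays. -/
theorem enorm_diag_le {σ m : ℝ} (x : Arr n d) (j : Fin d → ℤ) :
    ‖x 0 j j‖ₑ ≤ ENNReal.ofReal (jap j ^ (-(2 * m))) *
      nrm s (fun _ _ => 1) (σ - m) (σ + m) x := by
  have hj := jap_pos j
  have h := le_sq2 (fun t : (Fin n → ℤ) × (Fin d → ℤ) × (Fin d → ℤ) => ENNReal.ofReal (jap t.1 ^ s) *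
    (ENNReal.ofReal (wt (fun _ _ => 1) (σ - m) (σ + m) t.1 t.2.1 t.2.2) *
      absA x t.1 t.2.1 t.2.2)) (0, j, j)
  refine le_trans (le_of_eq ?_) (mul_le_mul_right h _)
  simp only [jap_zero, Real.one_rpow, ENNReal.ofReal_one, one_mul, wt, absA]
  rw [← mul_assoc, ← ENNReal.ofReal_mul (by positivity), ← Real.rpow_add hj, ← Real.rpow_add hj]
  have : -(2 * m) + (σ + m + -(σ - m)) = 0 := by ring
  rw [this, Real.rpow_zero, ENNReal.ofReal_one, one_mul]

theorem lipBd_meanA {σ m : ℝ} {p : Param n d → Arr n d}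
    (hp : LipBd (nrm s (fun _ _ => 1) (σ - m) (σ + m)) O p M)
    (S : Set ((Fin n → ℤ) × (Fin d → ℤ))) (j : Fin d → ℤ) :
    LipBd (fun x : ℂ => ‖x‖ₑ) O (fun w => meanA S (p w) 0 j j) (jap j ^ (-(2 * m)) * M) := by
  have hz := hp.projA (S ∩ {0})
  have hj : 0 ≤ jap j ^ (-(2 * m)) := Real.rpow_nonneg (jap_pos j).le _
  refine ⟨fun w hw => ?_, fun w₁ h₁ w₂ h₂ => ?_⟩
  · rw [ENNReal.ofReal_mul hj]
    exact (enorm_diag_le _ j).trans (mul_le_mul_right (hz.1 w hw) _)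
  · rw [mul_assoc, ENNReal.ofReal_mul hj]
    exact (enorm_diag_le (meanA S (p w₁) - meanA S (p w₂)) j).trans
      (mul_le_mul_right (hz.2 w₁ h₁ w₂ h₂) _)

end Norms

/-! ### The eigenvalues as functions of the parameter -/

section Eigenvalues

variable {n d : ℕ} {O : Set (Param n d)}

theorem abs_dotInt_le {p : ℕ} (x : EuclideanSpace ℝ (Fin p)) (l : Fin p → ℤ) :
    |dotInt x l| ≤ ‖x‖ * intLen l := by
  rw [EuclideanSpace.norm_eq, intLen, ← Real.sqrt_mul (Finset.sum_nonneg fun i _ => sq_nonneg _),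
    ← Real.sqrt_sq_eq_abs]
  refine Real.sqrt_le_sqrt ?_
  simp only [Real.norm_eq_abs, sq_abs]
  exact Finset.sum_mul_sq_le_sq_mul_sq _ _ _

theorem dotInt_sub {p : ℕ} (x y : Fin p → ℝ) (l : Fin p → ℤ) :
    dotInt (fun i => x i - y i) l = dotInt x l - dotInt y l := by
  simp [dotInt, sub_mul, Finset.sum_sub_distrib]

theorem dotInt_sub_right {p : ℕ} (x : Fin p → ℝ) (l l' : Fin p → ℤ) :
    dotInt x (l - l') = dotInt x l - dotInt x l' := by
  simp [dotInt, mul_sub, Finset.sum_sub_distrib]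

theorem norm_freq_sub_le (w₁ w₂ : Param n d) :
    ‖WithLp.toLp 2 (fun i => freq w₁ i - freq w₂ i)‖ ≤ ‖w₁ - w₂‖ := by
  rw [EuclideanSpace.norm_eq, EuclideanSpace.norm_eq]
  refine Real.sqrt_le_sqrt ?_
  rw [Fintype.sum_sum_type]
  simp only [freq, PiLp.sub_apply]
  exact le_add_of_nonneg_right (Finset.sum_nonneg fun i _ => sq_nonneg _)

theorem norm_vel_sub_le (w₁ w₂ : Param n d) : ‖vel w₁ - vel w₂‖ ≤ ‖w₁ - w₂‖ := by
  rw [EuclideanSpace.norm_eq, EuclideanSpace.norm_eq]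
  refine Real.sqrt_le_sqrt ?_
  rw [Fintype.sum_sum_type]
  simp only [vel, PiLp.sub_apply]
  exact le_add_of_nonneg_left (Finset.sum_nonneg fun i _ => sq_nonneg _)

theorem norm_sub_le_of_lipNormVal_le {E : Type*} [NormedAddCommGroup E] {g M : ℝ} (hg : 0 < g)
    (hM : 0 ≤ M) {f : Param n d → E} (h : lipNormVal g O f ≤ ENNReal.ofReal M)
    {w₁ w₂ : Param n d} (h₁ : w₁ ∈ O) (h₂ : w₂ ∈ O) : ‖f w₁ - f w₂‖ ≤ M / g * ‖w₁ - w₂‖ := by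
  by_cases hw : w₁ = w₂
  · simp [hw]
  have hpos : 0 < ‖w₁ - w₂‖ := norm_pos_iff.2 (sub_ne_zero.2 hw)
  have h2 := le_add_self.trans h
  have h3 : ENNReal.ofReal g * (‖f w₁ - f w₂‖ₑ / ENNReal.ofReal ‖w₁ - w₂‖) ≤ ENNReal.ofReal M := by
    refine le_trans (mul_le_mul_right ?_ _) h2
    exact le_iSup₂_of_le w₁ h₁ (le_iSup₂_of_le w₂ h₂ (le_iSup_of_le hw le_rfl))
  rw [← ofReal_norm, ← ENNReal.ofReal_div_of_pos hpos, ← ENNReal.ofReal_mul hg.le,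
    ENNReal.ofReal_le_ofReal_iff hM] at h3
  have h4 : ‖f w₁ - f w₂‖ = g * (‖f w₁ - f w₂‖ / ‖w₁ - w₂‖) * (‖w₁ - w₂‖ / g) := by field_simp
  rw [h4]
  calc _ ≤ M * (‖w₁ - w₂‖ / g) := by gcongr
    _ = _ := by ring

theorem norm_le_of_lipNormVal_le {E : Type*} [NormedAddCommGroup E] {g M : ℝ}
    (hM : 0 ≤ M) {f : Param n d → E} (h : lipNormVal g O f ≤ ENNReal.ofReal M)
    {w : Param n d} (hw : w ∈ O) : ‖f w‖ ≤ M := by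
  have h3 : ‖f w‖ₑ ≤ ENNReal.ofReal M :=
    (le_iSup₂ (f := fun w (_ : w ∈ O) => ‖f w‖ₑ) w hw).trans (le_self_add.trans h)
  rwa [← ofReal_norm, ENNReal.ofReal_le_ofReal_iff hM] at h3

theorem lipBd_enorm_iff {E : Type*} [NormedAddCommGroup E] {M : ℝ} (hM : 0 ≤ M)
    {f : Param n d → E} : LipBd (fun x : E => ‖x‖ₑ) O f M ↔
      (∀ w ∈ O, ‖f w‖ ≤ M) ∧ ∀ w₁ ∈ O, ∀ w₂ ∈ O, ‖f w₁ - f w₂‖ ≤ M * ‖w₁ - w₂‖ := by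
  unfold LipBd
  simp only [← ofReal_norm]
  refine and_congr (forall₂_congr fun w _ => ENNReal.ofReal_le_ofReal_iff hM)
    (forall₂_congr fun w₁ _ => forall₂_congr fun w₂ _ => ENNReal.ofReal_le_ofReal_iff ?_)
  positivity

/-- The divisors are Lipschitz in the parameter, with a constant proportional to the size of the
mode. The differences `z(j) - z(j')` are handled by the mean value inequality. -/
theorem norm_divisor_sub_le {ν₀ : Param n d → EuclideanSpace ℝ (Fin d)}
    {z : Param n d → EuclideanSpace ℝ (Fin d) → ℂ} {ρ : (Fin d → ℤ) → Param n d → ℂ} {K₁ K₂ R : ℝ}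
    (hK₁ : 0 ≤ K₁) (hK₂ : 0 ≤ K₂) (hR : 0 ≤ R)
    (hν : ∀ w₁ ∈ O, ∀ w₂ ∈ O, ‖(ν₀ w₁ - vel w₁) - (ν₀ w₂ - vel w₂)‖ ≤ K₁ * ‖w₁ - w₂‖)
    (hzd : ∀ w ∈ O, Differentiable ℝ (z w))
    (hz : ∀ ξ, ∀ w₁ ∈ O, ∀ w₂ ∈ O,
      ‖fderiv ℝ (z w₁) ξ - fderiv ℝ (z w₂) ξ‖ ≤ K₂ * ‖w₁ - w₂‖)
    (hρ : ∀ j, ∀ w₁ ∈ O, ∀ w₂ ∈ O, ‖ρ j w₁ - ρ j w₂‖ ≤ R * ‖w₁ - w₂‖)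
    {w₁ w₂ : Param n d} (h₁ : w₁ ∈ O) (h₂ : w₂ ∈ O) (l : Fin n → ℤ) (j j' : Fin d → ℤ) :
    ‖divisor (freq w₁) (fun j => initEig ν₀ z j w₁ + ρ j w₁) l j j' -
      divisor (freq w₂) (fun j => initEig ν₀ z j w₂ + ρ j w₂) l j j'‖ ≤
        (1 + K₁ + K₂ + 2 * R) * (jap l + jap (j - j')) * ‖w₁ - w₂‖ := by
  set δ := ‖w₁ - w₂‖ with hδdef
  have hδ : 0 ≤ δ := norm_nonneg _
  have e : divisor (freq w₁) (fun j => initEig ν₀ z j w₁ + ρ j w₁) l j j' -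
      divisor (freq w₂) (fun j => initEig ν₀ z j w₂ + ρ j w₂) l j j' =
      Complex.I * (dotInt (fun i => freq w₁ i - freq w₂ i) l : ℂ) -
      Complex.I * (dotInt (ν₀ w₁ - ν₀ w₂) (j - j') : ℂ) -
      ((z w₁ - z w₂) (intVec j) - (z w₁ - z w₂) (intVec j')) -
      (ρ j w₁ - ρ j w₂) + (ρ j' w₁ - ρ j' w₂) := by
    have h : dotInt (ν₀ w₁ - ν₀ w₂) (j - j') = dotInt (ν₀ w₁) j - dotInt (ν₀ w₁) j' -
        (dotInt (ν₀ w₂) j - dotInt (ν₀ w₂) j') := by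
      rw [← dotInt_sub_right, ← dotInt_sub_right, ← dotInt_sub]
      rfl
    rw [h, dotInt_sub]
    simp only [divisor, initEig, Pi.sub_apply]
    push_cast
    ring
  have e1 : ‖Complex.I * (dotInt (fun i => freq w₁ i - freq w₂ i) l : ℂ)‖ ≤ δ * jap l := by
    rw [norm_mul, Complex.norm_I, one_mul, Complex.norm_real, Real.norm_eq_abs]
    refine (abs_dotInt_le (WithLp.toLp 2 fun i => freq w₁ i - freq w₂ i) l).trans ?_
    exact mul_le_mul (norm_freq_sub_le w₁ w₂) (intLen_le_jap l) (intLen_nonneg l) hδ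
  have e2 : ‖Complex.I * (dotInt (ν₀ w₁ - ν₀ w₂) (j - j') : ℂ)‖ ≤
      ((1 + K₁) * δ) * jap (j - j') := by
    rw [norm_mul, Complex.norm_I, one_mul, Complex.norm_real, Real.norm_eq_abs]
    refine (abs_dotInt_le (ν₀ w₁ - ν₀ w₂) _).trans ?_
    refine mul_le_mul ?_ (intLen_le_jap _) (intLen_nonneg _) (by positivity)
    have : ν₀ w₁ - ν₀ w₂ = (vel w₁ - vel w₂) + ((ν₀ w₁ - vel w₁) - (ν₀ w₂ - vel w₂)) := by abel
    rw [this, add_mul, one_mul]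
    exact (norm_add_le _ _).trans (add_le_add (norm_vel_sub_le w₁ w₂) (hν w₁ h₁ w₂ h₂))
  have e3 : ‖(z w₁ - z w₂) (intVec j) - (z w₁ - z w₂) (intVec j')‖ ≤
      K₂ * δ * jap (j - j') := by
    have hd := (hzd w₁ h₁).sub (hzd w₂ h₂)
    have h := Convex.norm_image_sub_le_of_norm_fderiv_le (𝕜 := ℝ) (f := z w₁ - z w₂)
      (C := K₂ * δ) (s := Set.univ) (fun x _ => hd x) (fun x _ => by
        rw [fderiv_sub (hzd w₁ h₁ x) (hzd w₂ h₂ x)]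
        exact hz x w₁ h₁ w₂ h₂) convex_univ (Set.mem_univ (intVec j')) (Set.mem_univ (intVec j))
    refine h.trans (mul_le_mul_of_nonneg_left ?_ (by positivity))
    rw [← intVec_sub, ← intLen_eq_norm]
    exact intLen_le_jap _
  have e4 := hρ j w₁ h₁ w₂ h₂
  have e5 := hρ j' w₁ h₁ w₂ h₂
  rw [← hδdef] at e4 e5
  rw [e]
  have hl := one_le_jap l
  have hh := jap_pos (j - j')
  refine (norm_add_le _ _).trans ((add_le_add ((norm_sub_le _ _).trans (add_le_add
    ((norm_sub_le _ _).trans (add_le_add ((norm_sub_le _ _).trans (add_le_add e1 e2)) e3)) e4))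
    e5).trans ?_)
  have f1 : 0 ≤ K₁ * jap l * δ := by positivity
  have f2 : 0 ≤ K₂ * jap l * δ := by positivity
  have f3 : 0 ≤ R * δ * (jap l - 1) := mul_nonneg (by positivity) (by linarith)
  have f4 : 0 ≤ R * δ * jap (j - j') := by positivity
  nlinarith

theorem norm_sub_le_of_re_im {x y : ℂ} {c : ℝ} (h1 : |x.re - y.re| ≤ c) (h2 : |x.im - y.im| ≤ c) :
    ‖x - y‖ ≤ 2 * c := by
  refine (Complex.norm_le_abs_re_add_abs_im _).trans ?_
  rw [Complex.sub_re, Complex.sub_im]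
  linarith

/-- A bounded Lipschitz function on `O` has a bounded Lipschitz extension: McShane's extension,
truncated at the bound. -/
theorem exists_real_extension {M : ℝ} (hM : 0 ≤ M) {f : Param n d → ℝ}
    (h0 : ∀ w ∈ O, |f w| ≤ M) (h1 : ∀ w₁ ∈ O, ∀ w₂ ∈ O, |f w₁ - f w₂| ≤ M * ‖w₁ - w₂‖) :
    ∃ g : Param n d → ℝ, (∀ w ∈ O, g w = f w) ∧ (∀ w, |g w| ≤ M) ∧
      ∀ w₁ w₂, |g w₁ - g w₂| ≤ M * ‖w₁ - w₂‖ := by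
  have hL : LipschitzOnWith M.toNNReal f O := LipschitzOnWith.of_dist_le_mul fun x hx y hy => by
    rw [Real.dist_eq, dist_eq_norm, Real.coe_toNNReal _ hM]
    exact h1 x hx y hy
  obtain ⟨g, hg, hgf⟩ := hL.extend_real
  refine ⟨fun w => max (-M) (min M (g w)), fun w hw => ?_, fun w => ?_, fun w₁ w₂ => ?_⟩
  · have := abs_le.1 (h0 w hw)
    change max (-M) (min M (g w)) = f w
    rw [← hgf hw, min_eq_right this.2, max_eq_right this.1]
  · exact abs_le.2 ⟨le_max_left _ _, max_le (by linarith) (min_le_left _ _)⟩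
  · have h2 := hg.dist_le_mul w₁ w₂
    rw [Real.dist_eq, dist_eq_norm, Real.coe_toNNReal _ hM] at h2
    refine (abs_max_sub_max_le_max _ _ _ _).trans ?_
    rw [sub_self, abs_zero]
    refine max_le (by positivity) ((abs_min_sub_min_le_max _ _ _ _).trans ?_)
    rw [sub_self, abs_zero]
    exact max_le (by positivity) h2

theorem exists_complex_extension {M : ℝ} (hM : 0 ≤ M) {f : Param n d → ℂ}
    (h : LipBd (fun x : ℂ => ‖x‖ₑ) O f M) (O' : Set (Param n d)) :
    ∃ g : Param n d → ℂ, (∀ w ∈ O, g w = f w) ∧ LipBd (fun x : ℂ => ‖x‖ₑ) O' g (2 * M) := by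
  obtain ⟨h0, h1⟩ := (lipBd_enorm_iff hM).1 h
  obtain ⟨g, hg, hg0, hg1⟩ := exists_real_extension hM (f := fun w => (f w).re)
    (fun w hw => (Complex.abs_re_le_norm _).trans (h0 w hw))
    (fun w₁ h₁ w₂ h₂ => (Complex.abs_re_le_norm (f w₁ - f w₂)).trans (h1 w₁ h₁ w₂ h₂))
  obtain ⟨k, hk, hk0, hk1⟩ := exists_real_extension hM (f := fun w => (f w).im)
    (fun w hw => (Complex.abs_im_le_norm _).trans (h0 w hw))
    (fun w₁ h₁ w₂ h₂ => (Complex.abs_im_le_norm (f w₁ - f w₂)).trans (h1 w₁ h₁ w₂ h₂))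
  refine ⟨fun w => ⟨g w, k w⟩, fun w hw => Complex.ext (hg w hw) (hk w hw),
    (lipBd_enorm_iff (by positivity)).2 ⟨fun w _ => ?_, fun w₁ _ w₂ _ => ?_⟩⟩
  · refine (Complex.norm_le_abs_re_add_abs_im _).trans ?_
    linarith [hg0 w, hk0 w]
  · rw [mul_assoc]
    exact norm_sub_le_of_re_im (hg1 w₁ w₂) (hk1 w₁ w₂)

theorem norm_vel_le {w : Param n d} (hw : w ∈ paramBox n d) : ‖vel w‖ ≤ 2 * Real.sqrt d := by
  rw [EuclideanSpace.norm_eq]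
  refine Real.sqrt_le_iff.2 ⟨by positivity, ?_⟩
  rw [mul_pow, Real.sq_sqrt (by positivity)]
  calc ∑ i, ‖vel w i‖ ^ 2 ≤ ∑ _i : Fin d, (2 : ℝ) ^ 2 := by
        refine Finset.sum_le_sum fun i _ => ?_
        have := hw (Sum.inr i)
        change ‖w (Sum.inr i)‖ ^ 2 ≤ _
        rw [Real.norm_eq_abs, sq_abs]
        nlinarith
    _ = _ := by
        simp
        ring

/-- The unperturbed eigenvalues are bounded and Lipschitz in the parameter. -/
theorem exists_lipBd_initEig {ν₀ : Param n d → EuclideanSpace ℝ (Fin d)}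
    {z : Param n d → EuclideanSpace ℝ (Fin d) → ℂ} {K₁ K₂ K₃ : ℝ} (hK₁ : 0 ≤ K₁) (hK₂ : 0 ≤ K₂)
    (hO : O ⊆ paramBox n d) (hν0 : ∀ w ∈ O, ‖ν₀ w - vel w‖ ≤ K₃)
    (hν : ∀ w₁ ∈ O, ∀ w₂ ∈ O, ‖(ν₀ w₁ - vel w₁) - (ν₀ w₂ - vel w₂)‖ ≤ K₁ * ‖w₁ - w₂‖)
    (j : Fin d → ℤ) (hz : LipBd (fun x : ℂ => ‖x‖ₑ) O (fun w => z w (intVec j)) K₂) :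
    ∃ M, 0 ≤ M ∧ LipBd (fun x : ℂ => ‖x‖ₑ) O (initEig ν₀ z j) M := by
  obtain ⟨z0, z1⟩ := (lipBd_enorm_iff hK₂).1 hz
  have hj := intLen_nonneg j
  set a := |K₃| + 2 * Real.sqrt d with ha
  have ha0 : 0 ≤ a := by positivity
  have hI : ∀ r : ℝ, ‖Complex.I * (r : ℂ)‖ = |r| := fun r => by
    rw [norm_mul, Complex.norm_I, one_mul, Complex.norm_real, Real.norm_eq_abs]
  have hM : 0 ≤ (a + 1 + K₁) * intLen j + K₂ := by positivity
  refine ⟨(a + 1 + K₁) * intLen j + K₂, hM, (lipBd_enorm_iff hM).2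
    ⟨fun w hw => ?_, fun w₁ h₁ w₂ h₂ => ?_⟩⟩
  · have h1 : ‖ν₀ w‖ ≤ a := by
      have : ν₀ w = (ν₀ w - vel w) + vel w := by abel
      rw [this]
      exact (norm_add_le _ _).trans (add_le_add ((hν0 w hw).trans (le_abs_self _))
        (norm_vel_le (hO hw)))
    have h2 := (abs_dotInt_le (ν₀ w) j).trans (mul_le_mul_of_nonneg_right h1 hj)
    have h3 : ‖initEig ν₀ z j w‖ ≤ a * intLen j + K₂ := by
      refine (norm_add_le _ _).trans (add_le_add ?_ (z0 w hw))
      rwa [hI]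
    nlinarith [mul_nonneg hK₁ hj]
  · have h1 : ‖ν₀ w₁ - ν₀ w₂‖ ≤ (1 + K₁) * ‖w₁ - w₂‖ := by
      have : ν₀ w₁ - ν₀ w₂ = (vel w₁ - vel w₂) + ((ν₀ w₁ - vel w₁) - (ν₀ w₂ - vel w₂)) := by abel
      rw [this, add_mul, one_mul]
      exact (norm_add_le _ _).trans (add_le_add (norm_vel_sub_le w₁ w₂) (hν w₁ h₁ w₂ h₂))
    have h2 := (abs_dotInt_le (ν₀ w₁ - ν₀ w₂) j).trans (mul_le_mul_of_nonneg_right h1 hj)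
    have e : initEig ν₀ z j w₁ - initEig ν₀ z j w₂ =
        Complex.I * (dotInt (ν₀ w₁ - ν₀ w₂) j : ℂ) + (z w₁ (intVec j) - z w₂ (intVec j)) := by
      have h : dotInt (ν₀ w₁ - ν₀ w₂) j = dotInt (ν₀ w₁) j - dotInt (ν₀ w₂) j := by
        rw [← dotInt_sub]
        rfl
      rw [h]
      simp only [initEig]
      push_cast
      ring
    rw [e]
    refine (norm_add_le _ _).trans ?_
    rw [hI]
    have h3 := z1 w₁ h₁ w₂ h₂
    have h4 : 0 ≤ a * intLen j * ‖w₁ - w₂‖ := by positivity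
    nlinarith

theorem initEig_parity {ν₀ : Param n d → EuclideanSpace ℝ (Fin d)}
    {z : Param n d → EuclideanSpace ℝ (Fin d) → ℂ} {w : Param n d}
    (h1 : IsRealFamily (n := n) fun _ => Matrix.diagonal fun j => z w (intVec j))
    (h2 : IsReversibleFamily (n := n) fun _ => Matrix.diagonal fun j => z w (intVec j))
    (j : Fin d → ℤ) : (starRingEnd ℂ) (initEig ν₀ z j w) = -initEig ν₀ z j w ∧
      initEig ν₀ z (-j) w = -initEig ν₀ z j w := by
  have e1 := h1 0 (-j) (-j)
  have e2 := h2 0 (-j) j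
  simp only [neg_neg, Matrix.diagonal_apply_eq] at e1 e2
  have hc : (starRingEnd ℂ) (z w (intVec j)) = -z w (intVec j) := by rw [← e1, e2]
  constructor
  · rw [initEig, map_add, map_mul, Complex.conj_I, Complex.conj_ofReal, hc]
    ring
  · rw [initEig, initEig, e2, dotInt_neg]
    push_cast
    ring

end Eigenvalues

/-! ### The scales -/

section Scales

/-- The scales with shifted index: `kamNu N₀ k = N_{k-1}`. -/
def kamNu (N₀ : ℝ) (k : ℕ) : ℝ := kamScale N₀ ((k : ℤ) - 1)

/-- The rate `N_{k-1}^{-β} N_{k-2}` at which the `k`-th perturbation decays; it is `1` for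
`k = 0`. -/
def kamErr (β N₀ : ℝ) : ℕ → ℝ
  | 0 => 1
  | k + 1 => kamNu N₀ (k + 1) ^ (-β) * kamNu N₀ k

variable {N₀ : ℝ}

theorem kamNu_zero : kamNu N₀ 0 = 1 := by simp [kamNu, kamScale]

theorem kamScale_natCast (k : ℕ) : kamScale N₀ k = kamNu N₀ (k + 1) := by
  rw [kamNu]
  congr 1
  push_cast
  ring

theorem kamNu_succ (k : ℕ) : kamNu N₀ (k + 1) = N₀ ^ ((3 / 2 : ℝ) ^ k) := by
  rw [← kamScale_natCast, kamScale, if_neg (by omega), zpow_natCast]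

theorem kamNu_one : kamNu N₀ 1 = N₀ := by rw [kamNu_succ, pow_zero, Real.rpow_one]

theorem one_le_kamNu (hN : 1 ≤ N₀) (k : ℕ) : 1 ≤ kamNu N₀ k := by
  cases k with
  | zero => rw [kamNu_zero]
  | succ k =>
    rw [kamNu_succ]
    exact Real.one_le_rpow hN (by positivity)

theorem kamNu_succ_succ (hN : 1 ≤ N₀) (k : ℕ) :
    kamNu N₀ (k + 2) = kamNu N₀ (k + 1) ^ (3 / 2 : ℝ) := by
  rw [kamNu_succ, kamNu_succ, ← Real.rpow_mul (by linarith), pow_succ]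

/-- The growth of the scales, in the form valid for all indices. -/
theorem kamNu_le_rpow (hN : 1 ≤ N₀) (k : ℕ) : kamNu N₀ k ≤ kamNu N₀ (k + 1) ^ (2 / 3 : ℝ) := by
  cases k with
  | zero =>
    rw [kamNu_zero]
    exact Real.one_le_rpow (one_le_kamNu hN _) (by norm_num)
  | succ k =>
    rw [kamNu_succ_succ hN, ← Real.rpow_mul (by linarith [one_le_kamNu hN (k + 1)])]
    norm_num

theorem kamNu_le_succ (hN : 1 ≤ N₀) (k : ℕ) : kamNu N₀ k ≤ kamNu N₀ (k + 1) := by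
  refine (kamNu_le_rpow hN k).trans ?_
  conv_rhs => rw [← Real.rpow_one (kamNu N₀ (k + 1))]
  exact Real.rpow_le_rpow_of_exponent_le (one_le_kamNu hN _) (by norm_num)

theorem three_mul_kamNu_le (hN : 1 ≤ N₀) {k : ℕ} (hk : 27 ≤ kamNu N₀ (k + 1)) :
    3 * kamNu N₀ k ≤ kamNu N₀ (k + 1) := by
  set x := kamNu N₀ (k + 1) with hx
  have hx0 : 0 < x := by linarith
  have h1 : (3 : ℝ) ≤ x ^ (1 / 3 : ℝ) := by
    have h2 : (27 : ℝ) ^ (1 / 3 : ℝ) = 3 := by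
      rw [show (27 : ℝ) = 3 ^ (3 : ℝ) by norm_num, ← Real.rpow_mul (by norm_num)]
      norm_num
    calc (3 : ℝ) = 27 ^ (1 / 3 : ℝ) := h2.symm
      _ ≤ _ := Real.rpow_le_rpow (by norm_num) hk (by norm_num)
  have h3 : x ^ (1 / 3 : ℝ) * x ^ (2 / 3 : ℝ) = x := by
    rw [← Real.rpow_add hx0]
    norm_num
  calc 3 * kamNu N₀ k ≤ x ^ (1 / 3 : ℝ) * x ^ (2 / 3 : ℝ) :=
        mul_le_mul h1 (kamNu_le_rpow hN k) (by linarith [one_le_kamNu hN k]) (by positivity)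
    _ = x := h3

variable {α β τ : ℝ}

theorem kamErr_nonneg (hN : 1 ≤ N₀) (k : ℕ) : 0 ≤ kamErr β N₀ k := by
  cases k with
  | zero => exact zero_le_one
  | succ k =>
    have h1 := one_le_kamNu hN k
    have h2 := one_le_kamNu hN (k + 1)
    rw [kamErr]
    positivity

theorem kamErr_le_rpow (hN : 1 ≤ N₀) (hβ : α + 1 ≤ β) (k : ℕ) :
    kamErr β N₀ k ≤ kamNu N₀ k ^ (-α) := by
  cases k with
  | zero => rw [kamErr, kamNu_zero, Real.one_rpow]
  | succ k =>
    have h1 := one_le_kamNu hN (k + 1)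
    have h0 : 0 < kamNu N₀ (k + 1) := by linarith
    rw [kamErr]
    calc _ ≤ kamNu N₀ (k + 1) ^ (-β) * kamNu N₀ (k + 1) ^ (1 : ℝ) := by
          rw [Real.rpow_one]
          exact mul_le_mul_of_nonneg_left (kamNu_le_succ hN k) (by positivity)
      _ = kamNu N₀ (k + 1) ^ (-β + 1) := by rw [Real.rpow_add h0]
      _ ≤ _ := Real.rpow_le_rpow_of_exponent_le h1 (by linarith)

theorem one_le_mul_kamErr (hN : 1 ≤ N₀) (hβ : 0 ≤ β) {b : ℝ} {k : ℕ} (hk : kamNu N₀ k ≤ b) :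
    1 ≤ b ^ β * kamErr β N₀ k := by
  have h1 := one_le_kamNu hN k
  cases k with
  | zero =>
    rw [kamErr, mul_one]
    exact Real.one_le_rpow (h1.trans hk) hβ
  | succ k =>
    have h2 := one_le_kamNu hN k
    have h0 : 0 < kamNu N₀ (k + 1) := by linarith
    rw [kamErr, ← mul_assoc]
    refine one_le_mul_of_one_le_of_one_le ?_ h2
    calc (1 : ℝ) = kamNu N₀ (k + 1) ^ β * kamNu N₀ (k + 1) ^ (-β) := by
          rw [← Real.rpow_add h0, add_neg_cancel, Real.rpow_zero]
      _ ≤ _ := by gcongr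

/-- The size of the solution of the homological equation is small. -/
theorem sq_mul_rpow_mul_kamErr_le (hN : 1 ≤ N₀) (hτ : 0 ≤ τ) (k : ℕ) :
    N₀ ^ 2 * kamNu N₀ (k + 1) ^ (4 * τ + 1) * kamErr (kamBeta τ) N₀ k ≤ N₀ ^ (16 * τ + 11) := by
  have hN0 : 0 < N₀ := by linarith
  have hsq : N₀ ^ 2 = N₀ ^ (2 : ℝ) := by norm_num
  cases k with
  | zero =>
    rw [kamErr, zero_add, kamNu_one, mul_one, hsq, ← Real.rpow_add hN0]
    exact Real.rpow_le_rpow_of_exponent_le hN (by linarith)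
  | succ k =>
    have h1 := one_le_kamNu hN (k + 1)
    have h2 := kamNu_le_rpow hN k
    rw [kamErr, kamNu_succ_succ hN]
    set x := kamNu N₀ (k + 1)
    have hx : 0 < x := by linarith
    calc _ ≤ N₀ ^ 2 * (x ^ (3 / 2 : ℝ)) ^ (4 * τ + 1) * (x ^ (-kamBeta τ) * x ^ (2 / 3 : ℝ)) := by
          gcongr
      _ = N₀ ^ 2 * x ^ (3 / 2 * (4 * τ + 1) + (-kamBeta τ + 2 / 3)) := by
          rw [← Real.rpow_mul hx.le, mul_assoc, ← Real.rpow_add hx, ← Real.rpow_add hx]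
      _ ≤ N₀ ^ 2 * 1 := by
          refine mul_le_mul_of_nonneg_left (Real.rpow_le_one_of_one_le_of_nonpos h1 ?_)
            (by positivity)
          unfold kamBeta kamAlpha
          linarith
      _ ≤ _ := by
          rw [mul_one, hsq]
          exact Real.rpow_le_rpow_of_exponent_le hN (by linarith)

/-- The quadratic error is absorbed by the truncation error of the next step. -/
theorem sq_mul_rpow_mul_kamErr_sq_le (hN : 1 ≤ N₀) (hτ : 0 ≤ τ) (k : ℕ) :
    N₀ ^ 2 * kamNu N₀ (k + 1) ^ (4 * τ + 1) * kamErr (kamBeta τ) N₀ k ^ 2 ≤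
      N₀ ^ (16 * τ + 11) * kamErr (kamBeta τ) N₀ (k + 1) := by
  have hN0 : 0 < N₀ := by linarith
  have hsq : N₀ ^ 2 = N₀ ^ (2 : ℝ) := by norm_num
  cases k with
  | zero =>
    rw [kamErr, kamErr, zero_add, kamNu_one, kamNu_zero, one_pow, mul_one, mul_one, hsq,
      ← Real.rpow_add hN0, ← Real.rpow_add hN0]
    refine Real.rpow_le_rpow_of_exponent_le hN ?_
    unfold kamBeta kamAlpha
    linarith
  | succ k =>
    have h1 := one_le_kamNu hN (k + 1)
    have h2 := kamNu_le_rpow hN k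
    have h3 := one_le_kamNu hN k
    rw [kamErr, kamErr, kamNu_succ_succ hN]
    set x := kamNu N₀ (k + 1)
    have hx : 0 < x := by linarith
    have hpow : (x ^ (2 / 3 : ℝ)) ^ 2 = x ^ (4 / 3 : ℝ) := by
      rw [← Real.rpow_mul_natCast hx.le]
      norm_num
    have hpow' : (x ^ (-kamBeta τ)) ^ 2 = x ^ (-kamBeta τ * 2) := by
      rw [← Real.rpow_mul_natCast hx.le]
      norm_num
    calc _ ≤ N₀ ^ 2 * (x ^ (3 / 2 : ℝ)) ^ (4 * τ + 1) *
          (x ^ (-kamBeta τ) * x ^ (2 / 3 : ℝ)) ^ 2 := by gcongr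
      _ = N₀ ^ 2 * x ^ (3 / 2 * (4 * τ + 1) + (-kamBeta τ * 2 + 4 / 3)) := by
          rw [mul_pow, hpow, hpow', ← Real.rpow_mul hx.le, mul_assoc, ← Real.rpow_add hx,
            ← Real.rpow_add hx]
      _ ≤ N₀ ^ (16 * τ + 11) * x ^ (3 / 2 * -kamBeta τ + 1) := by
          rw [hsq]
          refine mul_le_mul (Real.rpow_le_rpow_of_exponent_le hN (by linarith))
            (Real.rpow_le_rpow_of_exponent_le h1 ?_) (by positivity) (by positivity)
          unfold kamBeta kamAlpha
          linarith
      _ = _ := by rw [← Real.rpow_mul hx.le, Real.rpow_add hx, Real.rpow_one]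

/-- For `k ≥ 1` the factor `γ⁻²` in the size of the transformations is absorbed by the scales. -/
theorem sq_mul_kamErr_succ_le (hN : 1 ≤ N₀) (hβ : β = α + 1) (k : ℕ) :
    N₀ ^ 2 * kamErr β N₀ (k + 1) ≤ kamNu N₀ (k + 2) * kamNu N₀ (k + 1) ^ (-α) := by
  have hN0 : 0 < N₀ := by linarith
  have h1 := one_le_kamNu hN (k + 1)
  have hx : 0 < kamNu N₀ (k + 1) := by linarith
  have key : N₀ ^ 2 * kamNu N₀ k ≤ kamNu N₀ (k + 1) * kamNu N₀ (k + 2) := by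
    have hsq : N₀ ^ 2 = N₀ ^ (2 : ℝ) := by norm_num
    cases k with
    | zero =>
      rw [kamNu_zero, kamNu_succ_succ hN, zero_add, kamNu_one, mul_one, hsq]
      nth_rewrite 2 [← Real.rpow_one N₀]
      rw [← Real.rpow_add hN0]
      exact Real.rpow_le_rpow_of_exponent_le hN (by norm_num)
    | succ k =>
      have h2 := kamNu_le_succ hN (k + 1)
      rw [mul_comm]
      refine mul_le_mul h2 ?_ (by positivity) (by linarith)
      rw [kamNu_succ, hsq]
      refine Real.rpow_le_rpow_of_exponent_le hN ?_
      calc (2 : ℝ) ≤ (3 / 2) ^ 2 := by norm_num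
        _ ≤ (3 / 2 : ℝ) ^ (k + 2) := pow_le_pow_right₀ (by norm_num) (by omega)
  rw [kamErr, hβ]
  have e : kamNu N₀ (k + 1) ^ (-(α + 1)) = kamNu N₀ (k + 1) ^ (-α) * (kamNu N₀ (k + 1))⁻¹ := by
    rw [neg_add, Real.rpow_add hx, Real.rpow_neg_one]
  rw [e]
  have h3 : 0 ≤ kamNu N₀ (k + 1) ^ (-α) := by positivity
  calc _ = kamNu N₀ (k + 1) ^ (-α) * (kamNu N₀ (k + 1))⁻¹ * (N₀ ^ 2 * kamNu N₀ k) := by ring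
    _ ≤ kamNu N₀ (k + 1) ^ (-α) * (kamNu N₀ (k + 1))⁻¹ *
        (kamNu N₀ (k + 1) * kamNu N₀ (k + 2)) := by gcongr
    _ = _ := by field_simp

end Scales

/-! ### The iteration -/

section Iteration

variable {n d : ℕ}

/-- The modes treated in the step from `k` to `k + 1`. The threshold `27` delays the first nontrivial
step until the scales grow at least by a factor three from one step to the next. -/
def stepModes (n d : ℕ) (γ : ℝ) (k : ℕ) : Set ((Fin n → ℤ) × (Fin d → ℤ)) :=
  kamModes n d 27 (kamNu γ⁻¹ (k + 1))

/-- The eigenvalue corrections and the perturbation after `k` steps, at the parameter `w`, starting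
from the eigenvalues `lam0` and the perturbation `p0`. -/
def kamState (γ : ℝ) (lam0 : (Fin d → ℤ) → Param n d → ℂ) (p0 : Param n d → Arr n d)
    (w : Param n d) : ℕ → ((Fin d → ℤ) → ℂ) × Arr n d
  | 0 => (0, p0 w)
  | k + 1 => (fun j => (kamState γ lam0 p0 w k).1 j +
        meanA (stepModes n d γ k) (kamState γ lam0 p0 w k).2 0 j j,
      stepA (stepModes n d γ k) (freq w) (fun j => lam0 j w + (kamState γ lam0 p0 w k).1 j)
        (kamState γ lam0 p0 w k).2)

/-- The eigenvalues after `k` steps. -/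
def kamLam (γ : ℝ) (lam0 : (Fin d → ℤ) → Param n d → ℂ) (p0 : Param n d → Arr n d) (k : ℕ)
    (j : Fin d → ℤ) (w : Param n d) : ℂ :=
  lam0 j w + (kamState γ lam0 p0 w k).1 j

/-- The array of the transformation in the step from `k` to `k + 1`. -/
def kamSol (γ : ℝ) (lam0 : (Fin d → ℤ) → Param n d → ℂ) (p0 : Param n d → Arr n d) (k : ℕ)
    (w : Param n d) : Arr n d :=
  solA (stepModes n d γ k) (freq w) (fun j => kamLam γ lam0 p0 k j w) (kamState γ lam0 p0 w k).2

/-- The factor in the estimates of the solution of the homological equation, without the powers of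
`γ` and of the scale. -/
def solConst (τ Λ : ℝ) : ℝ := 2 * (2 ^ (2 * τ) * (Λ * (2 * 2 ^ (4 * τ + 1))))

/-- The quantitative hypotheses of the iteration: the perturbation has size `A`, the divisors are
Lipschitz with constant `Λ` whatever the small corrections of the eigenvalues, and `A` is small. -/
structure KamHyp (s σ τ γ A Λ : ℝ) (O₀ : Set (Param n d))
    (lam0 : (Fin d → ℤ) → Param n d → ℂ) (p0 : Param n d → Arr n d) : Prop where
  s_nonneg : 0 ≤ s
  lt_two_mul_s : (n : ℝ) < 2 * s
  tau_pos : 0 < τ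
  gamma_pos : 0 < γ
  gamma_lt : γ < 1
  A_nonneg : 0 ≤ A
  one_le : 1 ≤ Λ
  low : LipBd (nrm s (fun _ _ => 1) (σ - kamM τ) (σ + kamM τ)) O₀ p0 A
  high : LipBd (nrm s (highWeight n d (kamBeta τ)) (σ - kamM τ) (σ + kamM τ)) O₀ p0 A
  lip : ∀ O ⊆ O₀, ∀ ρ : (Fin d → ℤ) → Param n d → ℂ,
    (∀ j, ∀ w₁ ∈ O, ∀ w₂ ∈ O, ‖ρ j w₁ - ρ j w₂‖ ≤ 4 * (27 ^ kamBeta τ * A) * ‖w₁ - w₂‖) →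
    ∀ w₁ ∈ O, ∀ w₂ ∈ O, ∀ l j j', ‖divisor (freq w₁) (fun j => lam0 j w₁ + ρ j w₁) l j j' -
      divisor (freq w₂) (fun j => lam0 j w₂ + ρ j w₂) l j j'‖ ≤
        Λ * (jap l + jap (j - j')) * ‖w₁ - w₂‖
  small : 32 * mulConst n s (2 ^ kamBeta τ) * solConst τ Λ * (27 ^ kamBeta τ * A) *
    γ⁻¹ ^ (16 * τ + 11) ≤ 1

theorem projA_empty (p : Arr n d) : projA ∅ p = 0 := by
  ext l j j'
  simp [projA]

theorem neumann_zero : neumann (0 : Arr n d) = 0 := by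
  have h : ∀ k, cpow (0 : Arr n d) k = 0 := by
    intro k
    induction k with
    | zero => rfl
    | succ k ih => rw [cpow, conv_zero_left]
  ext l j j'
  simp [neumann, h]

theorem solA_empty (ω : Fin n → ℝ) (lam : (Fin d → ℤ) → ℂ) (p : Arr n d) :
    solA ∅ ω lam p = 0 := by
  ext l j j'
  simp [solA, projA]

theorem stepA_empty (ω : Fin n → ℝ) (lam : (Fin d → ℤ) → ℂ) (p : Arr n d) :
    stepA ∅ ω lam p = p := by
  rw [stepA, restA, solA_empty, projA_empty, neg_zero, neumann_zero, conv_zero_left,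
    conv_zero_right, conv_zero_left, sub_zero, add_zero, sub_zero, add_zero]

theorem stepModes_eq_empty {γ : ℝ} {k : ℕ} (hk : kamNu γ⁻¹ (k + 1) < 27) :
    stepModes n d γ k = ∅ :=
  Set.eq_empty_of_forall_notMem fun _ ht => absurd ht.1 (not_le.2 hk)

theorem kamState_parity {γ : ℝ} {lam0 : (Fin d → ℤ) → Param n d → ℂ} {p0 : Param n d → Arr n d}
    {w : Param n d} (hp : HasParity (-1) (p0 w))
    (hlam : ∀ j, (starRingEnd ℂ) (lam0 j w) = -lam0 j w ∧ lam0 (-j) w = -lam0 j w) (k : ℕ) :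
    HasParity (-1) (kamState γ lam0 p0 w k).2 ∧
      ∀ j, (starRingEnd ℂ) (kamLam γ lam0 p0 k j w) = -kamLam γ lam0 p0 k j w ∧
        kamLam γ lam0 p0 k (-j) w = -kamLam γ lam0 p0 k j w := by
  induction k with
  | zero => exact ⟨hp, by simpa [kamLam, kamState] using hlam⟩
  | succ k ih =>
    obtain ⟨h1, h2⟩ := ih
    have hz := h1.meanA (S := stepModes n d γ k) neg_mem_kamModes
    refine ⟨h1.stepA neg_mem_kamModes (fun j => (h2 j).1) (fun j => (h2 j).2), fun j => ?_⟩
    have e : ∀ j, kamLam γ lam0 p0 (k + 1) j w = kamLam γ lam0 p0 k j w +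
        meanA (stepModes n d γ k) (kamState γ lam0 p0 w k).2 0 j j := fun j => by
      rw [kamLam, kamLam, kamState, add_assoc]
    have h3 := hz.conj 0 j j
    have h4 := hz.refl 0 j j
    rw [neg_zero] at h4
    rw [e, e, map_add, (h2 j).1, (h2 j).2, h3, h4]
    constructor <;> ring

namespace KamHyp

variable {s σ τ γ A Λ : ℝ} {O₀ : Set (Param n d)} {lam0 : (Fin d → ℤ) → Param n d → ℂ}
  {p0 : Param n d → Arr n d}

theorem one_le_inv (H : KamHyp s σ τ γ A Λ O₀ lam0 p0) : 1 ≤ γ⁻¹ := (one_le_inv₀ H.gamma_pos).2 H.gamma_lt.le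

theorem beta_nonneg (H : KamHyp s σ τ γ A Λ O₀ lam0 p0) : 0 ≤ kamBeta τ := by
  have := H.tau_pos
  unfold kamBeta kamAlpha
  linarith

theorem isWeight (H : KamHyp s σ τ γ A Λ O₀ lam0 p0) : IsWeight (2 ^ kamBeta τ) (highWeight n d (kamBeta τ)) :=
  isWeight_highWeight H.beta_nonneg

theorem solConst_nonneg (H : KamHyp s σ τ γ A Λ O₀ lam0 p0) : 0 ≤ solConst τ Λ := by
  have := H.one_le
  unfold solConst
  positivity

theorem mulConst_nonneg (H : KamHyp s σ τ γ A Λ O₀ lam0 p0) : 0 ≤ mulConst n s (2 ^ kamBeta τ) :=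
  _root_.mulConst_nonneg H.isWeight.const_nonneg s

/-- No step is carried out below the threshold. -/
theorem kamState_eq (H : KamHyp s σ τ γ A Λ O₀ lam0 p0) {k : ℕ} (hk : kamNu γ⁻¹ k < 27) (w : Param n d) :
    kamState γ lam0 p0 w k = (0, p0 w) := by
  induction k with
  | zero => rfl
  | succ k ih =>
    rw [kamState, ih ((kamNu_le_succ H.one_le_inv k).trans_lt hk), stepModes_eq_empty hk,
      stepA_empty, meanA, Set.empty_inter, projA_empty]
    ext <;> simp

theorem le_norm_divisor {k : ℕ} {w : Param n d}
    (hw : w ∈ melnikovSet γ τ O₀ (kamLam γ lam0 p0) (k + 1)) {l : Fin n → ℤ} {j j' : Fin d → ℤ}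
    (hl : (l, j - j') ∈ stepModes n d γ k \ {0}) :
    γ / (jap l ^ τ * jap j ^ τ * jap j' ^ τ) ≤
      ‖divisor (freq w) (fun j => kamLam γ lam0 p0 k j w) l j j'‖ := by
  have h := hw.2 (-l) j j' (fun h => hl.2 (by
    rw [Set.mem_singleton_iff, Prod.mk_eq_zero]
    exact ⟨neg_eq_zero.1 h.1, sub_eq_zero.2 h.2⟩)) (by
      rw [intLen_neg, kamScale_natCast]
      exact hl.1.2.1) (by
      rw [kamScale_natCast]
      exact hl.1.2.2)
  rw [jap_neg, dotInt_neg] at h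
  refine h.trans (le_of_eq ?_)
  rw [divisor, ← norm_neg]
  congr 1
  push_cast
  ring

theorem melnikovSet_subset (k : ℕ) : melnikovSet γ τ O₀ (kamLam γ lam0 p0) k ⊆ O₀ := by
  induction k with
  | zero => exact subset_rfl
  | succ k ih => exact fun w hw => ih hw.1

variable {k : ℕ}

/-- The bounds on the corrections of the eigenvalues increase by the size of the perturbation at
each nontrivial step; the total stays bounded. -/
theorem rho_norm_sub_le (H : KamHyp s σ τ γ A Λ O₀ lam0 p0)
    (hρ : ∀ j, LipBd (fun x : ℂ => ‖x‖ₑ)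
      (melnikovSet γ τ O₀ (kamLam γ lam0 p0) k) (fun w => (kamState γ lam0 p0 w k).1 j)
      (jap j ^ (-(2 * kamM τ)) * (27 ^ kamBeta τ * A * (4 - 3 / kamNu γ⁻¹ k))))
    (j : Fin d → ℤ) {w₁ w₂ : Param n d} (h₁ : w₁ ∈ melnikovSet γ τ O₀ (kamLam γ lam0 p0) k)
    (h₂ : w₂ ∈ melnikovSet γ τ O₀ (kamLam γ lam0 p0) k) :
    ‖(kamState γ lam0 p0 w₁ k).1 j - (kamState γ lam0 p0 w₂ k).1 j‖ ≤
      4 * (27 ^ kamBeta τ * A) * ‖w₁ - w₂‖ := by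
  have hA := H.A_nonneg
  have hν := one_le_kamNu H.one_le_inv k
  have hm : jap j ^ (-(2 * kamM τ)) ≤ 1 := by
    refine Real.rpow_le_one_of_one_le_of_nonpos (one_le_jap j) ?_
    have := H.tau_pos
    unfold kamM
    linarith
  have h0 : 0 ≤ jap j ^ (-(2 * kamM τ)) := Real.rpow_nonneg (jap_pos j).le _
  have h3 : 0 ≤ 3 / kamNu γ⁻¹ k := by positivity
  have hle : jap j ^ (-(2 * kamM τ)) * (27 ^ kamBeta τ * A * (4 - 3 / kamNu γ⁻¹ k)) ≤
      4 * (27 ^ kamBeta τ * A) := by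
    have hB : 0 ≤ 27 ^ kamBeta τ * A := by positivity
    calc _ ≤ jap j ^ (-(2 * kamM τ)) * (27 ^ kamBeta τ * A * 4) := by gcongr; linarith
      _ ≤ 1 * (27 ^ kamBeta τ * A * 4) := by gcongr
      _ = _ := by ring
  exact ((lipBd_enorm_iff (by positivity)).1 ((hρ j).mono hle)).2 w₁ h₁ w₂ h₂

/-- The transformation is controlled by the perturbation, for any pair of weights for which the loss
of the homological equation is controlled. -/
theorem lipBd_kamSol (H : KamHyp s σ τ γ A Λ O₀ lam0 p0)
    (hρ : ∀ j, LipBd (fun x : ℂ => ‖x‖ₑ)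
      (melnikovSet γ τ O₀ (kamLam γ lam0 p0) k) (fun w => (kamState γ lam0 p0 w k).1 j)
      (jap j ^ (-(2 * kamM τ)) * (27 ^ kamBeta τ * A * (4 - 3 / kamNu γ⁻¹ k))))
    {V V' : (Fin n → ℤ) → (Fin d → ℤ) → ℝ} (hV : ∀ l h, 0 ≤ V l h) (hV' : ∀ l h, 0 ≤ V' l h)
    {G M r : ℝ} (hG : 0 ≤ G) (hM : 0 ≤ M)
    (hVV' : ∀ l h, (l, h) ∈ stepModes n d γ k →
      V l h * ((jap l + jap h) * jap l ^ (2 * τ) * jap h ^ (2 * τ)) ≤ G * V' l h)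
    (hp : LipBd (nrm s V' (σ - kamM τ) (σ + kamM τ))
      (melnikovSet γ τ O₀ (kamLam γ lam0 p0) k) (fun w => (kamState γ lam0 p0 w k).2) M)
    (hr : r ∈ ({σ - kamM τ, σ + kamM τ} : Set ℝ)) :
    LipBd (nrm s V r r) (melnikovSet γ τ O₀ (kamLam γ lam0 p0) (k + 1)) (kamSol γ lam0 p0 k)
      (2 * (2 ^ (2 * τ) * (γ⁻¹ ^ 2 * Λ * G)) * M) := by
  have hsub : melnikovSet γ τ O₀ (kamLam γ lam0 p0) (k + 1) ⊆
      melnikovSet γ τ O₀ (kamLam γ lam0 p0) k := fun w hw => hw.1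
  exact lipBd_solA H.tau_pos.le H.gamma_pos H.gamma_lt.le H.one_le hG hM hV hV' hVV'
    (fun w hw l j j' hl => le_norm_divisor hw hl)
    (H.lip _ (melnikovSet_subset (k + 1)) (fun j w => (kamState γ lam0 p0 w k).1 j)
      fun j w₁ h₁ w₂ h₂ => H.rho_norm_sub_le hρ j (hsub h₁) (hsub h₂))
    (hp.mono_set hsub) hr

theorem loss_le (H : KamHyp s σ τ γ A Λ O₀ lam0 p0) {l : Fin n → ℤ} {h : Fin d → ℤ} (hlh : (l, h) ∈ stepModes n d γ k) :
    (jap l + jap h) * jap l ^ (2 * τ) * jap h ^ (2 * τ) ≤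
      2 * 2 ^ (4 * τ + 1) * kamNu γ⁻¹ (k + 1) ^ (4 * τ + 1) :=
  loss_le_of_mem_kamModes H.tau_pos.le (one_le_kamNu H.one_le_inv _) hlh

/-- The bounds that persist along the iteration. The low norm of the perturbation decays, the high
norm grows with the scale, and the corrections of the eigenvalues stay bounded. -/
structure _root_.KamBounds (s σ τ γ A : ℝ) (O₀ : Set (Param n d))
    (lam0 : (Fin d → ℤ) → Param n d → ℂ) (p0 : Param n d → Arr n d) (k : ℕ) : Prop where
  low : LipBd (nrm s (fun _ _ => 1) (σ - kamM τ) (σ + kamM τ))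
    (melnikovSet γ τ O₀ (kamLam γ lam0 p0) k) (fun w => (kamState γ lam0 p0 w k).2)
    (27 ^ kamBeta τ * A * kamErr (kamBeta τ) γ⁻¹ k)
  high : LipBd (nrm s (highWeight n d (kamBeta τ)) (σ - kamM τ) (σ + kamM τ))
    (melnikovSet γ τ O₀ (kamLam γ lam0 p0) k) (fun w => (kamState γ lam0 p0 w k).2)
    (A * kamNu γ⁻¹ k)
  rho : ∀ j, LipBd (fun x : ℂ => ‖x‖ₑ)
    (melnikovSet γ τ O₀ (kamLam γ lam0 p0) k) (fun w => (kamState γ lam0 p0 w k).1 j)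
    (jap j ^ (-(2 * kamM τ)) * (27 ^ kamBeta τ * A * (4 - 3 / kamNu γ⁻¹ k)))

/-- The bound for the transformation in the low norm and, with the high norm of the perturbation,
in the high norm. -/
theorem lipBd_kamSol_low (H : KamHyp s σ τ γ A Λ O₀ lam0 p0)
    (B : KamBounds s σ τ γ A O₀ lam0 p0 k) {r : ℝ}
    (hr : r ∈ ({σ - kamM τ, σ + kamM τ} : Set ℝ)) :
    LipBd (nrm s (fun _ _ => 1) r r) (melnikovSet γ τ O₀ (kamLam γ lam0 p0) (k + 1))
      (kamSol γ lam0 p0 k) (solConst τ Λ * γ⁻¹ ^ 2 * kamNu γ⁻¹ (k + 1) ^ (4 * τ + 1) *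
        (27 ^ kamBeta τ * A * kamErr (kamBeta τ) γ⁻¹ k)) := by
  have hA := H.A_nonneg
  have hν := one_le_kamNu H.one_le_inv (k + 1)
  have he := kamErr_nonneg (β := kamBeta τ) H.one_le_inv k
  refine (H.lipBd_kamSol B.rho (fun _ _ => zero_le_one) (fun _ _ => zero_le_one)
    (G := 2 * 2 ^ (4 * τ + 1) * kamNu γ⁻¹ (k + 1) ^ (4 * τ + 1)) (by positivity) (by positivity)
    (fun l h hlh => ?_) B.low hr).mono (le_of_eq ?_)
  · rw [one_mul, mul_one]
    exact H.loss_le hlh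
  · rw [solConst]
    ring

theorem lipBd_kamSol_high (H : KamHyp s σ τ γ A Λ O₀ lam0 p0)
    (B : KamBounds s σ τ γ A O₀ lam0 p0 k) {r : ℝ}
    (hr : r ∈ ({σ - kamM τ, σ + kamM τ} : Set ℝ)) :
    LipBd (nrm s (highWeight n d (kamBeta τ)) r r)
      (melnikovSet γ τ O₀ (kamLam γ lam0 p0) (k + 1))
      (kamSol γ lam0 p0 k) (solConst τ Λ * γ⁻¹ ^ 2 * kamNu γ⁻¹ (k + 1) ^ (4 * τ + 1) *
        (A * kamNu γ⁻¹ k)) := by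
  have hA := H.A_nonneg
  have hν := one_le_kamNu H.one_le_inv (k + 1)
  have hν' := one_le_kamNu H.one_le_inv k
  have hW : ∀ (l : Fin n → ℤ) (h : Fin d → ℤ), 0 ≤ highWeight n d (kamBeta τ) l h := fun l h =>
    zero_le_one.trans (H.isWeight.one_le l h)
  refine (H.lipBd_kamSol B.rho hW hW
    (G := 2 * 2 ^ (4 * τ + 1) * kamNu γ⁻¹ (k + 1) ^ (4 * τ + 1)) (by positivity) (by positivity)
    (fun l h hlh => ?_) B.high hr).mono (le_of_eq ?_)
  · rw [mul_comm]
    exact mul_le_mul_of_nonneg_right (H.loss_le hlh) (hW l h)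
  · rw [solConst]
    ring

/-- The transformation is small enough for the Neumann series. -/
theorem small_kamSol (H : KamHyp s σ τ γ A Λ O₀ lam0 p0) (k : ℕ) :
    32 * mulConst n s (2 ^ kamBeta τ) * (solConst τ Λ * γ⁻¹ ^ 2 *
      kamNu γ⁻¹ (k + 1) ^ (4 * τ + 1) * (27 ^ kamBeta τ * A * kamErr (kamBeta τ) γ⁻¹ k)) ≤ 1 := by
  have hA := H.A_nonneg
  have hC := H.solConst_nonneg
  have hκ := H.mulConst_nonneg
  refine le_trans ?_ H.small
  have h := sq_mul_rpow_mul_kamErr_le H.one_le_inv H.tau_pos.le k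
  calc _ = 32 * mulConst n s (2 ^ kamBeta τ) * solConst τ Λ * (27 ^ kamBeta τ * A) *
        (γ⁻¹ ^ 2 * kamNu γ⁻¹ (k + 1) ^ (4 * τ + 1) * kamErr (kamBeta τ) γ⁻¹ k) := by ring
    _ ≤ _ := by gcongr

theorem bounds_of_inactive (H : KamHyp s σ τ γ A Λ O₀ lam0 p0) (hk : kamNu γ⁻¹ k < 27) :
    KamBounds s σ τ γ A O₀ lam0 p0 k := by
  have hA := H.A_nonneg
  have hν := one_le_kamNu H.one_le_inv k
  have hsub := melnikovSet_subset (γ := γ) (τ := τ) (O₀ := O₀) (lam0 := lam0) (p0 := p0) k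
  refine ⟨?_, ?_, fun j => ?_⟩
  · simp only [H.kamState_eq hk]
    refine (H.low.mono_set hsub).mono ?_
    have := one_le_mul_kamErr H.one_le_inv H.beta_nonneg hk.le
    calc A = 1 * A := (one_mul A).symm
      _ ≤ _ * A := mul_le_mul_of_nonneg_right this hA
      _ = _ := by ring
  · simp only [H.kamState_eq hk]
    exact (H.high.mono_set hsub).mono (by nlinarith)
  · simp only [H.kamState_eq hk]
    have h3 : 0 ≤ 4 - 3 / kamNu γ⁻¹ k := by
      rw [sub_nonneg, div_le_iff₀ (by linarith)]
      linarith
    have hj : 0 ≤ jap j ^ (-(2 * kamM τ)) := Real.rpow_nonneg (jap_pos j).le _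
    refine (lipBd_enorm_iff (by positivity)).2 ⟨fun w _ => ?_, fun w₁ _ w₂ _ => ?_⟩
    · rw [Pi.zero_apply, norm_zero]
      positivity
    · rw [Pi.zero_apply, sub_zero, norm_zero]
      positivity

theorem bounds (H : KamHyp s σ τ γ A Λ O₀ lam0 p0) (k : ℕ) :
    KamBounds s σ τ γ A O₀ lam0 p0 k := by
  induction k with
  | zero => exact H.bounds_of_inactive (by rw [kamNu_zero]; norm_num)
  | succ k B =>
    by_cases hk : kamNu γ⁻¹ (k + 1) < 27
    · exact H.bounds_of_inactive hk
    rw [not_lt] at hk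
    have hA := H.A_nonneg
    have hC := H.solConst_nonneg
    have hκ := H.mulConst_nonneg
    have hβ := H.beta_nonneg
    have hν := one_le_kamNu H.one_le_inv (k + 1)
    have hν' := one_le_kamNu H.one_le_inv k
    have h3 := three_mul_kamNu_le H.one_le_inv hk
    have he := kamErr_nonneg (β := kamBeta τ) H.one_le_inv k
    have he' := kamErr_nonneg (β := kamBeta τ) H.one_le_inv (k + 1)
    have hsub : melnikovSet γ τ O₀ (kamLam γ lam0 p0) (k + 1) ⊆
        melnikovSet γ τ O₀ (kamLam γ lam0 p0) k := fun w hw => hw.1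
    have hW : ∀ (l : Fin n → ℤ) (h : Fin d → ℤ), 0 ≤ highWeight n d (kamBeta τ) l h := fun l h =>
      zero_le_one.trans (H.isWeight.one_le l h)
    have hT := (B.high.mono_set hsub).sub_projA (S := stepModes n d γ k)
      (V := fun _ _ => (1 : ℝ)) (g := kamNu γ⁻¹ (k + 1) ^ (-kamBeta τ)) (by positivity)
      (fun _ _ => zero_le_one) hW
      (fun l h hlh => one_le_mul_highWeight hβ (by linarith) hk hlh)
    have hT' := hT.mono (M' := A * kamErr (kamBeta τ) γ⁻¹ (k + 1))
      (le_of_eq (by rw [kamErr]; ring))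
    have hstep := lipBd_stepA H.s_nonneg H.lt_two_mul_s H.isWeight (by positivity) (by positivity)
      (by positivity) (by positivity) (H.small_kamSol k) (B.low.mono_set hsub)
      (B.high.mono_set hsub) hT' (fun r hr => H.lipBd_kamSol_low B hr)
      (fun r hr => H.lipBd_kamSol_high B hr)
    refine ⟨hstep.1.mono ?_, hstep.2.mono ?_, fun j => ?_⟩
    · -- the quadratic term is at most half of the admissible bound
      set D := (27 : ℝ) ^ kamBeta τ with hD
      have hD4 : 4 ≤ D := by
        have h1 : (27 : ℝ) ^ (1 : ℝ) ≤ D := Real.rpow_le_rpow_of_exponent_le (by norm_num) (by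
          have := H.tau_pos
          unfold kamBeta kamAlpha
          linarith)
        rw [Real.rpow_one] at h1
        linarith
      have h1 := sq_mul_rpow_mul_kamErr_sq_le H.one_le_inv H.tau_pos.le k
      set κ := mulConst n s (2 ^ kamBeta τ)
      have hs := H.small
      have h2 : 16 * κ * (solConst τ Λ * γ⁻¹ ^ 2 * kamNu γ⁻¹ (k + 1) ^ (4 * τ + 1)) *
          (D * A * kamErr (kamBeta τ) γ⁻¹ k) ^ 2 ≤
          D * A / 2 * kamErr (kamBeta τ) γ⁻¹ (k + 1) := by
        calc _ = 16 * κ * solConst τ Λ * (D * A) ^ 2 * (γ⁻¹ ^ 2 *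
              kamNu γ⁻¹ (k + 1) ^ (4 * τ + 1) * kamErr (kamBeta τ) γ⁻¹ k ^ 2) := by ring
          _ ≤ 16 * κ * solConst τ Λ * (D * A) ^ 2 * (γ⁻¹ ^ (16 * τ + 11) *
              kamErr (kamBeta τ) γ⁻¹ (k + 1)) := by gcongr
          _ = (32 * κ * solConst τ Λ * (D * A) * γ⁻¹ ^ (16 * τ + 11)) *
              (D * A / 2 * kamErr (kamBeta τ) γ⁻¹ (k + 1)) := by ring
          _ ≤ 1 * (D * A / 2 * kamErr (kamBeta τ) γ⁻¹ (k + 1)) := by gcongr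
          _ = _ := one_mul _
      have h4 : 2 * (A * kamErr (kamBeta τ) γ⁻¹ (k + 1)) ≤
          D * A / 2 * kamErr (kamBeta τ) γ⁻¹ (k + 1) := by
        have : 0 ≤ A * kamErr (kamBeta τ) γ⁻¹ (k + 1) := by positivity
        nlinarith
      linarith
    · nlinarith
    · have hj : 0 ≤ jap j ^ (-(2 * kamM τ)) := Real.rpow_nonneg (jap_pos j).le _
      have h5 : 0 ≤ 4 - 3 / kamNu γ⁻¹ k := by
        rw [sub_nonneg, div_le_iff₀ (by linarith)]
        linarith
      have hz := lipBd_meanA (B.low.mono_set hsub) (stepModes n d γ k) j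
      refine (((B.rho j).mono_set hsub).add enorm_add_le (by positivity) (by positivity) hz).mono ?_
      have h6 : kamErr (kamBeta τ) γ⁻¹ k ≤ 1 / kamNu γ⁻¹ k := by
        have := kamErr_le_rpow (α := 1) (β := kamBeta τ) H.one_le_inv (by
          have := H.tau_pos
          unfold kamBeta kamAlpha
          linarith) k
        rw [one_div]
        rwa [Real.rpow_neg_one] at this
      have h7 : 3 / kamNu γ⁻¹ (k + 1) ≤ 1 / kamNu γ⁻¹ k := by
        rw [div_le_div_iff₀ (by linarith) (by linarith)]
        linarith
      have h8 : 3 / kamNu γ⁻¹ k = 3 * (1 / kamNu γ⁻¹ k) := by ring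
      have h9 : 0 ≤ 1 / kamNu γ⁻¹ k := by positivity
      rw [← mul_add, ← mul_add]
      gcongr
      linarith

end KamHyp
end Iteration

/-! ### Consequences of the inductive bounds -/

section Conclusions

variable {n d : ℕ}

theorem LipBd.norm_le_one_of_small {κ M r s : ℝ} {O : Set (Param n d)} {x : Param n d → Arr n d}
    (hκ : 0 ≤ κ) (hx : LipBd (nrm s (fun _ _ => 1) r r) O x M)
    (hsmall : 32 * κ * M ≤ 1) {w : Param n d} (hw : w ∈ O) :
    4 * (ENNReal.ofReal κ * nrm s (fun _ _ => 1) r r (x w)) ≤ 1 := by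
  calc _ ≤ 4 * (ENNReal.ofReal κ * ENNReal.ofReal M) := by
        gcongr
        exact hx.1 w hw
    _ = ENNReal.ofReal (4 * (κ * M)) := by
        rw [ENNReal.ofReal_mul (by norm_num), ENNReal.ofReal_mul hκ, ENNReal.ofReal_ofNat]
    _ ≤ 1 := by
        rw [← ENNReal.ofReal_one]
        refine ENNReal.ofReal_le_ofReal ?_
        linarith

namespace KamHyp

variable {s σ τ γ A Λ : ℝ} {O₀ : Set (Param n d)} {lam0 : (Fin d → ℤ) → Param n d → ℂ}
  {p0 : Param n d → Arr n d} {k : ℕ}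

theorem nrm_kamState_lt_top (H : KamHyp s σ τ γ A Λ O₀ lam0 p0) {w : Param n d}
    (hw : w ∈ melnikovSet γ τ O₀ (kamLam γ lam0 p0) k) :
    nrm s (fun _ _ => 1) (σ - kamM τ) (σ + kamM τ) (kamState γ lam0 p0 w k).2 < ⊤ :=
  nrm_lt_top ((H.bounds k).low.1 w hw)

theorem nrm_kamSol_lt_top (H : KamHyp s σ τ γ A Λ O₀ lam0 p0) {w : Param n d}
    (hw : w ∈ melnikovSet γ τ O₀ (kamLam γ lam0 p0) (k + 1)) {r : ℝ}
    (hr : r ∈ ({σ - kamM τ, σ + kamM τ} : Set ℝ)) :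
    nrm s (fun _ _ => 1) r r (kamSol γ lam0 p0 k w) < ⊤ :=
  nrm_lt_top ((H.lipBd_kamSol_low (H.bounds k) hr).1 w hw)

/-- The step from `k` to `k + 1` conjugates the vector fields. -/
theorem isPushforward (H : KamHyp s σ τ γ A Λ O₀ lam0 p0) {w : Param n d}
    (hw : w ∈ melnikovSet γ τ O₀ (kamLam γ lam0 p0) (k + 1)) :
    IsPushforward s (σ + kamM τ) (σ - kamM τ) (freq w) (fun θ => 1 + ev (kamSol γ lam0 p0 k w) θ)
      (diagPlus (fun j => kamLam γ lam0 p0 k j w) (ev (kamState γ lam0 p0 w k).2))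
      (diagPlus (fun j => kamLam γ lam0 p0 (k + 1) j w)
        (ev (kamState γ lam0 p0 w (k + 1)).2)) := by
  have hA := H.A_nonneg
  have hC := H.solConst_nonneg
  have hν := one_le_kamNu H.one_le_inv (k + 1)
  have he := kamErr_nonneg (β := kamBeta τ) H.one_le_inv k
  have h := isPushforward_step (a := σ - kamM τ) (b := σ + kamM τ) (c := 2 ^ kamBeta τ)
    (S := stepModes n d γ k) (ω := freq w) (lam := fun j => kamLam γ lam0 p0 k j w)
    (p := (kamState γ lam0 p0 w k).2) H.s_nonneg H.lt_two_mul_s H.isWeight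
    (finite_kamModes _ _) (fun l j j' hl h0 => ?_) (H.nrm_kamState_lt_top hw.1)
    (fun r hr => H.nrm_kamSol_lt_top hw hr)
    (fun r hr => (H.lipBd_kamSol_low (H.bounds k) hr).norm_le_one_of_small H.mulConst_nonneg
      (H.small_kamSol k) hw)
    (fun r _ x hx => memM_ev H.lt_two_mul_s hx)
  · have e : (fun j => kamLam γ lam0 p0 (k + 1) j w) = fun j => kamLam γ lam0 p0 k j w +
        meanA (stepModes n d γ k) (kamState γ lam0 p0 w k).2 0 j j := by
      ext j
      rw [kamLam, kamLam, kamState, add_assoc]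
    rw [e]
    exact h
  · have h1 := le_norm_divisor hw hl
    rw [h0, norm_zero] at h1
    have hl := jap_pos l
    have hj := jap_pos j
    have hj' := jap_pos j'
    have hγ := H.gamma_pos
    have h2 : 0 < γ / (jap l ^ τ * jap j ^ τ * jap j' ^ τ) := by positivity
    linarith

/-- The transformations in terms of the scales. In the first step the high norm of the perturbation
is used, so that no power of the scale is lost; later the decay of the perturbation absorbs the
factor `γ⁻²`. -/
theorem lipBd_kamSol_scale (H : KamHyp s σ τ γ A Λ O₀ lam0 p0) {r : ℝ}
    (hr : r ∈ ({σ - kamM τ, σ + kamM τ} : Set ℝ)) (k : ℕ) :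
    LipBd (nrm s (fun _ _ => 1) r r) (melnikovSet γ τ O₀ (kamLam γ lam0 p0) (k + 1))
      (kamSol γ lam0 p0 k) (solConst τ Λ * (27 ^ kamBeta τ * A) *
        (kamNu γ⁻¹ (k + 1) ^ (4 * τ + 2) * kamNu γ⁻¹ k ^ (-kamAlpha τ))) := by
  have hA := H.A_nonneg
  have hΛ := H.one_le
  have hτ := H.tau_pos
  have hC := H.solConst_nonneg
  have hD : 1 ≤ (27 : ℝ) ^ kamBeta τ := Real.one_le_rpow (by norm_num) H.beta_nonneg
  have hν := one_le_kamNu H.one_le_inv (k + 1)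
  have hν0 : 0 < kamNu γ⁻¹ (k + 1) := by linarith
  cases k with
  | zero =>
    have hW : ∀ (l : Fin n → ℤ) (h : Fin d → ℤ), 0 ≤ highWeight n d (kamBeta τ) l h := fun l h =>
      zero_le_one.trans (H.isWeight.one_le l h)
    refine (H.lipBd_kamSol (H.bounds 0).rho (fun _ _ => zero_le_one) hW (G := 2) (by norm_num)
      (M := A * kamNu γ⁻¹ 0) (by rw [kamNu_zero]; linarith) (fun l h _ => ?_)
      (H.bounds 0).high hr).mono ?_
    · rw [one_mul]
      refine loss_le_highWeight hτ.le ?_ l h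
      unfold kamBeta kamAlpha
      linarith
    · rw [kamNu_zero, Real.one_rpow, zero_add, kamNu_one, mul_one, mul_one]
      rw [zero_add, kamNu_one] at hν hν0
      have h1 : γ⁻¹ ^ 2 ≤ γ⁻¹ ^ (4 * τ + 2) := by
        have : γ⁻¹ ^ 2 = γ⁻¹ ^ (2 : ℝ) := by norm_num
        rw [this]
        exact Real.rpow_le_rpow_of_exponent_le hν (by linarith)
      have h2 : (1 : ℝ) ≤ 2 ^ (4 * τ + 1) := Real.one_le_rpow (by norm_num) (by linarith)
      rw [solConst]
      calc _ = 2 * (2 ^ (2 * τ) * (Λ * (2 * 1))) * (1 * A) * γ⁻¹ ^ 2 := by ring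
        _ ≤ _ := by gcongr
  | succ k =>
    have h1 := sq_mul_kamErr_succ_le (α := kamAlpha τ) H.one_le_inv
      (rfl : kamBeta τ = kamAlpha τ + 1) k
    refine (H.lipBd_kamSol_low (H.bounds (k + 1)) hr).mono ?_
    have e : kamNu γ⁻¹ (k + 1 + 1) ^ (4 * τ + 2) =
        kamNu γ⁻¹ (k + 1 + 1) ^ (4 * τ + 1) * kamNu γ⁻¹ (k + 1 + 1) := by
      rw [← Real.rpow_add_one hν0.ne']
      congr 1
      ring
    rw [e]
    calc _ = solConst τ Λ * (27 ^ kamBeta τ * A) * kamNu γ⁻¹ (k + 1 + 1) ^ (4 * τ + 1) *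
          (γ⁻¹ ^ 2 * kamErr (kamBeta τ) γ⁻¹ (k + 1)) := by ring
      _ ≤ solConst τ Λ * (27 ^ kamBeta τ * A) * kamNu γ⁻¹ (k + 1 + 1) ^ (4 * τ + 1) *
          (kamNu γ⁻¹ (k + 2) * kamNu γ⁻¹ (k + 1) ^ (-kamAlpha τ)) := by gcongr
      _ = _ := by ring

theorem mLip_kamSol_le (H : KamHyp s σ τ γ A Λ O₀ lam0 p0) {r : ℝ}
    (hr : r ∈ ({σ - kamM τ, σ + kamM τ} : Set ℝ)) (k : ℕ) :
    mLip s r r (melnikovSet γ τ O₀ (kamLam γ lam0 p0) (k + 1))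
      (fun w => ev (kamSol γ lam0 p0 k w)) ≤
      ENNReal.ofReal (2 * (solConst τ Λ * (27 ^ kamBeta τ * A) *
        (kamNu γ⁻¹ (k + 1) ^ (4 * τ + 2) * kamNu γ⁻¹ k ^ (-kamAlpha τ)))) := by
  have hA := H.A_nonneg
  have hC := H.solConst_nonneg
  have hν := one_le_kamNu H.one_le_inv (k + 1)
  have hν' := one_le_kamNu H.one_le_inv k
  exact mLip_ev_le H.lt_two_mul_s (by positivity) (H.lipBd_kamSol_scale hr k)

theorem mLip_kamState_le (H : KamHyp s σ τ γ A Λ O₀ lam0 p0) (k : ℕ) :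
    mLip s (σ - kamM τ) (σ + kamM τ) (melnikovSet γ τ O₀ (kamLam γ lam0 p0) k)
      (fun w => ev (kamState γ lam0 p0 w k).2) ≤
      ENNReal.ofReal (2 * (27 ^ kamBeta τ * A * kamNu γ⁻¹ k ^ (-kamAlpha τ))) := by
  have hA := H.A_nonneg
  have hν := one_le_kamNu H.one_le_inv k
  refine mLip_ev_le H.lt_two_mul_s (by positivity) ((H.bounds k).low.mono ?_)
  have := kamErr_le_rpow (α := kamAlpha τ) (β := kamBeta τ) H.one_le_inv le_rfl k
  gcongr

theorem mLipHigh_kamState_le (H : KamHyp s σ τ γ A Λ O₀ lam0 p0) (k : ℕ) :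
    mLipHigh (kamBeta τ) s (σ - kamM τ) (σ + kamM τ) (melnikovSet γ τ O₀ (kamLam γ lam0 p0) k)
      (fun w => ev (kamState γ lam0 p0 w k).2) ≤ ENNReal.ofReal (4 * (A * kamNu γ⁻¹ k)) := by
  have hA := H.A_nonneg
  have hν := one_le_kamNu H.one_le_inv k
  exact mLipHigh_ev_le H.lt_two_mul_s (H.bounds k).low (by positivity) (H.bounds k).high

theorem lipNormVal_rho_le (H : KamHyp s σ τ γ A Λ O₀ lam0 p0) (k : ℕ) (j : Fin d → ℤ) :
    lipNormVal 1 (melnikovSet γ τ O₀ (kamLam γ lam0 p0) k)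
      (fun w => (kamState γ lam0 p0 w k).1 j) ≤
      ENNReal.ofReal (2 * (jap j ^ (-(2 * kamM τ)) * (27 ^ kamBeta τ * A * 4))) := by
  have hA := H.A_nonneg
  have hν := one_le_kamNu H.one_le_inv k
  have hj : 0 ≤ jap j ^ (-(2 * kamM τ)) := Real.rpow_nonneg (jap_pos j).le _
  refine LipBd.lipNorm_le (by positivity) (((H.bounds k).rho j).mono ?_)
  have : 0 ≤ 3 / kamNu γ⁻¹ k := by positivity
  gcongr
  linarith

/-- The change of the eigenvalues in one step is the averaged diagonal of the perturbation. -/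
theorem lipBd_kamLam_succ_sub (H : KamHyp s σ τ γ A Λ O₀ lam0 p0) (k : ℕ) (j : Fin d → ℤ) :
    LipBd (fun x : ℂ => ‖x‖ₑ) (melnikovSet γ τ O₀ (kamLam γ lam0 p0) k)
      (fun w => kamLam γ lam0 p0 (k + 1) j w - kamLam γ lam0 p0 k j w)
      (jap j ^ (-(2 * kamM τ)) * (mLip s (σ - kamM τ) (σ + kamM τ)
        (melnikovSet γ τ O₀ (kamLam γ lam0 p0) k)
        (fun w => ev (kamState γ lam0 p0 w k).2)).toReal) := by
  have hfin := ((H.mLip_kamState_le k).trans_lt ENNReal.ofReal_lt_top).ne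
  have hts : ∀ w ∈ melnikovSet γ τ O₀ (kamLam γ lam0 p0) k,
      TimeSummable (kamState γ lam0 p0 w k).2 := fun w hw =>
    timeSummable_of_nrm H.lt_two_mul_s isWeight_one (H.nrm_kamState_lt_top hw)
  have h := lipBd_of_mLip_le H.lt_two_mul_s (fun w hw => (hts w hw).continuous_ev)
    (ENNReal.ofReal_toReal hfin).ge
  have h' := h.congr (g := fun w => (kamState γ lam0 p0 w k).2) fun w hw =>
    (coeffArr_ev (hts w hw)).symm
  refine (lipBd_meanA h' (stepModes n d γ k) j).congr fun w _ => ?_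
  rw [kamLam, kamLam, kamState]
  ring

end KamHyp

theorem LipBd.lipNormVal_lt_top {E : Type*} [NormedAddCommGroup E] {M : ℝ} (hM : 0 ≤ M)
    {O : Set (Param n d)} {f : Param n d → E} (h : LipBd (fun x : E => ‖x‖ₑ) O f M) :
    lipNormVal 1 O f < ⊤ :=
  (h.lipNorm_le hM).trans_lt ENNReal.ofReal_lt_top

/-- Functions on decreasing sets with controlled increments extend to the largest set: extend the
increments and sum. -/
theorem exists_extensions {ι : Type*} {O : ℕ → Set (Param n d)} (hO : ∀ k, O (k + 1) ⊆ O k)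
    {lam : ℕ → ι → Param n d → ℂ} {M : ι → ℝ} {μ : ℕ → ι → ℝ} (hM : ∀ j, 0 ≤ M j)
    (hμ : ∀ k j, 0 ≤ μ k j) (h0 : ∀ j, LipBd (fun x : ℂ => ‖x‖ₑ) (O 0) (lam 0 j) (M j))
    (h1 : ∀ k j, LipBd (fun x : ℂ => ‖x‖ₑ) (O k) (fun w => lam (k + 1) j w - lam k j w) (μ k j)) :
    ∃ lamExt : ℕ → ι → Param n d → ℂ, (∀ k j, ∀ w ∈ O k, lamExt k j w = lam k j w) ∧
      (∀ k j, lipNormVal 1 (O 0) (lamExt k j) < ⊤) ∧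
      ∀ k j, lipNormVal 1 (O 0) (fun w => lamExt (k + 1) j w - lamExt k j w) ≤
        ENNReal.ofReal (4 * μ k j) := by
  choose g hg hg' using fun k j => exists_complex_extension (hμ k j) (h1 k j) (O 0)
  have hanti : Antitone O := antitone_nat_of_succ_le hO
  refine ⟨fun k j w => lam 0 j w + ∑ i ∈ Finset.range k, g i j w, fun k j w hw => ?_,
    fun k j => ?_, fun k j => ?_⟩
  · have : ∀ i ∈ Finset.range k, g i j w = lam (i + 1) j w - lam i j w := fun i hi =>
      hg i j w (hanti (Finset.mem_range.1 hi).le hw)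
    dsimp only
    rw [Finset.sum_congr rfl this, Finset.sum_range_sub (fun i => lam i j w)]
    ring
  · have : ∀ k, ∃ B, 0 ≤ B ∧ LipBd (fun x : ℂ => ‖x‖ₑ) (O 0)
        (fun w => lam 0 j w + ∑ i ∈ Finset.range k, g i j w) B := by
      intro k
      induction k with
      | zero => exact ⟨M j, hM j, by simpa using h0 j⟩
      | succ k ih =>
        obtain ⟨B, hB, h⟩ := ih
        refine ⟨B + 2 * μ k j, by linarith [hμ k j], ?_⟩
        have h2 := h.add enorm_add_le hB (by linarith [hμ k j]) (hg' k j)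
        refine h2.congr fun w _ => ?_
        rw [Finset.sum_range_succ, add_assoc]
    obtain ⟨B, hB, h⟩ := this k
    exact h.lipNormVal_lt_top hB
  · have e : (fun w => lam 0 j w + ∑ i ∈ Finset.range (k + 1), g i j w -
        (lam 0 j w + ∑ i ∈ Finset.range k, g i j w)) = g k j := by
      ext w
      rw [Finset.sum_range_succ]
      ring
    rw [e]
    have h := (hg' k j).lipNorm_le (by linarith [hμ k j])
    refine h.trans (le_of_eq ?_)
    congr 1
    ring

end Conclusions

/-! ### Verification of the hypotheses of the iteration -/

section Setting

variable {n d : ℕ}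

/-- A Lipschitz constant of the divisors. -/
def divisorLip (τ K : ℝ) : ℝ := 1 + 2 * K + 8 * (27 ^ kamBeta τ * (2 * K))

/-- The constant behind the smallness condition. -/
def smallConst (n : ℕ) (s τ K : ℝ) : ℝ :=
  32 * mulConst n s (2 ^ kamBeta τ) * solConst τ (divisorLip τ K) * (27 ^ kamBeta τ * (2 * K))

theorem solConst_divisorLip_nonneg {τ K : ℝ} (hK : 0 ≤ K) : 0 ≤ solConst τ (divisorLip τ K) := by
  unfold solConst divisorLip
  positivity

theorem smallConst_nonneg {s τ K : ℝ} (hK : 0 ≤ K) : 0 ≤ smallConst n s τ K := by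
  have h1 : 0 ≤ mulConst n s (2 ^ kamBeta τ) := mulConst_nonneg (by positivity) s
  have h2 := solConst_divisorLip_nonneg (τ := τ) hK
  unfold smallConst
  positivity

/-- The hypotheses on the system provide those of the iteration. -/
theorem kamHyp_of_small {τ s σ K γ ε : ℝ} {ν₀ : Param n d → EuclideanSpace ℝ (Fin d)}
    {z : Param n d → EuclideanSpace ℝ (Fin d) → ℂ} {P₀ : Param n d → OpFamily n d}
    (hτ : 0 < τ) (hs : ((n / 2 : ℕ) : ℝ) + 1 < s) (hK : 0 < K) (hγ : 0 < γ) (hγ1 : γ < 1)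
    (hε : 0 < ε)
    (hν : lipNormVal γ (paramBox n d) (fun w => ν₀ w - vel w) ≤ ENNReal.ofReal (K * ε))
    (hzd : ∀ w ∈ diophSet γ τ ν₀, Differentiable ℝ (z w))
    (hdz : ∀ ξ, lipNormVal 1 (diophSet γ τ ν₀) (fun w => fderiv ℝ (z w) ξ) ≤
      ENNReal.ofReal (K * ε))
    (hc : ∀ w ∈ diophSet γ τ ν₀, ∀ j j', Continuous fun θ => P₀ w θ j j')
    (hP : mLip s (σ - kamM τ) (σ + kamM τ) (diophSet γ τ ν₀) P₀ ≤ ENNReal.ofReal (K * ε))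
    (hP' : mLipHigh (kamBeta τ) s (σ - kamM τ) (σ + kamM τ) (diophSet γ τ ν₀) P₀ ≤
      ENNReal.ofReal (K * ε))
    (hsm : γ⁻¹ ^ (16 * τ + 11) * ε ≤ 1 / (2 + smallConst n s τ K)) :
    KamHyp s σ τ γ (2 * (K * ε)) (divisorLip τ K) (diophSet γ τ ν₀) (initEig ν₀ z)
      (fun w => coeffArr (P₀ w)) := by
  have hs2 : (n : ℝ) < 2 * s := by
    have h1 : n ≤ 2 * (n / 2) + 1 := by omega
    have h2 : (n : ℝ) ≤ 2 * ((n / 2 : ℕ) : ℝ) + 1 := by exact_mod_cast h1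
    linarith
  have hN : 1 ≤ γ⁻¹ := (one_le_inv₀ hγ).2 hγ1.le
  have hKε : 0 ≤ K * ε := by positivity
  have hQ := smallConst_nonneg (n := n) (s := s) (τ := τ) hK.le
  have hsm1 : γ⁻¹ ^ (16 * τ + 11) * ε ≤ 1 := by
    refine hsm.trans ?_
    rw [div_le_one (by positivity)]
    linarith
  have hsub : diophSet γ τ ν₀ ⊆ paramBox n d := fun w hw => hw.1
  have hε1 : γ⁻¹ * ε ≤ 1 := by
    refine le_trans ?_ hsm1
    refine mul_le_mul_of_nonneg_right ?_ hε.le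
    conv_lhs => rw [← Real.rpow_one γ⁻¹]
    exact Real.rpow_le_rpow_of_exponent_le hN (by linarith)
  have hε2 : ε ≤ 1 := le_trans (by nlinarith) hε1
  refine ⟨?_, hs2, hτ, hγ, hγ1, by positivity, ?_, ?_, ?_, ?_, ?_⟩
  · have : (0 : ℝ) ≤ ((n / 2 : ℕ) : ℝ) := Nat.cast_nonneg _
    linarith
  · have : 0 ≤ 2 * K + 8 * (27 ^ kamBeta τ * (2 * K)) := by positivity
    unfold divisorLip
    linarith
  · exact (lipBd_of_mLip_le hs2 hc hP).mono (by linarith)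
  · exact lipBd_of_mLipHigh_le hs2 hc hP hKε hP'
  · intro O hO ρ hρ w₁ h₁ w₂ h₂ l j j'
    have h := norm_divisor_sub_le (O := O) (ν₀ := ν₀) (z := z) (ρ := ρ) (K₁ := K * ε / γ)
      (K₂ := K * ε) (by positivity) hKε
      (R := 4 * (27 ^ kamBeta τ * (2 * (K * ε)))) (by positivity)
      (fun w₁ h₁ w₂ h₂ => norm_sub_le_of_lipNormVal_le hγ hKε hν (hsub (hO h₁)) (hsub (hO h₂)))
      (fun w hw => hzd w (hO hw))
      (fun ξ w₁ h₁ w₂ h₂ => by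
        have := norm_sub_le_of_lipNormVal_le one_pos hKε (hdz ξ) (hO h₁) (hO h₂)
        rwa [div_one] at this)
      hρ h₁ h₂ l j j'
    refine h.trans ?_
    have hl := jap_pos l
    have hh := jap_pos (j - j')
    have e1 : K * ε / γ ≤ K := by
      have : K * ε / γ = K * (γ⁻¹ * ε) := by ring
      rw [this]
      nlinarith
    have e2 : K * ε ≤ K := by nlinarith
    have e3 : 27 ^ kamBeta τ * (2 * (K * ε)) ≤ 27 ^ kamBeta τ * (2 * K) := by gcongr
    gcongr
    unfold divisorLip
    linarith
  · calc _ = smallConst n s τ K * (γ⁻¹ ^ (16 * τ + 11) * ε) := by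
          unfold smallConst
          ring
      _ ≤ smallConst n s τ K * (1 / (2 + smallConst n s τ K)) := by gcongr
      _ ≤ 1 := by
          rw [mul_one_div, div_le_one (by positivity)]
          linarith

end Setting

end

/-! ### The reducibility theorem -/

theorem mainTheorem4 :
    ∃ c : ℝ, 0 < c ∧
    ∀ (n d : ℕ), 0 < n → 0 < d →
    ∀ (τ s σ K : ℝ), 0 < τ → ((n / 2 : ℕ) : ℝ) + 1 < s → 0 ≤ σ → 0 < K →
    ∃ C₀ δ Cstar C : ℝ, 0 < C₀ ∧ 0 < δ ∧ δ < 1 ∧ 0 < Cstar ∧ 0 < C ∧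
    ∀ (γ ε e : ℝ) (ν₀ : Param n d → EuclideanSpace ℝ (Fin d))
      (z : Param n d → EuclideanSpace ℝ (Fin d) → ℂ) (P₀ : Param n d → OpFamily n d),
      0 < γ → γ < 1 → 0 < ε → 0 < e →
      -- the constant transport vector `ν⁽⁰⁾`
      lipNormVal γ (paramBox n d) (fun w => ν₀ w - vel w) ≤ ENNReal.ofReal (K * ε) →
      -- the Fourier multiplier `z`
      (∀ w ∈ diophSet γ τ ν₀, Differentiable ℝ (z w)) →
      (∀ ξ, lipNormVal 1 (diophSet γ τ ν₀) (fun w => z w ξ) ≤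
        ENNReal.ofReal (K * ε * Real.sqrt (1 + ‖ξ‖ ^ 2) ^ (1 - e))) →
      (∀ ξ, lipNormVal 1 (diophSet γ τ ν₀) (fun w => fderiv ℝ (z w) ξ) ≤
        ENNReal.ofReal (K * ε)) →
      -- the smoothing perturbation `P₀`
      (∀ w ∈ diophSet γ τ ν₀, ∀ j j', Continuous fun θ => P₀ w θ j j') →
      mLip s (σ - kamM τ) (σ + kamM τ) (diophSet γ τ ν₀) P₀ ≤ ENNReal.ofReal (K * ε) →
      mLipHigh (kamBeta τ) s (σ - kamM τ) (σ + kamM τ) (diophSet γ τ ν₀) P₀ ≤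
        ENNReal.ofReal (K * ε) →
      -- the smallness condition, with `N₀ = γ⁻¹`
      (γ⁻¹) ^ C₀ * ε ≤ δ →
      ∃ (ρ : ℕ → (Fin d → ℤ) → Param n d → ℂ) (P X : ℕ → Param n d → OpFamily n d)
        (lam lamExt : ℕ → (Fin d → ℤ) → Param n d → ℂ) (O : ℕ → Set (Param n d)),
        (∀ k j w, lam k j w = initEig ν₀ z j w + ρ k j w) ∧
        (∀ k, O k = melnikovSet γ τ (diophSet γ τ ν₀) lam k) ∧
        (∀ j w, ρ 0 j w = 0) ∧ P 0 = P₀ ∧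
        -- the eigenvalue corrections
        (∀ k j, lipNormVal 1 (O k) (ρ k j) ≤
          ENNReal.ofReal (C * ε * jap j ^ (-(2 * kamM τ)))) ∧
        -- the remainders
        (∀ k, ∀ w ∈ O k, MemM s (σ - kamM τ) (σ + kamM τ) (P k w)) ∧
        (∀ k : ℕ, mLip s (σ - kamM τ) (σ + kamM τ) (O k) (P k) ≤
          ENNReal.ofReal (Cstar * kamScale γ⁻¹ (k - 1) ^ (-kamAlpha τ) * ε)) ∧
        (∀ k : ℕ, mLipHigh (kamBeta τ) s (σ - kamM τ) (σ + kamM τ) (O k) (P k) ≤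
          ENNReal.ofReal (Cstar * kamScale γ⁻¹ (k - 1) * ε)) ∧
        -- the maps `Id + X_k` and the conjugation of `H_k` to `H_{k+1}`
        (∀ k, ∀ w ∈ O (k + 1),
          MemM s (σ + kamM τ) (σ + kamM τ) (X k w) ∧
          MemM s (σ - kamM τ) (σ - kamM τ) (X k w) ∧
          IsPushforward s (σ + kamM τ) (σ - kamM τ) (freq w) (fun θ => 1 + X k w θ)
            (diagPlus (fun j => lam k j w) (P k w))
            (diagPlus (fun j => lam (k + 1) j w) (P (k + 1) w))) ∧
        (∀ k : ℕ,
          mLip s (σ + kamM τ) (σ + kamM τ) (O (k + 1)) (X k) ≤ ENNReal.ofReal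
            (C * kamScale γ⁻¹ k ^ (4 * τ + 2) * kamScale γ⁻¹ (k - 1) ^ (-kamAlpha τ) * ε) ∧
          mLip s (σ - kamM τ) (σ - kamM τ) (O (k + 1)) (X k) ≤ ENNReal.ofReal
            (C * kamScale γ⁻¹ k ^ (4 * τ + 2) * kamScale γ⁻¹ (k - 1) ^ (-kamAlpha τ) * ε)) ∧
        -- reality and reversibility
        ((∀ w ∈ diophSet γ τ ν₀,
            IsRealFamily (P₀ w) ∧ IsReversibleFamily (P₀ w) ∧
            IsRealFamily (n := n) (fun _ => Matrix.diagonal fun j => z w (intVec j)) ∧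
            IsReversibleFamily (n := n) (fun _ => Matrix.diagonal fun j => z w (intVec j))) →
          ∀ k, ∀ w ∈ O k,
            IsRealFamily (P k w) ∧ IsReversibleFamily (P k w) ∧ ∀ j, (lam k j w).re = 0) ∧
        -- the Lipschitz extensions of the eigenvalues
        (∀ k j, ∀ w ∈ O k, lamExt k j w = lam k j w) ∧
        (∀ k j, lipNormVal 1 (diophSet γ τ ν₀) (lamExt k j) < ⊤) ∧
        (∀ (k : ℕ) (j : Fin d → ℤ),
          lipNormVal 1 (diophSet γ τ ν₀) (fun w => lamExt (k + 1) j w - lamExt k j w) ≤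
            ENNReal.ofReal (c * jap j ^ (-(2 * kamM τ))) *
              mLip s (σ - kamM τ) (σ + kamM τ) (O k) (P k) ∧
          lipNormVal 1 (diophSet γ τ ν₀) (fun w => lamExt (k + 1) j w - lamExt k j w) ≤
            ENNReal.ofReal (C * jap j ^ (-(2 * kamM τ)) *
              kamScale γ⁻¹ (k - 1) ^ (-kamAlpha τ) * ε)) := by
  refine ⟨4, by norm_num, fun n d _ _ τ s σ K hτ hs _ hK => ?_⟩
  set B : ℝ := 27 ^ kamBeta τ * (2 * K) with hB
  have hB0 : 0 < B := by positivity
  set L : ℝ := solConst τ (divisorLip τ K) with hL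
  have hL0 : 0 ≤ L := solConst_divisorLip_nonneg hK.le
  have hQ := smallConst_nonneg (n := n) (s := s) (τ := τ) hK.le
  refine ⟨16 * τ + 11, 1 / (2 + smallConst n s τ K), 2 * B + 8 * K, 16 * B + 32 * K + 2 * (L * B),
    by linarith, by positivity, ?_, by positivity, by positivity, ?_⟩
  · rw [div_lt_one (by positivity)]
    linarith
  intro γ ε e ν₀ z P₀ hγ hγ1 hε _ hν hzd hz hdz hc hP hP' hsm
  have H : KamHyp s σ τ γ (2 * (K * ε)) (divisorLip τ K) (diophSet γ τ ν₀) (initEig ν₀ z)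
      (fun w => coeffArr (P₀ w)) := kamHyp_of_small hτ hs hK hγ hγ1 hε hν hzd hdz hc hP hP' hsm
  set O₀ := diophSet γ τ ν₀ with hO₀
  set p0 : Param n d → Arr n d := fun w => coeffArr (P₀ w) with hp0
  set lam0 := initEig ν₀ z with hlam0
  set O := melnikovSet γ τ O₀ (kamLam γ lam0 p0) with hO
  have hOsub : ∀ k, O k ⊆ O₀ := KamHyp.melnikovSet_subset
  have hA : 27 ^ kamBeta τ * (2 * (K * ε)) = B * ε := by rw [hB]; ring
  -- the given family is the initial state, and it is determined by its coefficients on `O₀`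
  let P : ℕ → Param n d → OpFamily n d := fun k w =>
    if k = 0 then P₀ w else ev (kamState γ lam0 p0 w k).2
  have hts : ∀ w ∈ O₀, TimeSummable (p0 w) := fun w hw =>
    timeSummable_of_nrm H.lt_two_mul_s isWeight_one (nrm_lt_top (H.low.1 w hw))
  have hP₀ : ∀ w ∈ O₀, ev (p0 w) = P₀ w := fun w hw => ev_coeffArr (hc w hw) (hts w hw)
  have hPk : ∀ k, ∀ w ∈ O k, P k w = ev (kamState γ lam0 p0 w k).2 := by
    intro k w hw
    cases k with
    | zero => exact (hP₀ w hw).symm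
    | succ k => exact if_neg (Nat.succ_ne_zero k)
  have hPlip : ∀ k, mLip s (σ - kamM τ) (σ + kamM τ) (O k) (P k) =
      mLip s (σ - kamM τ) (σ + kamM τ) (O k) (fun w => ev (kamState γ lam0 p0 w k).2) :=
    fun k => lipNorm_congr (hPk k)
  have hPhigh : ∀ k, mLipHigh (kamBeta τ) s (σ - kamM τ) (σ + kamM τ) (O k) (P k) =
      mLipHigh (kamBeta τ) s (σ - kamM τ) (σ + kamM τ) (O k)
        (fun w => ev (kamState γ lam0 p0 w k).2) := fun k =>
    congrArg₂ (· + ·) (lipNorm_congr (hPk k))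
      (lipNorm_congr fun w hw => congrArg (nablaPow (kamBeta τ)) (hPk k w hw))
  have hν1 : ∀ k, 1 ≤ kamNu γ⁻¹ k := one_le_kamNu H.one_le_inv
  have hlow : ∀ k : ℕ, mLip s (σ - kamM τ) (σ + kamM τ) (O k) (P k) ≤
      ENNReal.ofReal ((2 * B + 8 * K) * kamScale γ⁻¹ (k - 1) ^ (-kamAlpha τ) * ε) := by
    intro k
    rw [hPlip]
    refine (H.mLip_kamState_le k).trans (ENNReal.ofReal_le_ofReal ?_)
    rw [hA]
    change 2 * (B * ε * kamNu γ⁻¹ k ^ (-kamAlpha τ)) ≤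
      (2 * B + 8 * K) * kamNu γ⁻¹ k ^ (-kamAlpha τ) * ε
    have h1 : 0 ≤ kamNu γ⁻¹ k ^ (-kamAlpha τ) :=
      Real.rpow_nonneg (zero_le_one.trans (hν1 k)) _
    have h2 : 0 ≤ 8 * K * kamNu γ⁻¹ k ^ (-kamAlpha τ) * ε := by positivity
    linarith
  have hXlip : ∀ r ∈ ({σ - kamM τ, σ + kamM τ} : Set ℝ), ∀ k : ℕ,
      mLip s r r (O (k + 1)) (fun w => ev (kamSol γ lam0 p0 k w)) ≤ ENNReal.ofReal
        ((16 * B + 32 * K + 2 * (L * B)) * kamScale γ⁻¹ k ^ (4 * τ + 2) *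
          kamScale γ⁻¹ (k - 1) ^ (-kamAlpha τ) * ε) := by
    intro r hr k
    refine (H.mLip_kamSol_le hr k).trans (ENNReal.ofReal_le_ofReal ?_)
    rw [hA, kamScale_natCast]
    change 2 * (L * (B * ε) * (kamNu γ⁻¹ (k + 1) ^ (4 * τ + 2) * kamNu γ⁻¹ k ^ (-kamAlpha τ))) ≤
      (16 * B + 32 * K + 2 * (L * B)) * kamNu γ⁻¹ (k + 1) ^ (4 * τ + 2) *
        kamNu γ⁻¹ k ^ (-kamAlpha τ) * ε
    have h1 : 0 ≤ kamNu γ⁻¹ k ^ (-kamAlpha τ) :=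
      Real.rpow_nonneg (zero_le_one.trans (hν1 k)) _
    have h2 : 0 ≤ kamNu γ⁻¹ (k + 1) ^ (4 * τ + 2) :=
      Real.rpow_nonneg (zero_le_one.trans (hν1 (k + 1))) _
    have h3 : 0 ≤ (16 * B + 32 * K) * kamNu γ⁻¹ (k + 1) ^ (4 * τ + 2) *
        kamNu γ⁻¹ k ^ (-kamAlpha τ) * ε := by positivity
    linarith
  have hinit : ∀ j, ∃ M, 0 ≤ M ∧ LipBd (fun x : ℂ => ‖x‖ₑ) (O 0) (kamLam γ lam0 p0 0 j) M := by
    intro j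
    have hsub : O₀ ⊆ paramBox n d := fun w hw => hw.1
    have hKε : 0 ≤ K * ε := by positivity
    obtain ⟨M, hM, h⟩ := exists_lipBd_initEig (O := O₀) (ν₀ := ν₀) (z := z) (K₁ := K * ε / γ)
      (K₃ := K * ε) (by positivity) (by positivity) hsub
      (fun w hw => norm_le_of_lipNormVal_le hKε hν (hsub hw))
      (fun w₁ h₁ w₂ h₂ => norm_sub_le_of_lipNormVal_le hγ hKε hν (hsub h₁) (hsub h₂)) j
      (lipBd_of_lipNorm_le enorm_zero (hz (intVec j)))
    refine ⟨M, hM, h.congr fun w _ => ?_⟩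
    exact add_zero _
  choose M hM hM' using hinit
  obtain ⟨lamExt, hE1, hE2, hE3⟩ := exists_extensions (O := O) (fun k w hw => hw.1) hM
    (fun k j => mul_nonneg (Real.rpow_nonneg (jap_pos j).le _) ENNReal.toReal_nonneg) hM'
    (fun k j => H.lipBd_kamLam_succ_sub k j)
  have hE4 : ∀ (k : ℕ) (j : Fin d → ℤ),
      lipNormVal 1 O₀ (fun w => lamExt (k + 1) j w - lamExt k j w) ≤
        ENNReal.ofReal (4 * jap j ^ (-(2 * kamM τ))) *
          mLip s (σ - kamM τ) (σ + kamM τ) (O k) (P k) := by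
    intro k j
    have hj : 0 ≤ 4 * jap j ^ (-(2 * kamM τ)) :=
      mul_nonneg (by norm_num) (Real.rpow_nonneg (jap_pos j).le _)
    refine (hE3 k j).trans (le_of_eq ?_)
    rw [hPlip, ← mul_assoc, ENNReal.ofReal_mul hj, ENNReal.ofReal_toReal]
    exact ((H.mLip_kamState_le k).trans_lt ENNReal.ofReal_lt_top).ne
  refine ⟨fun k j w => (kamState γ lam0 p0 w k).1 j, P, fun k w => ev (kamSol γ lam0 p0 k w),
    kamLam γ lam0 p0, lamExt, O, fun _ _ _ => rfl, fun _ => rfl, fun _ _ => rfl,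
    funext fun w => if_pos rfl, fun k j => ?_, fun k w hw => ?_, hlow, fun k => ?_,
    fun k w hw => ⟨?_, ?_, ?_⟩, fun k => ⟨hXlip _ (by simp) k, hXlip _ (by simp) k⟩,
    fun hpar k w hw => ?_, hE1, hE2, fun k j => ⟨hE4 k j, ?_⟩⟩
  · refine (H.lipNormVal_rho_le k j).trans (ENNReal.ofReal_le_ofReal ?_)
    rw [hA]
    have hj : 0 ≤ jap j ^ (-(2 * kamM τ)) := Real.rpow_nonneg (jap_pos j).le _
    have h1 : 0 ≤ (8 * B + 32 * K + 2 * (L * B)) * ε * jap j ^ (-(2 * kamM τ)) := by positivity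
    linarith
  · rw [hPk k w hw]
    exact memM_ev H.lt_two_mul_s (H.nrm_kamState_lt_top hw)
  · rw [hPhigh]
    refine (H.mLipHigh_kamState_le k).trans (ENNReal.ofReal_le_ofReal ?_)
    change 4 * (2 * (K * ε) * kamNu γ⁻¹ k) ≤ (2 * B + 8 * K) * kamNu γ⁻¹ k * ε
    have h1 : 0 ≤ 2 * B * kamNu γ⁻¹ k * ε := by
      have := hν1 k
      positivity
    linarith
  · exact memM_ev H.lt_two_mul_s (H.nrm_kamSol_lt_top hw (by simp))
  · exact memM_ev H.lt_two_mul_s (H.nrm_kamSol_lt_top hw (by simp))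
  · rw [hPk k w hw.1, hPk (k + 1) w hw]
    exact H.isPushforward hw
  · obtain ⟨h1, h2, h3, h4⟩ := hpar w (hOsub k hw)
    have hw0 := hOsub k hw
    rw [← hP₀ w hw0] at h1 h2
    obtain ⟨h5, h6⟩ := kamState_parity (γ := γ) (lam0 := lam0) (p0 := p0)
      (hasParity_of_real_of_reversible (hts w hw0) h1 h2) (initEig_parity h3 h4) k
    rw [hPk k w hw]
    refine ⟨h5.isRealFamily, h5.isReversibleFamily, fun j => ?_⟩
    have h7 := congrArg Complex.re (h6 j).1
    rw [Complex.conj_re, Complex.neg_re] at h7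
    linarith
  · refine (hE4 k j).trans ((mul_le_mul_right (hlow k) _).trans ?_)
    have hj : 0 ≤ jap j ^ (-(2 * kamM τ)) := Real.rpow_nonneg (jap_pos j).le _
    rw [← ENNReal.ofReal_mul (by positivity)]
    refine ENNReal.ofReal_le_ofReal ?_
    change 4 * jap j ^ (-(2 * kamM τ)) * ((2 * B + 8 * K) * kamNu γ⁻¹ k ^ (-kamAlpha τ) * ε) ≤
      (16 * B + 32 * K + 2 * (L * B)) * jap j ^ (-(2 * kamM τ)) *
        kamNu γ⁻¹ k ^ (-kamAlpha τ) * ε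
    have h1 : 0 ≤ kamNu γ⁻¹ k ^ (-kamAlpha τ) :=
      Real.rpow_nonneg (zero_le_one.trans (hν1 k)) _
    have h2 : 0 ≤ (8 * B + 2 * (L * B)) * jap j ^ (-(2 * kamM τ)) *
        kamNu γ⁻¹ k ^ (-kamAlpha τ) * ε := by positivity
    linarith
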